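/- Let $n\ge 2$, let $\Gamma\subset\mathbb C^{n-1}$ be either $\mathbb C^{n-1}$ or a bounded strictly pseudoconvex domain (with boundary of class $\mathscr C^2$), and let $\mu$ be a real-valued $\mathscr C^\infty$ function on an open neighbourhood of $\overline\Gamma$ with $\big(\frac{\partial^2\mu}{\partial z_j\partial\overline z_\ell}(z)\big)_{j,\ell=1}^{n-1}\ge 0$ for all $z\in\Gamma$. If $\Gamma=\mathbb C^{n-1}$, assume moreover that $\mu\ge 0$. Let $X=\Gamma\times\mathbb R$, with coordinates $(z,t)$, be the CR manifold whose bundle $T^{1,0}X$ is spanned by $\frac{\partial}{\partial z_j}+i\frac{\partial\mu}{\partial z_j}\frac{\partial}{\partial t}$, $1\le j\le n-1$, with the Hermitian metric for which these fields, their conjugates $\overline Z_j=\frac{\partial}{\partial\overline z_j}-i\frac{\partial\mu}{\partial\overline z_j}\frac{\partial}{\partial t}$ and $\frac{\partial}{\partial t}$ are orthonormal, and with the volume form $m=e^{-2|z|^2}d\lambda(z)\,dt$, where $d\lambda$ is Lebesgue measure on $\mathbb C^{n-1}$. Norms and inner products are those of $L^2(X)=L^2(X,m)$ and of the space $L^2_{(0,1)}(X)$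 of forms $\sum_j f_j\,d\overline z_j$ with $\|f\|^2=\sum_j\|f_j\|^2$. Let $\overline\partial_b u=\sum_j(\overline Z_ju)\,d\overline z_j$, with domain the set of $u\in L^2(X)$ for which $\overline\partial_bu$, taken in the sense of distributions, is in $L^2_{(0,1)}(X)$; let $\overline\partial_b^*$ be its Hilbert space adjoint, $\Box_b^{(0)}=\overline\partial_b^*\overline\partial_b$ with domain $\{s\in\mathrm{Dom}\,\overline\partial_b:\ \overline\partial_bs\in\mathrm{Dom}\,\overline\partial_b^*\}$, and $\Pi^{(0)}$ the orthogonal projection of $L^2(X)$ onto $\mathrm{Ker}\,\Box_b^{(0)}$. Let $\tau\in\mathscr C^\infty(\mathbb R,[0,1])$ with $\tau=0$ on $]-\infty,\frac14]$ and $\tau=1$ on $[\frac12,\infty[$. Then the operator $$Q^{(0)}u(z,t)=\frac1{2\pi}\int_{\mathbb R}\Big(\int_{\mathbb R} e^{i(t-\theta)\eta}\,u(z,\theta)\,\tau(\eta)\,d\theta\Big)d\eta,\qquad u\in\mathscr C^\infty_0(X),$$ extends uniquely to a continuous operator $Q^{(0)}:L^2(X)\to L^2(X)$, and there is a constant $C_0>0$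 such that $$\|Q^{(0)}(I-\Pi^{(0)})u\|^2\le C_0\,\|\overline\partial_bu\|^2\qquad\text{for all }u\in\mathscr C_0^\infty(X).$$ Moreover, $\Box_b^{(0)}$ has local $L^2$ closed range on $X$ with respect to $Q^{(0)}$: for every open set $D'$ whose closure is a compact subset of $X$ there are a constant $C_{D'}>0$ and an integer $p\ge 1$ such that, for every $u\in\mathscr C_0^\infty(D')$, $u\in\mathrm{Dom}\,(\Box_b^{(0)})^p$ and $$\|Q^{(0)}(I-\Pi^{(0)})u\|^2\le C_{D'}\,\big((\Box_b^{(0)})^pu\,\big|\,u\big).$$ -/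

import Mathlib

open MeasureTheory Set TopologicalSpace
open scoped ContDiff Distributions ENNReal ComplexConjugate ComplexOrder

noncomputable section

/-! ### Wirtinger calculus on `ℂ^d`

`ℂ^d` is `Fin d → ℂ` with coordinates `z_j = x_{2j-1} + i x_{2j}`; its `volume` is Lebesgue measure
`dx_1 ⋯ dx_{2d}`. -/

/-- `∂f/∂z_j = (∂f/∂x_{2j-1} - i ∂f/∂x_{2j}) / 2`. -/
def wirtingerD {d : ℕ} (j : Fin d) (f : (Fin d → ℂ) → ℂ) (z : Fin d → ℂ) : ℂ :=
  (fderiv ℝ f z (Pi.single j 1) - Complex.I * fderiv ℝ f z (Pi.single j Complex.I)) / 2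

/-- `∂f/∂z̄_j = (∂f/∂x_{2j-1} + i ∂f/∂x_{2j}) / 2`. -/
def wirtingerDbar {d : ℕ} (j : Fin d) (f : (Fin d → ℂ) → ℂ) (z : Fin d → ℂ) : ℂ :=
  (fderiv ℝ f z (Pi.single j 1) + Complex.I * fderiv ℝ f z (Pi.single j Complex.I)) / 2

/-- The complex Hessian `(∂²f/∂z_j∂z̄_l)_{j,l}` of a real function. -/
def leviMatrix {d : ℕ} (f : (Fin d → ℂ) → ℝ) (z : Fin d → ℂ) : Matrix (Fin d) (Fin d) ℂ :=
  fun j l => wirtingerD j (fun w => wirtingerDbar l (fun v => (f v : ℂ)) w) z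

/-- A bounded strictly pseudoconvex domain in `ℂ^d`: a bounded connected open set with a defining
function `ρ` of class `C²` near the boundary, with `dρ ≠ 0` on the boundary, whose Levi form is
positive definite on the complex tangent space `{w | ∑_j ∂ρ/∂z_j w_j = 0}` at each boundary point. -/
def IsBoundedStrictlyPseudoconvexDomain {d : ℕ} (Γ : Set (Fin d → ℂ)) : Prop :=
  IsOpen Γ ∧ IsConnected Γ ∧ Bornology.IsBounded Γ ∧
    ∃ (U : Set (Fin d → ℂ)) (ρ : (Fin d → ℂ) → ℝ),
      IsOpen U ∧ frontier Γ ⊆ U ∧ ContDiffOn ℝ 2 ρ U ∧ Γ ∩ U = {z ∈ U | ρ z < 0} ∧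
      ∀ p ∈ frontier Γ, fderiv ℝ ρ p ≠ 0 ∧
        ∀ w : Fin d → ℂ, w ≠ 0 → ∑ j, wirtingerD j (fun v => (ρ v : ℂ)) p * w j = 0 →
          0 < (∑ j, ∑ l, leviMatrix ρ p j l * w j * conj (w l)).re

/-! ### The CR manifold `X = Γ × ℝ` -/

/-- The data of the CR manifold `X = Γ × ℝ`, with coordinates `(z, t)`, whose CR structure
`T^{1,0}X` is spanned by `∂/∂z_j + i (∂μ/∂z_j) ∂/∂t`, `j = 1, …, d`: an open set `Γ ⊆ ℂ^d` and a
smooth real function `μ` on `Γ`. -/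
structure TubeCR (d : ℕ) where
  /-- the base `Γ` -/
  base : Set (Fin d → ℂ)
  isOpen_base : IsOpen base
  /-- the weight `μ` (only its values on the base matter) -/
  weight : (Fin d → ℂ) → ℝ
  contDiffOn_weight : ContDiffOn ℝ ∞ weight base

namespace TubeCR

variable {d : ℕ} (X : TubeCR d)

/-- The open set `X = Γ × ℝ` of `ℂ^d × ℝ`. -/
def carrier : Opens ((Fin d → ℂ) × ℝ) :=
  ⟨X.base ×ˢ univ, X.isOpen_base.prod isOpen_univ⟩

/-- The density `e^{-2|z|²}`, where `|z|² = ∑_j |z_j|²`. -/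
def density (x : (Fin d → ℂ) × ℝ) : ℝ := Real.exp (-2 * ∑ j, ‖x.1 j‖ ^ 2)

/-- The volume form `m = e^{-2|z|²} dx_1 ⋯ dx_{2d} dt` on `X`, as a measure. -/
def measure : Measure ((Fin d → ℂ) × ℝ) :=
  (volume.withDensity fun x => ENNReal.ofReal (density x)).restrict X.carrier

/-- `L²(X)`. -/
abbrev L2 : Type := Lp ℂ 2 X.measure

/-- `L²_{(0,1)}(X)`: the `(0,1)` form `∑_j f_j dz̄_j` is written as `f = (f_1, …, f_d)`; the forms
`dz̄_j` are orthonormal and dual to the vector fields `∂/∂z̄_j - i (∂μ/∂z̄_j) ∂/∂t`. -/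
abbrev L2Form : Type := Lp (EuclideanSpace ℂ (Fin d)) 2 X.measure

/-- The vector field `Z̄_j = ∂/∂z̄_j - i (∂μ/∂z̄_j) ∂/∂t`, spanning `T^{0,1}X`. -/
def Zbar (j : Fin d) (u : (Fin d → ℂ) × ℝ → ℂ) (x : (Fin d → ℂ) × ℝ) : ℂ :=
  (fderiv ℝ u x (Pi.single j 1, 0) + Complex.I * fderiv ℝ u x (Pi.single j Complex.I, 0)) / 2
    - Complex.I * wirtingerDbar j (fun z => (X.weight z : ℂ)) x.1 * fderiv ℝ u x (0, 1)

/-- The tangential Cauchy-Riemann operator on smooth functions: `∂̄_b u = ∑_j (Z̄_j u) dz̄_j`. -/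
def smoothDbar (u : (Fin d → ℂ) × ℝ → ℂ) (x : (Fin d → ℂ) × ℝ) : EuclideanSpace ℂ (Fin d) :=
  WithLp.toLp 2 fun j => X.Zbar j u x

lemma continuous_density : Continuous (density (d := d)) := by
  unfold density; fun_prop

lemma density_pos (x : (Fin d → ℂ) × ℝ) : 0 < density x := Real.exp_pos _

instance : IsLocallyFiniteMeasure X.measure := by
  have : IsLocallyFiniteMeasure
      ((volume : Measure ((Fin d → ℂ) × ℝ)).withDensity fun x => ENNReal.ofReal (density x)) :=
    IsLocallyFiniteMeasure.withDensity_ofReal continuous_density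
  unfold measure; infer_instance

lemma memLp_test (u : 𝓓(X.carrier, ℂ)) : MemLp u 2 X.measure :=
  u.continuous.memLp_of_hasCompactSupport u.hasCompactSupport

/-- The class in `L²(X)` of a function in `C_0^∞(X)`. -/
def toL2 (u : 𝓓(X.carrier, ℂ)) : X.L2 := (X.memLp_test u).toLp u

/-- `∂̄_b u = f` in the sense of distributions on `X` (the transpose of `Z̄_j` with respect to
`dx_1 ⋯ dx_{2d} dt` is `-Z̄_j`). -/
def IsWeakDbar (u : X.L2) (f : X.L2Form) : Prop :=
  ∀ (φ : 𝓓(X.carrier, ℂ)) (j : Fin d),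
    ∫ x in (X.carrier : Set _), f x j * φ x = -∫ x in (X.carrier : Set _), u x * X.Zbar j φ x

lemma continuous_Zbar (φ : 𝓓(X.carrier, ℂ)) (j : Fin d) : Continuous (X.Zbar j φ) := by
  have hφ : Continuous (fderiv ℝ φ) := φ.contDiff.continuous_fderiv (by simp)
  rw [continuous_iff_continuousAt]
  intro x
  by_cases hx : x ∈ tsupport φ
  · have hb : x.1 ∈ X.base := (φ.tsupport_subset hx).1
    have hμ : ContinuousOn (fderiv ℝ fun z => (X.weight z : ℂ)) X.base :=
      (Complex.ofRealCLM.contDiff.comp_contDiffOn X.contDiffOn_weight).continuousOn_fderiv_of_isOpen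
        X.isOpen_base (by simp)
    have hμx : ContinuousAt (fun y : (Fin d → ℂ) × ℝ => fderiv ℝ (fun z => (X.weight z : ℂ)) y.1)
        x := (hμ.continuousAt (X.isOpen_base.mem_nhds hb)).comp (f := Prod.fst) continuousAt_fst
    have h1 : ∀ v, ContinuousAt (fun y => fderiv ℝ φ y v) x := fun v =>
      (hφ.clm_apply continuous_const).continuousAt
    have h2 : ∀ v, ContinuousAt (fun y : (Fin d → ℂ) × ℝ =>
        fderiv ℝ (fun z => (X.weight z : ℂ)) y.1 v) x := fun v =>
      hμx.clm_apply continuousAt_const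
    unfold Zbar wirtingerDbar
    exact (((h1 _).add (continuousAt_const.mul (h1 _))).div_const _).sub
      ((continuousAt_const.mul (((h2 _).add (continuousAt_const.mul (h2 _))).div_const _)).mul
        (h1 _))
  · have h0 : X.Zbar j φ =ᶠ[nhds x] fun _ => 0 := by
      filter_upwards [(isClosed_tsupport φ).isOpen_compl.mem_nhds hx] with y hy
      have : fderiv ℝ φ y = 0 := by
        by_contra h
        exact hy (support_fderiv_subset ℝ h)
      simp [Zbar, this]
    exact continuousAt_const.congr h0.symm

lemma hasCompactSupport_Zbar (φ : 𝓓(X.carrier, ℂ)) (j : Fin d) :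
    HasCompactSupport (X.Zbar j φ) := by
  refine (φ.hasCompactSupport.fderiv (𝕜 := ℝ)).mono fun y hy => ?_
  contrapose! hy
  have : fderiv ℝ φ y = 0 := by simpa using hy
  simp [Zbar, this]

/-- The pairing of an `L²` function with a continuous function of compact support, with respect to
Lebesgue measure on `X`, is defined by an integrable function. -/
lemma integrableOn_mul {g ψ : (Fin d → ℂ) × ℝ → ℂ} (hg : MemLp g 2 X.measure)
    (hψ : Continuous ψ) (hc : HasCompactSupport ψ) :
    IntegrableOn (fun x => g x * ψ x) (X.carrier : Set _) := by
  have hd : Continuous fun x : (Fin d → ℂ) × ℝ => ((density x : ℂ))⁻¹ :=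
    (Complex.continuous_ofReal.comp continuous_density).inv₀ fun x => by
      simpa using (density_pos x).ne'
  have h1 : MemLp (fun x => ((density x : ℂ))⁻¹ * ψ x) 2 X.measure :=
    (hd.mul hψ).memLp_of_hasCompactSupport (hc.mul_left)
  have h2 : Integrable (fun x => g x * (((density x : ℂ))⁻¹ * ψ x)) X.measure :=
    hg.integrable_mul h1
  have hm : Measurable fun x : (Fin d → ℂ) × ℝ => ENNReal.ofReal (density x) :=
    (continuous_density.measurable).ennreal_ofReal
  rw [measure, restrict_withDensity X.carrier.isOpen.measurableSet,
    integrable_withDensity_iff_integrable_smul' hm (by simp)] at h2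
  refine h2.congr (Filter.Eventually.of_forall fun x => ?_)
  have hx : (density x : ℂ) ≠ 0 := by simpa using (density_pos x).ne'
  simp only [ENNReal.toReal_ofReal (density_pos x).le, Complex.real_smul]
  field_simp

lemma memLp_coord (f : X.L2Form) (j : Fin d) : MemLp (fun x => f x j) 2 X.measure :=
  (EuclideanSpace.proj (𝕜 := ℂ) j : EuclideanSpace ℂ (Fin d) →L[ℂ] ℂ).comp_memLp' (Lp.memLp f)

lemma integrableOn_form_mul (f : X.L2Form) (φ : 𝓓(X.carrier, ℂ)) (j : Fin d) :
    IntegrableOn (fun x => f x j * φ x) (X.carrier : Set _) :=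
  X.integrableOn_mul (X.memLp_coord f j) φ.continuous φ.hasCompactSupport

lemma integrableOn_mul_Zbar (u : X.L2) (φ : 𝓓(X.carrier, ℂ)) (j : Fin d) :
    IntegrableOn (fun x => u x * X.Zbar j φ x) (X.carrier : Set _) :=
  X.integrableOn_mul (Lp.memLp u) (X.continuous_Zbar φ j) (X.hasCompactSupport_Zbar φ j)

lemma ae_carrier {P : (Fin d → ℂ) × ℝ → Prop} :
    (∀ᵐ x ∂X.measure, P x) ↔ ∀ᵐ x ∂(volume.restrict (X.carrier : Set _)), P x := by
  have hm : Measurable fun x : (Fin d → ℂ) × ℝ => ENNReal.ofReal (density x) :=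
    (continuous_density.measurable).ennreal_ofReal
  rw [measure, restrict_withDensity X.carrier.isOpen.measurableSet, ae_withDensity_iff hm]
  simp [density_pos]

/-- The graph of `∂̄_b`. -/
def dbarGraph : Submodule ℂ (X.L2 × X.L2Form) where
  carrier := {p | X.IsWeakDbar p.1 p.2}
  zero_mem' := fun φ j => by
    have h1 := X.ae_carrier.1 (Lp.coeFn_zero ℂ 2 X.measure)
    have h2 := X.ae_carrier.1 (Lp.coeFn_zero (EuclideanSpace ℂ (Fin d)) 2 X.measure)
    rw [integral_eq_zero_of_ae, integral_eq_zero_of_ae, neg_zero]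
    · filter_upwards [h1] with x hx
      change (0 : X.L2) x * _ = 0
      rw [hx]; simp
    · filter_upwards [h2] with x hx
      change (0 : X.L2Form) x j * _ = 0
      rw [hx]; simp
  add_mem' := fun {p q} hp hq φ j => by
    have h1 := X.ae_carrier.1 (Lp.coeFn_add p.1 q.1)
    have h2 := X.ae_carrier.1 (Lp.coeFn_add p.2 q.2)
    have e1 : ∫ x in (X.carrier : Set _), (p + q).1 x * X.Zbar j φ x
        = ∫ x in (X.carrier : Set _), (p.1 x * X.Zbar j φ x + q.1 x * X.Zbar j φ x) := by
      refine integral_congr_ae ?_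
      filter_upwards [h1] with x hx
      change (p.1 + q.1 : X.L2) x * _ = _
      rw [hx, Pi.add_apply, add_mul]
    have e2 : ∫ x in (X.carrier : Set _), (p + q).2 x j * φ x
        = ∫ x in (X.carrier : Set _), (p.2 x j * φ x + q.2 x j * φ x) := by
      refine integral_congr_ae ?_
      filter_upwards [h2] with x hx
      change (p.2 + q.2 : X.L2Form) x j * _ = _
      rw [hx, Pi.add_apply, PiLp.add_apply, add_mul]
    rw [e1, e2, integral_add (X.integrableOn_mul_Zbar _ _ _) (X.integrableOn_mul_Zbar _ _ _),
      integral_add (X.integrableOn_form_mul _ _ _) (X.integrableOn_form_mul _ _ _), hp φ j,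
      hq φ j, neg_add]
  smul_mem' := fun c p hp φ j => by
    have h1 := X.ae_carrier.1 (Lp.coeFn_smul c p.1)
    have h2 := X.ae_carrier.1 (Lp.coeFn_smul c p.2)
    have e1 : ∫ x in (X.carrier : Set _), (c • p).1 x * X.Zbar j φ x
        = ∫ x in (X.carrier : Set _), c * (p.1 x * X.Zbar j φ x) := by
      refine integral_congr_ae ?_
      filter_upwards [h1] with x hx
      simp [hx, mul_assoc]
    have e2 : ∫ x in (X.carrier : Set _), (c • p).2 x j * φ x
        = ∫ x in (X.carrier : Set _), c * (p.2 x j * φ x) := by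
      refine integral_congr_ae ?_
      filter_upwards [h2] with x hx
      simp [hx, mul_assoc]
    rw [e1, e2, integral_const_mul, integral_const_mul, hp φ j, mul_neg]

/-- A distributional `∂̄_b u` in `L²` is unique. -/
lemma dbarGraph_functional (p : X.L2 × X.L2Form) (hp : p ∈ X.dbarGraph) (h0 : p.1 = 0) :
    p.2 = 0 := by
  have key : ∀ j, ∀ᵐ x, x ∈ (X.carrier : Set _) → p.2 x j = 0 := by
    intro j
    refine X.carrier.isOpen.ae_eq_zero_of_integral_contDiff_smul_eq_zero ?_ ?_
    · rw [locallyIntegrableOn_iff X.carrier.isOpen.isLocallyClosed]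
      intro k hk hkc
      obtain ⟨g, hg1, -, hgc, -⟩ := exists_continuous_one_zero_of_isCompact hkc isClosed_empty
        (disjoint_empty k)
      have h := X.integrableOn_mul (ψ := fun x => (g x : ℂ)) (X.memLp_coord p.2 j)
        (by fun_prop) (hgc.comp_left (g := ((↑) : ℝ → ℂ)) Complex.ofReal_zero)
      refine (h.mono_set hk).congr_fun (fun x hx => ?_) hkc.measurableSet
      simp [hg1 hx]
    · intro g hg hgc hgs
      let φ : 𝓓(X.carrier, ℂ) := ⟨fun x => (g x : ℂ), Complex.ofRealCLM.contDiff.comp hg,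
        hgc.comp_left (g := ((↑) : ℝ → ℂ)) Complex.ofReal_zero,
        (closure_mono (Function.support_comp_subset (g := ((↑) : ℝ → ℂ)) Complex.ofReal_zero g)).trans hgs⟩
      have h1 := hp φ j
      have h2 : ∫ x in (X.carrier : Set _), p.1 x * X.Zbar j φ x = 0 := by
        refine integral_eq_zero_of_ae ?_
        filter_upwards [X.ae_carrier.1 (Lp.coeFn_zero ℂ 2 X.measure)] with x hx
        rw [h0, hx]; simp
      rw [h2, neg_zero, setIntegral_eq_integral_of_forall_compl_eq_zero] at h1
      · rw [← h1]
        exact integral_congr_ae (Filter.Eventually.of_forall fun x => by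
          change g x • p.2 x j = p.2 x j * (g x : ℂ)
          rw [Complex.real_smul, mul_comm])
      · intro x hx
        have : x ∉ tsupport φ := fun h => hx (φ.tsupport_subset h)
        simp [image_eq_zero_of_notMem_tsupport this]
  refine Lp.eq_zero_iff_ae_eq_zero.2 (X.ae_carrier.2 ?_)
  rw [ae_restrict_iff' X.carrier.isOpen.measurableSet]
  filter_upwards [ae_all_iff.2 key] with x hx hxc
  ext j
  exact hx j hxc

/-- `∂̄_b : Dom ∂̄_b ⊆ L²(X) → L²_{(0,1)}(X)`, where `Dom ∂̄_b` consists of the `u ∈ L²(X)` whose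
distributional `∂̄_b u` is in `L²_{(0,1)}(X)`. -/
def dbar : X.L2 →ₗ.[ℂ] X.L2Form := X.dbarGraph.toLinearPMap

lemma mem_graph_dbar (u : X.L2) (f : X.L2Form) :
    (u, f) ∈ X.dbar.graph ↔ X.IsWeakDbar u f := by
  rw [dbar, Submodule.toLinearPMap_graph_eq _ X.dbarGraph_functional]
  rfl

/-- The Kohn Laplacian `□_b^{(0)} = ∂̄_b^* ∂̄_b` on functions, with the Hilbert space adjoint
`∂̄_b^*` and domain `{s ∈ Dom ∂̄_b | ∂̄_b s ∈ Dom ∂̄_b^*}`. -/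
def kohnLaplacian : X.L2 →ₗ.[ℂ] X.L2 :=
  X.dbar.adjoint.comp
    (X.dbar.domRestrict ((X.dbar.adjoint.domain.comap X.dbar.toFun).map X.dbar.domain.subtype))
    fun x => by
      obtain ⟨y, hy, hyx⟩ := x.2.1
      have h : X.dbar.domRestrict _ x = X.dbar y := LinearPMap.domRestrict_apply hyx.symm
      rw [h]
      exact hy

/-- The kernel of `□_b^{(0)}`. -/
def kohnKernel : Submodule ℂ X.L2 :=
  X.kohnLaplacian.toFun.ker.map X.kohnLaplacian.domain.subtype

/-- The Szegő projector `Π^{(0)}`: the orthogonal projection of `L²(X)` onto `Ker □_b^{(0)}` (which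
is closed, `□_b^{(0)}` being self-adjoint, so that the closure adds nothing). -/
def szego : X.L2 →L[ℂ] X.L2 := X.kohnKernel.topologicalClosure.starProjection

/-- `u ∈ Dom (□_b^{(0)})^p` and `(□_b^{(0)})^p u = w`. -/
def IsKohnPow : ℕ → X.L2 → X.L2 → Prop
  | 0, u, w => u = w
  | p + 1, u, w => ∃ v, IsKohnPow p u v ∧ (v, w) ∈ X.kohnLaplacian.graph

/-- `□_b^{(0)}` has local `L²` closed range on the open set `D ⊆ X` with respect to the continuous
operator `Q` on `L²(X)`: for every open `D' ⋐ D` there are `C > 0` and an integer `p ≥ 1` with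
`‖Q (I - Π^{(0)}) u‖² ≤ C ((□_b^{(0)})^p u | u)` for all `u ∈ C_0^∞(D')`. -/
def HasLocalL2ClosedRange (Q : X.L2 →L[ℂ] X.L2) (D : Set ((Fin d → ℂ) × ℝ)) : Prop :=
  ∀ D' : Set ((Fin d → ℂ) × ℝ), IsOpen D' → IsCompact (closure D') → closure D' ⊆ D →
    ∃ C : ℝ, 0 < C ∧ ∃ p : ℕ, 1 ≤ p ∧ ∀ u : 𝓓(X.carrier, ℂ), tsupport u ⊆ D' →
      ∃ w, X.IsKohnPow p (X.toL2 u) w ∧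
        ‖Q (X.toL2 u - X.szego (X.toL2 u))‖ ^ 2 ≤ C * (inner ℂ w (X.toL2 u)).re

end TubeCR

/-! ### The positive-frequency cutoff -/

/-- `(1/2π) ∫ e^{i(t-θ)η} u(z,θ) τ(η) dθ dη`, as an iterated integral. -/
def frequencyCutoff {d : ℕ} (τ : ℝ → ℝ) (u : (Fin d → ℂ) × ℝ → ℂ) (x : (Fin d → ℂ) × ℝ) : ℂ :=
  (1 / (2 * Real.pi) : ℂ) *
    ∫ η : ℝ, ∫ θ : ℝ, Complex.exp (Complex.I * ((x.2 - θ : ℝ) : ℂ) * (η : ℂ)) * u (x.1, θ) * (τ η : ℂ)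

/-- `Q` is the continuous extension to `L²(X)` of the frequency cutoff on `C_0^∞(X)`. -/
def TubeCR.IsFrequencyCutoff {d : ℕ} (X : TubeCR d) (τ : ℝ → ℝ) (Q : X.L2 →L[ℂ] X.L2) : Prop :=
  ∀ u : 𝓓(X.carrier, ℂ), (Q (X.toL2 u) : _ → ℂ) =ᵐ[X.measure] frequencyCutoff τ u

end

/-!
After a Fourier transform in `t`, with dual variable `η`, the vector fields `Z̄_j` become
`∂̄_j + η μ_{z̄_j}`, and multiplication by `e^{-|z|²}` turns `L²(Γ, e^{-2|z|²} dλ)` into the unweighted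
`L²(Γ)`. For `η ≥ 0` the operator `∂̄_b` is then a family of operators `∂̄ + ∂̄ψ` (`twistedDbar`) on `Γ`
with weights `ψ = η μ + |z|²`, whose Levi form is at least `1`, uniformly in `η`, because `μ` is
plurisubharmonic. Since `τ` vanishes on the negative frequencies, Hörmander's `L²` theory on `Γ`
gives the estimate with constant `2`.

The `L²` theory is used in dual form: `|((∂̄ + ∂̄ψ) u, g)|² ≤ 2 ‖(∂̄ + ∂̄ψ) u‖² ‖(∂̄ + ∂̄ψ)^* g‖²` for test
functions `u` and test forms `g` on `Γ`. Its source is the Bochner-Kodaira-Hörmander inequality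
(`leviForm_le_of_contDiff`), which is extended by mollification to compactly supported `L²` forms
(`leviForm_le_of_weak`) and applied to a cutoff of the projection of `g` to the closure of the exact
forms (`norm_integral_twistedDbar_sq_le`). The derivatives of the cutoff function are absorbed by
making the weight steep near the boundary, between the supports of `u` and `g` and `∂Γ`, with the
help of a strictly plurisubharmonic defining function
(`norm_integral_twistedDbar_sq_le_of_exhaustion`); no boundary regularity of solutions is needed.
For `Γ = ℂ^d` the domain is replaced by a ball. Integration over the frequencies
(`TubeCR.norm_inner_formalAdjoint_multiplier_sq_le`) gives
`|(Q u | ϑ g)|² ≤ 2 ‖∂̄_b u‖² ‖ϑ g‖²` on `X`, where `ϑ` is the formal adjoint of `∂̄_b`.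

The kernel of `□_b` is the kernel of `∂̄_b`, that is the orthogonal complement of the range of `ϑ`
(`TubeCR.kohnKernel_eq`). As this range is invariant under translations in `t`, its orthogonal
complement is invariant under the self-adjoint operator `Q`
(`TubeCR.inner_formalAdjoint_multiplier_eq_zero`). Hence `Q (I - Π) u` lies in the closure of the
range of `ϑ` and pairs with the elements of this range as `Q u` does, and the estimate above bounds
its norm (`TubeCR.norm_multiplier_sub_szego_sq_le`). Finally `(□_b u | u) = ‖∂̄_b u‖²` for test
functions, so that local closed range holds with `p = 1` and `C = 2`.
-/

noncomputable section

/-! ### Wirtinger calculus -/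

section Wirtinger

variable {d : ℕ} {f g : (Fin d → ℂ) → ℂ} {z : Fin d → ℂ}

lemma wirtingerD_congr (j : Fin d) (h : f =ᶠ[nhds z] g) : wirtingerD j f z = wirtingerD j g z := by
  simp only [wirtingerD, h.fderiv_eq]

lemma wirtingerDbar_congr (j : Fin d) (h : f =ᶠ[nhds z] g) :
    wirtingerDbar j f z = wirtingerDbar j g z := by
  simp only [wirtingerDbar, h.fderiv_eq]

lemma wirtingerD_conj (j : Fin d) (f : (Fin d → ℂ) → ℂ) (z : Fin d → ℂ) :
    wirtingerD j (fun w => conj (f w)) z = conj (wirtingerDbar j f z) := by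
  have h : fderiv ℝ (fun w => conj (f w)) z
      = (Complex.conjCLE : ℂ →L[ℝ] ℂ).comp (fderiv ℝ f z) :=
    Complex.conjCLE.comp_fderiv
  simp only [wirtingerD, wirtingerDbar, h]
  simp [sub_eq_add_neg, map_ofNat]

lemma wirtingerDbar_conj (j : Fin d) (f : (Fin d → ℂ) → ℂ) (z : Fin d → ℂ) :
    wirtingerDbar j (fun w => conj (f w)) z = conj (wirtingerD j f z) := by
  have := wirtingerD_conj j (fun w => conj (f w)) z
  simp only [Complex.conj_conj] at this
  rw [this, Complex.conj_conj]

lemma conj_wirtingerD_ofReal (j : Fin d) (ψ : (Fin d → ℂ) → ℝ) (z : Fin d → ℂ) :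
    conj (wirtingerD j (fun w => (ψ w : ℂ)) z) = wirtingerDbar j (fun w => (ψ w : ℂ)) z := by
  rw [← wirtingerDbar_conj]; simp

lemma conj_wirtingerDbar_ofReal (j : Fin d) (ψ : (Fin d → ℂ) → ℝ) (z : Fin d → ℂ) :
    conj (wirtingerDbar j (fun w => (ψ w : ℂ)) z) = wirtingerD j (fun w => (ψ w : ℂ)) z := by
  rw [← wirtingerD_conj]; simp

lemma wirtingerD_add (j : Fin d) (hf : DifferentiableAt ℝ f z) (hg : DifferentiableAt ℝ g z) :
    wirtingerD j (fun w => f w + g w) z = wirtingerD j f z + wirtingerD j g z := by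
  simp only [wirtingerD, fderiv_fun_add hf hg, _root_.add_apply]; ring

lemma wirtingerDbar_add (j : Fin d) (hf : DifferentiableAt ℝ f z) (hg : DifferentiableAt ℝ g z) :
    wirtingerDbar j (fun w => f w + g w) z = wirtingerDbar j f z + wirtingerDbar j g z := by
  simp only [wirtingerDbar, fderiv_fun_add hf hg, _root_.add_apply]; ring

lemma wirtingerDbar_sub (j : Fin d) (hf : DifferentiableAt ℝ f z) (hg : DifferentiableAt ℝ g z) :
    wirtingerDbar j (fun w => f w - g w) z = wirtingerDbar j f z - wirtingerDbar j g z := by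
  simp only [wirtingerDbar, fderiv_fun_sub hf hg, _root_.sub_apply]; ring

lemma wirtingerD_mul (j : Fin d) (hf : DifferentiableAt ℝ f z) (hg : DifferentiableAt ℝ g z) :
    wirtingerD j (fun w => f w * g w) z = f z * wirtingerD j g z + g z * wirtingerD j f z := by
  simp only [wirtingerD, fderiv_fun_mul hf hg, _root_.add_apply,
    _root_.smul_apply, smul_eq_mul]
  ring

lemma wirtingerDbar_mul (j : Fin d) (hf : DifferentiableAt ℝ f z) (hg : DifferentiableAt ℝ g z) :
    wirtingerDbar j (fun w => f w * g w) z
      = f z * wirtingerDbar j g z + g z * wirtingerDbar j f z := by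
  simp only [wirtingerDbar, fderiv_fun_mul hf hg, _root_.add_apply,
    _root_.smul_apply, smul_eq_mul]
  ring

lemma wirtingerDbar_const_mul (j : Fin d) (c : ℂ) (hf : DifferentiableAt ℝ f z) :
    wirtingerDbar j (fun w => c * f w) z = c * wirtingerDbar j f z := by
  rw [wirtingerDbar_mul j (by fun_prop) hf]
  simp [wirtingerDbar]

/-- The chain rule for a real function of one variable applied to a real function on `ℂ^d`. -/
lemma wirtingerD_comp_real (j : Fin d) {p : ℝ → ℝ} {p' : ℝ} {s : (Fin d → ℂ) → ℝ}
    (hp : HasDerivAt p p' (s z)) (hs : DifferentiableAt ℝ s z) :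
    wirtingerD j (fun w => ((p (s w) : ℝ) : ℂ)) z
      = p' * wirtingerD j (fun w => (s w : ℂ)) z := by
  have h1 : HasFDerivAt (fun w => ((p (s w) : ℝ) : ℂ))
      (Complex.ofRealCLM.comp (p' • fderiv ℝ s z)) z :=
    Complex.ofRealCLM.hasFDerivAt.comp z (hp.comp_hasFDerivAt z hs.hasFDerivAt)
  have h2 : HasFDerivAt (fun w => ((s w : ℝ) : ℂ)) (Complex.ofRealCLM.comp (fderiv ℝ s z)) z :=
    Complex.ofRealCLM.hasFDerivAt.comp z hs.hasFDerivAt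
  simp only [wirtingerD, h1.fderiv, h2.fderiv]
  simp only [ContinuousLinearMap.coe_comp, Function.comp_apply, _root_.smul_apply,
    Complex.ofRealCLM_apply, smul_eq_mul, Complex.ofReal_mul]
  ring

lemma wirtingerDbar_comp_real (j : Fin d) {p : ℝ → ℝ} {p' : ℝ} {s : (Fin d → ℂ) → ℝ}
    (hp : HasDerivAt p p' (s z)) (hs : DifferentiableAt ℝ s z) :
    wirtingerDbar j (fun w => ((p (s w) : ℝ) : ℂ)) z
      = p' * wirtingerDbar j (fun w => (s w : ℂ)) z := by
  rw [← conj_wirtingerD_ofReal, ← conj_wirtingerD_ofReal, wirtingerD_comp_real j hp hs]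
  simp

lemma ContDiffOn.wirtingerD {n m : WithTop ℕ∞} {s : Set (Fin d → ℂ)} (hf : ContDiffOn ℝ n f s)
    (hs : IsOpen s) (hmn : m + 1 ≤ n) (j : Fin d) : ContDiffOn ℝ m (wirtingerD j f) s := by
  have h := hf.fderiv_of_isOpen hs hmn
  unfold _root_.wirtingerD
  exact ((h.clm_apply contDiffOn_const).sub
    (contDiffOn_const.mul (h.clm_apply contDiffOn_const))).div_const _

lemma ContDiffOn.wirtingerDbar {n m : WithTop ℕ∞} {s : Set (Fin d → ℂ)} (hf : ContDiffOn ℝ n f s)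
    (hs : IsOpen s) (hmn : m + 1 ≤ n) (j : Fin d) : ContDiffOn ℝ m (wirtingerDbar j f) s := by
  have h := hf.fderiv_of_isOpen hs hmn
  unfold _root_.wirtingerDbar
  exact ((h.clm_apply contDiffOn_const).add
    (contDiffOn_const.mul (h.clm_apply contDiffOn_const))).div_const _

lemma ContDiff.wirtingerD {n m : WithTop ℕ∞} (hf : ContDiff ℝ n f) (hmn : m + 1 ≤ n) (j : Fin d) :
    ContDiff ℝ m (wirtingerD j f) :=
  contDiffOn_univ.1 (hf.contDiffOn.wirtingerD isOpen_univ hmn j)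

lemma ContDiff.wirtingerDbar {n m : WithTop ℕ∞} (hf : ContDiff ℝ n f) (hmn : m + 1 ≤ n)
    (j : Fin d) : ContDiff ℝ m (wirtingerDbar j f) :=
  contDiffOn_univ.1 (hf.contDiffOn.wirtingerDbar isOpen_univ hmn j)

lemma ContDiff.ofReal_comp {E : Type*} [NormedAddCommGroup E] [NormedSpace ℝ E] {n : WithTop ℕ∞}
    {ψ : E → ℝ} (hψ : ContDiff ℝ n ψ) : ContDiff ℝ n (fun z => (ψ z : ℂ)) :=
  Complex.ofRealCLM.contDiff.comp hψ

lemma ContDiff.conj_comp {E : Type*} [NormedAddCommGroup E] [NormedSpace ℝ E] {n : WithTop ℕ∞}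
    {u : E → ℂ} (hu : ContDiff ℝ n u) : ContDiff ℝ n (fun z => conj (u z)) :=
  Complex.conjCLE.contDiff.comp hu

lemma support_wirtingerD_subset (j : Fin d) (f : (Fin d → ℂ) → ℂ) :
    Function.support (wirtingerD j f) ⊆ tsupport f := by
  intro z hz
  by_contra h
  have : fderiv ℝ f z = 0 := by
    by_contra h'
    exact h (support_fderiv_subset ℝ h')
  exact hz (by simp [wirtingerD, this])

lemma support_wirtingerDbar_subset (j : Fin d) (f : (Fin d → ℂ) → ℂ) :
    Function.support (wirtingerDbar j f) ⊆ tsupport f := by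
  intro z hz
  by_contra h
  have : fderiv ℝ f z = 0 := by
    by_contra h'
    exact h (support_fderiv_subset ℝ h')
  exact hz (by simp [wirtingerDbar, this])

lemma wirtingerD_eq_zero (j : Fin d) (hz : z ∉ tsupport f) : wirtingerD j f z = 0 := by
  by_contra h; exact hz (support_wirtingerD_subset j f h)

lemma wirtingerDbar_eq_zero (j : Fin d) (hz : z ∉ tsupport f) : wirtingerDbar j f z = 0 := by
  by_contra h; exact hz (support_wirtingerDbar_subset j f h)

lemma HasCompactSupport.wirtingerD (hf : HasCompactSupport f) (j : Fin d) :
    HasCompactSupport (wirtingerD j f) :=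
  hf.mono' (support_wirtingerD_subset j f)

lemma HasCompactSupport.wirtingerDbar (hf : HasCompactSupport f) (j : Fin d) :
    HasCompactSupport (wirtingerDbar j f) :=
  hf.mono' (support_wirtingerDbar_subset j f)

lemma HasCompactSupport.conj_comp {E : Type*} [TopologicalSpace E] {u : E → ℂ}
    (hu : HasCompactSupport u) : HasCompactSupport (fun z => conj (u z)) :=
  hu.comp_left (g := (starRingEnd ℂ : ℂ → ℂ)) (map_zero _)

lemma fderiv_fderiv_apply {n : WithTop ℕ∞} (hn : 2 ≤ n) (hf : ContDiffAt ℝ n f z)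
    (v w : Fin d → ℂ) :
    fderiv ℝ (fun y => fderiv ℝ f y v) z w = fderiv ℝ (fderiv ℝ f) z w v := by
  have h : DifferentiableAt ℝ (fderiv ℝ f) z :=
    (hf.fderiv_right (m := 1) (by rwa [one_add_one_eq_two])).differentiableAt (by simp)
  rw [fderiv_clm_apply h (by fun_prop)]
  simp

lemma differentiableAt_fderiv_apply (hf : ContDiffAt ℝ 2 f z) (v : Fin d → ℂ) :
    DifferentiableAt ℝ (fun y => fderiv ℝ f y v) z :=
  ((hf.fderiv_right (m := 1) (by norm_num)).differentiableAt (by simp)).clm_apply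
    (differentiableAt_const _)

lemma fderiv_wirtingerD (hf : ContDiffAt ℝ 2 f z) (j : Fin d) (v : Fin d → ℂ) :
    fderiv ℝ (wirtingerD j f) z v = (fderiv ℝ (fderiv ℝ f) z v (Pi.single j 1)
      - Complex.I * fderiv ℝ (fderiv ℝ f) z v (Pi.single j Complex.I)) / 2 := by
  have h := fun v => differentiableAt_fderiv_apply hf v
  have e : wirtingerD j f = fun y => (2 : ℂ)⁻¹ * (fderiv ℝ f y (Pi.single j 1)
      - Complex.I * fderiv ℝ f y (Pi.single j Complex.I)) := by
    funext y; simp only [wirtingerD]; ring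
  rw [e, fderiv_const_mul ((h _).fun_sub ((h _).const_mul _)), _root_.smul_apply,
    fderiv_fun_sub (h _) ((h _).const_mul _), _root_.sub_apply,
    fderiv_const_mul (h _), _root_.smul_apply, fderiv_fderiv_apply le_rfl hf,
    fderiv_fderiv_apply le_rfl hf]
  simp only [smul_eq_mul]; ring

lemma fderiv_wirtingerDbar (hf : ContDiffAt ℝ 2 f z) (j : Fin d) (v : Fin d → ℂ) :
    fderiv ℝ (wirtingerDbar j f) z v = (fderiv ℝ (fderiv ℝ f) z v (Pi.single j 1)
      + Complex.I * fderiv ℝ (fderiv ℝ f) z v (Pi.single j Complex.I)) / 2 := by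
  have h := fun v => differentiableAt_fderiv_apply hf v
  have e : wirtingerDbar j f = fun y => (2 : ℂ)⁻¹ * (fderiv ℝ f y (Pi.single j 1)
      + Complex.I * fderiv ℝ f y (Pi.single j Complex.I)) := by
    funext y; simp only [wirtingerDbar]; ring
  rw [e, fderiv_const_mul ((h _).fun_add ((h _).const_mul _)), _root_.smul_apply,
    fderiv_fun_add (h _) ((h _).const_mul _), _root_.add_apply,
    fderiv_const_mul (h _), _root_.smul_apply, fderiv_fderiv_apply le_rfl hf,
    fderiv_fderiv_apply le_rfl hf]
  simp only [smul_eq_mul]; ring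

lemma fderiv_fderiv_comm (hf : ContDiffAt ℝ 2 f z) (v w : Fin d → ℂ) :
    fderiv ℝ (fderiv ℝ f) z v w = fderiv ℝ (fderiv ℝ f) z w v :=
  (hf.isSymmSndFDerivAt (by simp)).eq v w

lemma wirtingerDbar_wirtingerD_comm (hf : ContDiffAt ℝ 2 f z) (j k : Fin d) :
    wirtingerDbar k (wirtingerD j f) z = wirtingerD j (wirtingerDbar k f) z := by
  rw [wirtingerDbar, wirtingerD]
  simp only [fderiv_wirtingerD hf, fderiv_wirtingerDbar hf]
  rw [fderiv_fderiv_comm hf (Pi.single k 1), fderiv_fderiv_comm hf (Pi.single k 1),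
    fderiv_fderiv_comm hf (Pi.single k Complex.I), fderiv_fderiv_comm hf (Pi.single k Complex.I)]
  ring

lemma wirtingerDbar_wirtingerDbar_comm (hf : ContDiffAt ℝ 2 f z) (j k : Fin d) :
    wirtingerDbar k (wirtingerDbar j f) z = wirtingerDbar j (wirtingerDbar k f) z := by
  rw [wirtingerDbar, wirtingerDbar]
  simp only [fderiv_wirtingerDbar hf]
  rw [fderiv_fderiv_comm hf (Pi.single k 1), fderiv_fderiv_comm hf (Pi.single k 1),
    fderiv_fderiv_comm hf (Pi.single k Complex.I), fderiv_fderiv_comm hf (Pi.single k Complex.I)]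
  ring

lemma integral_mul_fderiv_of_hasCompactSupport {E : Type*} [NormedAddCommGroup E]
    [NormedSpace ℝ E] [FiniteDimensional ℝ E] [MeasurableSpace E] [BorelSpace E]
    {μ : Measure E} [μ.IsAddHaarMeasure] {f g : E → ℂ} (hf : ContDiff ℝ 1 f)
    (hg : ContDiff ℝ 1 g) (hc : HasCompactSupport f) (v : E) :
    ∫ x, f x * fderiv ℝ g x v ∂μ = - ∫ x, fderiv ℝ f x v * g x ∂μ := by
  have hf' : Continuous fun x => fderiv ℝ f x v :=
    (hf.continuous_fderiv (by simp)).clm_apply continuous_const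
  have hg' : Continuous fun x => fderiv ℝ g x v :=
    (hg.continuous_fderiv (by simp)).clm_apply continuous_const
  have hcf' : HasCompactSupport fun x => fderiv ℝ f x v := hc.fderiv_apply ℝ v
  refine integral_mul_fderiv_eq_neg_fderiv_mul_of_integrable ?_ ?_ ?_
    (fun x _ => hf.differentiable (by simp) x) (fun x _ => hg.differentiable (by simp) x)
  · exact (hf'.mul hg.continuous).integrable_of_hasCompactSupport hcf'.mul_right
  · exact (hf.continuous.mul hg').integrable_of_hasCompactSupport hc.mul_right
  · exact (hf.continuous.mul hg.continuous).integrable_of_hasCompactSupport hc.mul_right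

lemma integral_mul_wirtingerDbar (hf : ContDiff ℝ 1 f) (hg : ContDiff ℝ 1 g)
    (hc : HasCompactSupport f) (j : Fin d) :
    ∫ z, f z * wirtingerDbar j g z = - ∫ z, wirtingerDbar j f z * g z := by
  have hf' : ∀ v, Continuous fun x => fderiv ℝ f x v := fun v =>
    (hf.continuous_fderiv (by simp)).clm_apply continuous_const
  have hg' : ∀ v, Continuous fun x => fderiv ℝ g x v := fun v =>
    (hg.continuous_fderiv (by simp)).clm_apply continuous_const
  have i1 : ∀ v, Integrable fun z => f z * fderiv ℝ g z v := fun v =>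
    (hf.continuous.mul (hg' v)).integrable_of_hasCompactSupport hc.mul_right
  have i2 : ∀ v, Integrable fun z => fderiv ℝ f z v * g z := fun v =>
    ((hf' v).mul hg.continuous).integrable_of_hasCompactSupport (hc.fderiv_apply ℝ v).mul_right
  have e1 : ∀ z, f z * wirtingerDbar j g z = 2⁻¹ * (f z * fderiv ℝ g z (Pi.single j 1)
      + Complex.I * (f z * fderiv ℝ g z (Pi.single j Complex.I))) := fun z => by
    simp only [wirtingerDbar]; ring
  have e2 : ∀ z, wirtingerDbar j f z * g z = 2⁻¹ * (fderiv ℝ f z (Pi.single j 1) * g z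
      + Complex.I * (fderiv ℝ f z (Pi.single j Complex.I) * g z)) := fun z => by
    simp only [wirtingerDbar]; ring
  simp_rw [e1, e2]
  rw [integral_const_mul, integral_const_mul, integral_add (i1 _) ((i1 _).const_mul _),
    integral_add (i2 _) ((i2 _).const_mul _), integral_const_mul, integral_const_mul,
    integral_mul_fderiv_of_hasCompactSupport hf hg hc,
    integral_mul_fderiv_of_hasCompactSupport hf hg hc]
  ring

end Wirtinger

/-! ### The twisted Cauchy-Riemann operators -/

section Twisted

variable {d : ℕ}

/-- `∂̄_j + ∂ψ/∂z̄_j`, the conjugate `e^{-ψ} ∂̄_j e^{ψ}` of `∂̄_j`. -/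
def twistedDbar (ψ : (Fin d → ℂ) → ℝ) (j : Fin d) (u : (Fin d → ℂ) → ℂ) (z : Fin d → ℂ) : ℂ :=
  wirtingerDbar j u z + wirtingerDbar j (fun w => (ψ w : ℂ)) z * u z

/-- `∂_j - ∂ψ/∂z_j`, minus the formal adjoint of `twistedDbar ψ j` in the unweighted `L²(ℂ^d)`. -/
def twistedD (ψ : (Fin d → ℂ) → ℝ) (j : Fin d) (u : (Fin d → ℂ) → ℂ) (z : Fin d → ℂ) : ℂ :=
  wirtingerD j u z - wirtingerD j (fun w => (ψ w : ℂ)) z * u z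

/-- The Levi form `∑_{j,l} (∂²ψ/∂z_j∂z̄_l) w_j w̄_l`. -/
def leviForm (ψ : (Fin d → ℂ) → ℝ) (z w : Fin d → ℂ) : ℝ :=
  (∑ j, ∑ l, leviMatrix ψ z j l * w j * conj (w l)).re

variable {ψ : (Fin d → ℂ) → ℝ} {u v : (Fin d → ℂ) → ℂ}

lemma support_twistedDbar_subset (ψ : (Fin d → ℂ) → ℝ) (j : Fin d) (u : (Fin d → ℂ) → ℂ) :
    Function.support (twistedDbar ψ j u) ⊆ tsupport u := by
  intro z hz
  by_contra h
  exact hz (by simp [twistedDbar, wirtingerDbar_eq_zero j h, image_eq_zero_of_notMem_tsupport h])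

lemma support_twistedD_subset (ψ : (Fin d → ℂ) → ℝ) (j : Fin d) (u : (Fin d → ℂ) → ℂ) :
    Function.support (twistedD ψ j u) ⊆ tsupport u := by
  intro z hz
  by_contra h
  exact hz (by simp [twistedD, wirtingerD_eq_zero j h, image_eq_zero_of_notMem_tsupport h])

lemma HasCompactSupport.twistedDbar (hu : HasCompactSupport u) (ψ : (Fin d → ℂ) → ℝ) (j : Fin d) :
    HasCompactSupport (twistedDbar ψ j u) :=
  hu.mono' (support_twistedDbar_subset ψ j u)

lemma HasCompactSupport.twistedD (hu : HasCompactSupport u) (ψ : (Fin d → ℂ) → ℝ) (j : Fin d) :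
    HasCompactSupport (twistedD ψ j u) :=
  hu.mono' (support_twistedD_subset ψ j u)

lemma ContDiff.twistedDbar {n m : WithTop ℕ∞} (hu : ContDiff ℝ n u) (hψ : ContDiff ℝ n ψ)
    (h : m + 1 ≤ n) (j : Fin d) : ContDiff ℝ m (twistedDbar ψ j u) :=
  (hu.wirtingerDbar h j).add ((hψ.ofReal_comp.wirtingerDbar h j).mul
    (hu.of_le (le_trans le_self_add h)))

lemma ContDiff.twistedD {n m : WithTop ℕ∞} (hu : ContDiff ℝ n u) (hψ : ContDiff ℝ n ψ)
    (h : m + 1 ≤ n) (j : Fin d) : ContDiff ℝ m (twistedD ψ j u) :=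
  (hu.wirtingerD h j).sub ((hψ.ofReal_comp.wirtingerD h j).mul
    (hu.of_le (le_trans le_self_add h)))

lemma continuous_twistedDbar (hu : ContDiff ℝ 1 u) (hψ : ContDiff ℝ 1 ψ) (j : Fin d) :
    Continuous (twistedDbar ψ j u) :=
  (hu.twistedDbar (m := 0) hψ (by simp) j).continuous

lemma continuous_twistedD (hu : ContDiff ℝ 1 u) (hψ : ContDiff ℝ 1 ψ) (j : Fin d) :
    Continuous (twistedD ψ j u) :=
  (hu.twistedD (m := 0) hψ (by simp) j).continuous

/-- `-twistedD` is the formal adjoint of `twistedDbar`. -/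
lemma integral_twistedDbar_mul_conj (hψ : ContDiff ℝ 1 ψ) (hu : ContDiff ℝ 1 u)
    (hv : ContDiff ℝ 1 v) (hc : HasCompactSupport v) (j : Fin d) :
    ∫ z, twistedDbar ψ j u z * conj (v z) = - ∫ z, u z * conj (twistedD ψ j v z) := by
  have hv' := hv.conj_comp
  have hc' := hc.conj_comp
  have h1 := integral_mul_wirtingerDbar hv' hu hc' j
  have cψ : Continuous (wirtingerDbar j fun w => (ψ w : ℂ)) :=
    (hψ.ofReal_comp.wirtingerDbar (m := 0) (by simp) j).continuous
  have cu : Continuous (wirtingerDbar j u) := (hu.wirtingerDbar (m := 0) (by simp) j).continuous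
  have cv : Continuous (wirtingerDbar j fun z => conj (v z)) :=
    (hv'.wirtingerDbar (m := 0) (by simp) j).continuous
  have i0 : Integrable fun z => conj (v z) * wirtingerDbar j u z :=
    (hv'.continuous.mul cu).integrable_of_hasCompactSupport hc'.mul_right
  have i1 : Integrable fun z => wirtingerDbar j (fun w => (ψ w : ℂ)) z * u z * conj (v z) :=
    ((cψ.mul hu.continuous).mul hv'.continuous).integrable_of_hasCompactSupport hc'.mul_left
  have i2 : Integrable fun z => wirtingerDbar j (fun w => conj (v w)) z * u z :=
    (cv.mul hu.continuous).integrable_of_hasCompactSupport (hc'.wirtingerDbar j).mul_right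
  have e1 : ∀ z, twistedDbar ψ j u z * conj (v z) = conj (v z) * wirtingerDbar j u z
      + wirtingerDbar j (fun w => (ψ w : ℂ)) z * u z * conj (v z) := fun z => by
    simp only [twistedDbar]; ring
  have e2 : ∀ z, u z * conj (twistedD ψ j v z) = wirtingerDbar j (fun w => conj (v w)) z * u z
      - wirtingerDbar j (fun w => (ψ w : ℂ)) z * u z * conj (v z) := fun z => by
    rw [wirtingerDbar_conj, twistedD, map_sub, map_mul, conj_wirtingerD_ofReal]; ring
  simp_rw [e1, e2]
  rw [integral_add i0 i1, integral_sub i2 i1, h1]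
  ring

lemma integral_twistedD_mul_conj (hψ : ContDiff ℝ 1 ψ) (hu : ContDiff ℝ 1 u)
    (hv : ContDiff ℝ 1 v) (hc : HasCompactSupport u) (j : Fin d) :
    ∫ z, twistedD ψ j u z * conj (v z) = - ∫ z, u z * conj (twistedDbar ψ j v z) := by
  have h := integral_twistedDbar_mul_conj hψ hv hu hc j
  have h2 := congrArg (starRingEnd ℂ) h
  rw [map_neg, ← integral_conj, ← integral_conj] at h2
  simp only [map_mul, Complex.conj_conj] at h2
  rw [← neg_eq_iff_eq_neg] at h2
  simp_rw [mul_comm (u _), mul_comm (twistedD _ _ _ _)]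
  rw [← h2]

lemma leviMatrix_eq (ψ : (Fin d → ℂ) → ℝ) (z : Fin d → ℂ) (j k : Fin d) :
    leviMatrix ψ z j k = wirtingerD j (wirtingerDbar k fun w => (ψ w : ℂ)) z := rfl

/-- The commutator `[∂̄_k + ψ_{k̄}, ∂_j - ψ_j] = -2 ψ_{j k̄}`. -/
lemma twistedDbar_twistedD (hψ : ContDiff ℝ 2 ψ) (hu : ContDiff ℝ 2 u) (j k : Fin d)
    (z : Fin d → ℂ) :
    twistedDbar ψ k (twistedD ψ j u) z
      = twistedD ψ j (twistedDbar ψ k u) z - 2 * leviMatrix ψ z j k * u z := by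
  have d1 : DifferentiableAt ℝ (wirtingerD j u) z :=
    (hu.wirtingerD (m := 1) (by norm_num) j).differentiable (by simp) z
  have d2 : DifferentiableAt ℝ (wirtingerDbar k u) z :=
    (hu.wirtingerDbar (m := 1) (by norm_num) k).differentiable (by simp) z
  have d3 : DifferentiableAt ℝ (wirtingerD j fun w => (ψ w : ℂ)) z :=
    (hψ.ofReal_comp.wirtingerD (m := 1) (by norm_num) j).differentiable (by simp) z
  have d4 : DifferentiableAt ℝ (wirtingerDbar k fun w => (ψ w : ℂ)) z :=
    (hψ.ofReal_comp.wirtingerDbar (m := 1) (by norm_num) k).differentiable (by simp) z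
  have d5 : DifferentiableAt ℝ u z := hu.differentiable (by simp) z
  rw [twistedDbar, twistedD]
  unfold twistedDbar twistedD
  rw [wirtingerDbar_sub k d1 (d3.fun_mul d5), wirtingerDbar_mul k d3 d5,
    wirtingerD_add j d2 (d4.fun_mul d5),
    wirtingerD_mul j d4 d5, wirtingerDbar_wirtingerD_comm hu.contDiffAt,
    wirtingerDbar_wirtingerD_comm hψ.ofReal_comp.contDiffAt, leviMatrix_eq]
  ring

lemma twistedDbar_comm (hψ : ContDiff ℝ 2 ψ) (hu : ContDiff ℝ 2 u) (j k : Fin d)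
    (z : Fin d → ℂ) :
    twistedDbar ψ k (twistedDbar ψ j u) z = twistedDbar ψ j (twistedDbar ψ k u) z := by
  have d1 : ∀ j, DifferentiableAt ℝ (wirtingerDbar j u) z := fun j =>
    (hu.wirtingerDbar (m := 1) (by norm_num) j).differentiable (by simp) z
  have d3 : ∀ j, DifferentiableAt ℝ (wirtingerDbar j fun w => (ψ w : ℂ)) z := fun j =>
    (hψ.ofReal_comp.wirtingerDbar (m := 1) (by norm_num) j).differentiable (by simp) z
  have d5 : DifferentiableAt ℝ u z := hu.differentiable (by simp) z
  rw [twistedDbar, twistedDbar]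
  unfold twistedDbar
  rw [wirtingerDbar_add k (d1 j) ((d3 j).fun_mul d5), wirtingerDbar_mul k (d3 j) d5,
    wirtingerDbar_add j (d1 k) ((d3 k).fun_mul d5),
    wirtingerDbar_mul j (d3 k) d5, wirtingerDbar_wirtingerDbar_comm hu.contDiffAt j k,
    wirtingerDbar_wirtingerDbar_comm hψ.ofReal_comp.contDiffAt j k]
  ring

lemma continuous_leviMatrix (hψ : ContDiff ℝ 2 ψ) (j k : Fin d) :
    Continuous fun z => leviMatrix ψ z j k :=
  ((hψ.ofReal_comp.wirtingerDbar (m := 1) (by norm_num) k).wirtingerD (m := 0) (by simp)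
    j).continuous

lemma sum_norm_sub_sq (a : Fin d → Fin d → ℂ) :
    (2⁻¹ : ℝ) * ∑ j, ∑ k, ‖a j k - a k j‖ ^ 2
      = ∑ j, ∑ k, ‖a j k‖ ^ 2 - (∑ j, ∑ k, a k j * conj (a j k)).re := by
  have h : ∀ j k, ‖a j k - a k j‖ ^ 2
      = ‖a j k‖ ^ 2 + ‖a k j‖ ^ 2 - 2 * (a k j * conj (a j k)).re := fun j k => by
    rw [← Complex.normSq_eq_norm_sq, ← Complex.normSq_eq_norm_sq, ← Complex.normSq_eq_norm_sq,
      Complex.normSq_sub]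
    simp only [Complex.mul_re, Complex.conj_re, Complex.conj_im]
    ring
  simp_rw [h, Finset.sum_sub_distrib, Finset.sum_add_distrib, Complex.re_sum, ← Finset.mul_sum]
  rw [Finset.sum_comm (f := fun j k => ‖a k j‖ ^ 2)]
  ring

lemma integrable_mul_conj {E : Type*} [TopologicalSpace E] [MeasurableSpace E] [BorelSpace E]
    {μ : Measure E} [IsFiniteMeasureOnCompacts μ] {a b : E → ℂ} (ha : Continuous a)
    (hb : Continuous b) (hc : HasCompactSupport a) : Integrable (fun z => a z * conj (b z)) μ :=
  (ha.mul (Complex.continuous_conj.comp hb)).integrable_of_hasCompactSupport hc.mul_right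

lemma integrable_norm_sq {E F : Type*} [TopologicalSpace E] [MeasurableSpace E] [BorelSpace E]
    [NormedAddCommGroup F] {μ : Measure E} [IsFiniteMeasureOnCompacts μ] {a : E → F}
    (ha : Continuous a) (hc : HasCompactSupport a) : Integrable (fun z => ‖a z‖ ^ 2) μ := by
  refine (ha.norm.pow 2).integrable_of_hasCompactSupport (hc.mono fun z hz => ?_)
  contrapose! hz
  have : a z = 0 := by simpa using hz
  simp [this]

/-- The Bochner-Kodaira-Hörmander inequality for test forms: moving `∂_j - ψ_j` and `∂̄_k + ψ_{k̄}`
to the other side in `‖∑_j (∂_j - ψ_j) H_j‖²` and exchanging them produces the Levi form, and the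
remaining terms are those of the exterior derivative, up to `∑_{j,k} ‖(∂̄_j + ψ_{j̄}) H_k‖² ≥ 0`. -/
lemma leviForm_le_of_contDiff (hψ : ContDiff ℝ 2 ψ) {H : Fin d → (Fin d → ℂ) → ℂ}
    (hH : ∀ j, ContDiff ℝ 2 (H j)) (hc : ∀ j, HasCompactSupport (H j)) :
    2 * ∫ z, leviForm ψ z (fun j => H j z) ≤ (∫ z, ‖∑ j, twistedD ψ j (H j) z‖ ^ 2)
      + 2⁻¹ * ∑ j, ∑ k, ∫ z, ‖twistedDbar ψ j (H k) z - twistedDbar ψ k (H j) z‖ ^ 2 := by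
  have hψ1 : ContDiff ℝ 1 ψ := hψ.of_le (by norm_num)
  have hH1 : ∀ j, ContDiff ℝ 1 (H j) := fun j => (hH j).of_le (by norm_num)
  have hA : ∀ j k, ContDiff ℝ 1 (twistedDbar ψ k (H j)) := fun j k =>
    (hH j).twistedDbar hψ (by norm_num) k
  have hB : ∀ j k, ContDiff ℝ 1 (twistedD ψ k (H j)) := fun j k =>
    (hH j).twistedD hψ (by norm_num) k
  have cA : ∀ j k, HasCompactSupport (twistedDbar ψ k (H j)) := fun j k => (hc j).twistedDbar ψ k
  have cB : ∀ j k, HasCompactSupport (twistedD ψ k (H j)) := fun j k => (hc j).twistedD ψ k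
  have cL : ∀ j k, Integrable fun z => leviMatrix ψ z j k * H j z * conj (H k z) := fun j k =>
    integrable_mul_conj ((continuous_leviMatrix hψ j k).mul (hH j).continuous) (hH k).continuous
      (hc j).mul_left
  have iAA : ∀ a b c e, Integrable fun z =>
      twistedDbar ψ b (H a) z * conj (twistedDbar ψ e (H c) z) := fun a b c e =>
    integrable_mul_conj (hA a b).continuous (hA c e).continuous (cA a b)
  -- the integration by parts, for one pair of indices
  have key : ∀ j k, ∫ z, twistedD ψ j (H j) z * conj (twistedD ψ k (H k) z)
      = (∫ z, twistedDbar ψ k (H j) z * conj (twistedDbar ψ j (H k) z))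
        + 2 * ∫ z, leviMatrix ψ z j k * H j z * conj (H k z) := fun j k => by
    have h1 := integral_twistedDbar_mul_conj hψ1 (hB j j) (hH1 k) (hc k) k
    have h2 := integral_twistedD_mul_conj hψ1 (hA j k) (hH1 k) (cA j k) j
    simp_rw [twistedDbar_twistedD hψ (hH j) j k, sub_mul, mul_assoc (2 : ℂ)] at h1
    have i3 : Integrable fun z => twistedD ψ j (twistedDbar ψ k (H j)) z * conj (H k z) :=
      integrable_mul_conj (continuous_twistedD (hA j k) hψ1 j) (hH k).continuous
        ((cA j k).twistedD ψ j)
    rw [integral_sub i3 ((cL j k).const_mul 2), integral_const_mul, h2] at h1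
    linear_combination h1
  have e1 : ((∫ z, ‖∑ j, twistedD ψ j (H j) z‖ ^ 2 : ℝ) : ℂ)
      = ∑ j, ∑ k, ∫ z, twistedD ψ j (H j) z * conj (twistedD ψ k (H k) z) := by
    rw [← integral_complex_ofReal]
    simp_rw [Complex.ofReal_pow, ← Complex.mul_conj', map_sum, Finset.sum_mul_sum]
    rw [integral_finsetSum _ fun j _ => integrable_finsetSum _ fun k _ =>
      integrable_mul_conj (hB j j).continuous (hB k k).continuous (cB j j)]
    exact Finset.sum_congr rfl fun j _ => integral_finsetSum _ fun k _ =>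
      integrable_mul_conj (hB j j).continuous (hB k k).continuous (cB j j)
  have e2 : ∫ z, leviForm ψ z (fun j => H j z)
      = (∑ j, ∑ k, ∫ z, leviMatrix ψ z j k * H j z * conj (H k z)).re := by
    simp_rw [← integral_finsetSum _ fun k _ => cL _ k]
    rw [← integral_finsetSum _ fun j _ => integrable_finsetSum _ fun k _ => cL j k]
    exact integral_re (integrable_finsetSum _ fun j _ => integrable_finsetSum _ fun k _ => cL j k)
  have iN : ∀ j k, Integrable fun z => ‖twistedDbar ψ j (H k) z‖ ^ 2 := fun j k =>
    integrable_norm_sq (hA k j).continuous (cA k j)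
  have iS : ∀ j k, Integrable fun z =>
      ‖twistedDbar ψ j (H k) z - twistedDbar ψ k (H j) z‖ ^ 2 := fun j k =>
    integrable_norm_sq ((hA k j).continuous.sub (hA j k).continuous) ((cA k j).sub (cA j k))
  have e3 : 2⁻¹ * ∑ j, ∑ k, ∫ z, ‖twistedDbar ψ j (H k) z - twistedDbar ψ k (H j) z‖ ^ 2
      = (∑ j, ∑ k, ∫ z, ‖twistedDbar ψ j (H k) z‖ ^ 2)
        - (∑ j, ∑ k, ∫ z, twistedDbar ψ k (H j) z * conj (twistedDbar ψ j (H k) z)).re := by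
    simp_rw [← integral_finsetSum _ fun k _ => iS _ k, ← integral_finsetSum _ fun k _ => iN _ k,
      ← integral_finsetSum Finset.univ fun k _ => iAA _ k k _]
    rw [← integral_finsetSum _ fun j _ => integrable_finsetSum _ fun k _ => iS j k,
      ← integral_finsetSum _ fun j _ => integrable_finsetSum _ fun k _ => iN j k,
      ← integral_finsetSum _ fun j _ => integrable_finsetSum _ fun k _ => iAA j k k j,
      ← integral_const_mul]
    have hre := integral_re (𝕜 := ℂ) (integrable_finsetSum Finset.univ fun j _ =>
      integrable_finsetSum Finset.univ fun k _ => iAA j k k j)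
    simp only [RCLike.re_eq_complex_re] at hre
    rw [← hre, ← integral_sub]
    · refine integral_congr_ae (Filter.Eventually.of_forall fun z => ?_)
      exact sum_norm_sub_sq fun j k => twistedDbar ψ j (H k) z
    · exact integrable_finsetSum _ fun j _ => integrable_finsetSum _ fun k _ => iN j k
    · exact (integrable_finsetSum _ fun j _ => integrable_finsetSum _ fun k _ => iAA j k k j).re
  have e4 : ∫ z, ‖∑ j, twistedD ψ j (H j) z‖ ^ 2
      = (∑ j, ∑ k, ∫ z, twistedDbar ψ k (H j) z * conj (twistedDbar ψ j (H k) z)).re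
        + 2 * ∫ z, leviForm ψ z (fun j => H j z) := by
    rw [e2, ← Complex.ofReal_re (∫ z, ‖∑ j, twistedD ψ j (H j) z‖ ^ 2), e1]
    simp_rw [key, Finset.sum_add_distrib, ← Finset.mul_sum]
    simp
  have e5 : 0 ≤ ∑ j, ∑ k, ∫ z, ‖twistedDbar ψ j (H k) z‖ ^ 2 :=
    Finset.sum_nonneg fun j _ => Finset.sum_nonneg fun k _ => integral_nonneg fun z => by positivity
  rw [e3, e4]
  generalize (∑ j, ∑ k, ∫ z, ‖twistedDbar ψ j (H k) z‖ ^ 2) = a at e5 ⊢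
  generalize (∑ j, ∑ k, ∫ z, twistedDbar ψ k (H j) z * conj (twistedDbar ψ j (H k) z)).re = b
  linarith

end Twisted

/-! ### Mollification in `L²` -/

section Mollify

open Filter Topology

variable {d : ℕ}

/-- The convolution `ρ * F`. -/
def mollify (ρ : (Fin d → ℂ) → ℝ) (F : (Fin d → ℂ) → ℂ) (x : Fin d → ℂ) : ℂ :=
  ∫ y, (ρ (x - y) : ℂ) * F y

variable {ρ : (Fin d → ℂ) → ℝ} {F G : (Fin d → ℂ) → ℂ}

lemma mollify_eq_convolution (ρ : (Fin d → ℂ) → ℝ) (F : (Fin d → ℂ) → ℂ) :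
    mollify ρ F = MeasureTheory.convolution (fun y => (ρ y : ℂ)) F
      (ContinuousLinearMap.mul ℝ ℂ) volume := by
  funext x
  rw [convolution_eq_swap]
  rfl

lemma ContDiff.mollify (hρ : ContDiff ℝ ∞ ρ) (hc : HasCompactSupport ρ)
    (hF : LocallyIntegrable F) : ContDiff ℝ ∞ (mollify ρ F) := by
  rw [mollify_eq_convolution]
  exact HasCompactSupport.contDiff_convolution_left (n := (⊤ : ℕ∞)) _
    (hc.comp_left (g := ((↑) : ℝ → ℂ)) Complex.ofReal_zero) hρ.ofReal_comp hF

lemma integrable_mul_of_locallyIntegrable {q : (Fin d → ℂ) → ℂ} (hq : Continuous q)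
    (hc : HasCompactSupport q) (hF : LocallyIntegrable F) : Integrable fun y => q y * F y := by
  simpa only [smul_eq_mul] using hF.integrable_smul_left_of_hasCompactSupport hq hc

lemma HasCompactSupport.comp_const_sub {M : Type*} [Zero M] {q : (Fin d → ℂ) → M}
    (hc : HasCompactSupport q) (x : Fin d → ℂ) : HasCompactSupport fun y => q (x - y) :=
  hc.comp_homeomorph (Homeomorph.subLeft x)

lemma fderiv_mollify (hρ : ContDiff ℝ ∞ ρ) (hc : HasCompactSupport ρ)
    (hF : LocallyIntegrable F) (x v : Fin d → ℂ) :
    fderiv ℝ (_root_.mollify ρ F) x v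
      = ∫ y, fderiv ℝ (fun y => (ρ y : ℂ)) (x - y) v * F y := by
  have hc' : HasCompactSupport fun y => (ρ y : ℂ) :=
    hc.comp_left (g := ((↑) : ℝ → ℂ)) Complex.ofReal_zero
  have hρ' : ContDiff ℝ 1 fun y => (ρ y : ℂ) := hρ.ofReal_comp.of_le (by simp)
  have h := HasCompactSupport.hasFDerivAt_convolution_left (μ := volume)
    (ContinuousLinearMap.mul ℝ ℂ) hc' hρ' hF x
  have hint : ConvolutionExistsAt (fderiv ℝ fun y => (ρ y : ℂ)) F x
      ((ContinuousLinearMap.mul ℝ ℂ).precompL (Fin d → ℂ)) volume :=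
    (hc'.fderiv (𝕜 := ℝ)).convolutionExists_left _ (hρ'.continuous_fderiv (by simp)) hF x
  rw [mollify_eq_convolution, h.fderiv, convolution_eq_swap, ContinuousLinearMap.integral_apply]
  · rfl
  · exact hint.integrable_swap

lemma wirtingerD_mollify (hρ : ContDiff ℝ ∞ ρ) (hc : HasCompactSupport ρ)
    (hF : LocallyIntegrable F) (j : Fin d) (x : Fin d → ℂ) :
    wirtingerD j (mollify ρ F) x = ∫ y, wirtingerD j (fun y => (ρ y : ℂ)) (x - y) * F y := by
  have hc' : HasCompactSupport fun y => (ρ y : ℂ) :=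
    hc.comp_left (g := ((↑) : ℝ → ℂ)) Complex.ofReal_zero
  have i : ∀ v, Integrable fun y => fderiv ℝ (fun y => (ρ y : ℂ)) (x - y) v * F y := fun v =>
    integrable_mul_of_locallyIntegrable (((hρ.ofReal_comp.continuous_fderiv (by simp)).comp
      (continuous_const.sub continuous_id)).clm_apply continuous_const)
      ((hc'.fderiv_apply ℝ v).comp_const_sub x) hF
  rw [wirtingerD, fderiv_mollify hρ hc hF, fderiv_mollify hρ hc hF, ← integral_const_mul,
    ← integral_sub (i _) ((i _).const_mul _), ← integral_div]
  congr 1; funext y; simp only [wirtingerD]; ring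

lemma wirtingerDbar_mollify (hρ : ContDiff ℝ ∞ ρ) (hc : HasCompactSupport ρ)
    (hF : LocallyIntegrable F) (j : Fin d) (x : Fin d → ℂ) :
    wirtingerDbar j (mollify ρ F) x
      = ∫ y, wirtingerDbar j (fun y => (ρ y : ℂ)) (x - y) * F y := by
  have hc' : HasCompactSupport fun y => (ρ y : ℂ) :=
    hc.comp_left (g := ((↑) : ℝ → ℂ)) Complex.ofReal_zero
  have i : ∀ v, Integrable fun y => fderiv ℝ (fun y => (ρ y : ℂ)) (x - y) v * F y := fun v =>
    integrable_mul_of_locallyIntegrable (((hρ.ofReal_comp.continuous_fderiv (by simp)).comp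
      (continuous_const.sub continuous_id)).clm_apply continuous_const)
      ((hc'.fderiv_apply ℝ v).comp_const_sub x) hF
  rw [wirtingerDbar, fderiv_mollify hρ hc hF, fderiv_mollify hρ hc hF, ← integral_const_mul,
    ← integral_add (i _) ((i _).const_mul _), ← integral_div]
  congr 1; funext y; simp only [wirtingerDbar]; ring

lemma fderiv_comp_const_sub_apply {E F : Type*} [NormedAddCommGroup E] [NormedSpace ℝ E]
    [NormedAddCommGroup F] [NormedSpace ℝ F] {q : E → F} (x y v : E) :
    fderiv ℝ (fun y => q (x - y)) y v = - fderiv ℝ q (x - y) v := by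
  have h : (fun y => q (x - y)) = fun y => (q ∘ ContinuousLinearEquiv.neg ℝ) (y - x) := by
    funext y; simp
  rw [h, fderiv_comp_sub (f := q ∘ ContinuousLinearEquiv.neg ℝ) x,
    ContinuousLinearEquiv.comp_right_fderiv]
  simp

/-- If `F` vanishes outside `K` and `ρ` outside the ball of radius `r`, then `ρ * F` vanishes
outside the `r`-neighbourhood of `K`. -/
lemma mollify_eq_zero {K : Set (Fin d → ℂ)} {r : ℝ} (hρ : ∀ x, r < ‖x‖ → ρ x = 0)
    (hF : ∀ x, x ∉ K → F x = 0) {x : Fin d → ℂ} (hx : x ∉ Metric.cthickening r K) :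
    mollify ρ F x = 0 := by
  refine integral_eq_zero_of_ae (Eventually.of_forall fun y => ?_)
  by_cases hy : y ∈ K
  · have : r < ‖x - y‖ := by
      by_contra! h
      exact hx (Metric.mem_cthickening_of_dist_le x y r K hy (by rwa [dist_eq_norm]))
    simp [hρ _ this]
  · simp [hF y hy]

/-- Translations are continuous in `L²`. -/
lemma eventually_eLpNorm_translate_sub_le (hF : MemLp F 2 volume) {ε : ℝ≥0∞}
    (hε : 0 < ε) : ∃ δ > 0, ∀ t : Fin d → ℂ, ‖t‖ ≤ δ →
      eLpNorm (fun x => F (x - t) - F x) 2 volume ≤ ε := by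
  let f : Lp ℂ 2 (volume : Measure (Fin d → ℂ)) := hF.toLp F
  let g : C((Fin d → ℂ) × (Fin d → ℂ), Fin d → ℂ) := ⟨fun p => p.2 - p.1, by fun_prop⟩
  have hgm : ∀ t, MeasurePreserving (g.curry t) volume volume := fun t =>
    measurePreserving_sub_right volume t
  have hcont : Continuous fun t => Lp.compMeasurePreserving (g.curry t) (hgm t) f :=
    continuous_const.compMeasurePreservingLp g.curry.continuous hgm (by norm_num)
  have hf0 : Lp.compMeasurePreserving (g.curry 0) (hgm 0) f = f := by
    rw [Lp.toLp_compMeasurePreserving hF (hgm 0)]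
    refine MemLp.toLp_congr _ _ (Eventually.of_forall fun x => ?_)
    simp [g]
  have h0 : Tendsto (fun t => edist (Lp.compMeasurePreserving (g.curry t) (hgm t) f) f) (𝓝 0)
      (𝓝 0) := by
    have := (hcont.edist (continuous_const (y := f))).tendsto 0
    simpa [hf0] using this
  obtain ⟨δ, hδ, h⟩ := Metric.eventually_nhds_iff.1 (h0.eventually (ge_mem_nhds hε))
  refine ⟨δ / 2, by positivity, fun t ht => ?_⟩
  have h1 := h (y := t) (by rw [dist_zero_right]; linarith)
  rw [Lp.toLp_compMeasurePreserving hF (hgm t), Lp.edist_toLp_toLp] at h1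
  exact h1

/-- A mollification is an average of translates, so it moves `F` in `L²` at most as much as these
do. -/
lemma eLpNorm_mollify_sub_le (hF : StronglyMeasurable F) (hF2 : MemLp F 2 volume)
    (hρ : Continuous ρ) (hρ0 : ∀ x, 0 ≤ ρ x) (hρ1 : ∫ x, ρ x = 1) (hc : HasCompactSupport ρ)
    {r : ℝ} (hr : ∀ x, r < ‖x‖ → ρ x = 0) {ε : ℝ≥0∞}
    (hε : ∀ t : Fin d → ℂ, ‖t‖ ≤ r → eLpNorm (fun x => F (x - t) - F x) 2 volume ≤ ε) :
    eLpNorm (mollify ρ F - F) 2 volume ≤ ε := by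
  have hρi : Integrable ρ := hρ.integrable_of_hasCompactSupport hc
  have hFl : LocallyIntegrable F := hF2.locallyIntegrable (by norm_num)
  -- the probability measure with density `ρ`, for which Jensen's inequality holds
  let ν : Measure (Fin d → ℂ) := volume.withDensity fun t => ENNReal.ofReal (ρ t)
  have hm : Measurable fun t => ENNReal.ofReal (ρ t) := hρ.measurable.ennreal_ofReal
  have hν : ν univ = 1 := by
    simp only [ν, withDensity_apply _ MeasurableSet.univ, Measure.restrict_univ]
    rw [← ofReal_integral_eq_lintegral_ofReal hρi (Eventually.of_forall hρ0), hρ1]; simp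
  have : IsProbabilityMeasure ν := ⟨hν⟩
  have hmeas : StronglyMeasurable fun p : (Fin d → ℂ) × (Fin d → ℂ) => F (p.1 - p.2) - F p.1 :=
    (hF.comp_measurable (measurable_fst.sub measurable_snd)).sub
      (hF.comp_measurable measurable_fst)
  have pt : ∀ x, ‖mollify ρ F x - F x‖ₑ ^ (2 : ℝ) ≤ ∫⁻ t, ‖F (x - t) - F x‖ₑ ^ (2 : ℝ) ∂ν := by
    intro x
    have e1 : mollify ρ F x - F x = ∫ t, (ρ t : ℂ) * (F (x - t) - F x) := by
      have i1 : Integrable fun t => (ρ t : ℂ) * F (x - t) := by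
        have := integrable_mul_of_locallyIntegrable (q := fun y => (ρ (x - y) : ℂ)) (F := F)
          (by fun_prop) ((hc.comp_const_sub x).comp_left (g := ((↑) : ℝ → ℂ)) Complex.ofReal_zero)
          hFl
        have h2 := this.comp_sub_left x
        simpa using h2
      have i2 : Integrable fun t => (ρ t : ℂ) * F x := (hρi.ofReal (𝕜 := ℂ)).mul_const _
      simp_rw [mul_sub]
      rw [integral_sub i1 i2, integral_mul_const, integral_complex_ofReal, hρ1]
      rw [mollify_eq_convolution, convolution_def]
      simp
    have e2 : ‖mollify ρ F x - F x‖ₑ ≤ ∫⁻ t, ‖F (x - t) - F x‖ₑ ∂ν := by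
      rw [e1]
      refine (enorm_integral_le_lintegral_enorm _).trans (le_of_eq ?_)
      rw [lintegral_withDensity_eq_lintegral_mul₀ hm.aemeasurable]
      · refine lintegral_congr fun t => ?_
        rw [Pi.mul_apply, enorm_mul]
        congr 1
        rw [← ofReal_norm, Complex.norm_real, Real.norm_of_nonneg (hρ0 t)]
      · exact ((hmeas.comp_measurable measurable_prodMk_left).enorm).aemeasurable
    have e3 := eLpNorm_le_eLpNorm_of_exponent_le (μ := ν) (p := 1) (q := 2) (by norm_num)
      (f := fun t => F (x - t) - F x)
      (hmeas.comp_measurable measurable_prodMk_left).aestronglyMeasurable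
    rw [eLpNorm_one_eq_lintegral_enorm, eLpNorm_eq_lintegral_rpow_enorm_toReal (by norm_num)
      (by norm_num)] at e3
    simp only [ENNReal.toReal_ofNat] at e3
    calc ‖mollify ρ F x - F x‖ₑ ^ (2 : ℝ)
        ≤ ((∫⁻ t, ‖F (x - t) - F x‖ₑ ^ (2 : ℝ) ∂ν) ^ (1 / (2 : ℝ))) ^ (2 : ℝ) := by
          gcongr; exact e2.trans e3
      _ = _ := by rw [← ENNReal.rpow_mul]; norm_num
  have hle : eLpNorm (mollify ρ F - F) 2 volume ^ (2 : ℝ) ≤ ε ^ (2 : ℝ) := by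
    rw [eLpNorm_eq_lintegral_rpow_enorm_toReal (by norm_num) (by norm_num), ← ENNReal.rpow_mul]
    simp only [ENNReal.toReal_ofNat]
    norm_num
    have pt' : ∀ x, ‖mollify ρ F x - F x‖ₑ ^ 2 ≤ ∫⁻ t, ‖F (x - t) - F x‖ₑ ^ 2 ∂ν := fun x => by
      simpa using pt x
    refine (lintegral_mono pt').trans ?_
    rw [lintegral_lintegral_swap]
    · have hae : ∀ᵐ t ∂ν, ∫⁻ x, ‖F (x - t) - F x‖ₑ ^ 2 ≤ ε ^ 2 := by
        rw [ae_withDensity_iff hm]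
        refine Eventually.of_forall fun t ht => ?_
        have htr : ‖t‖ ≤ r := by
          by_contra! h
          exact ht (by simp [hr t h])
        have := hε t htr
        rw [eLpNorm_eq_lintegral_rpow_enorm_toReal (by norm_num) (by norm_num)] at this
        have h2 := ENNReal.rpow_le_rpow this (z := 2) (by norm_num)
        rw [← ENNReal.rpow_mul] at h2
        simpa using h2
      refine (lintegral_mono_ae hae).trans ?_
      simp [hν]
    · exact (hmeas.enorm.pow_const 2).aemeasurable
  exact (ENNReal.rpow_le_rpow_iff (by norm_num)).1 hle

/-- A sequence of smooth probability densities, the `n`-th one supported in the ball of radius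
`1 / (n + 1)`. -/
lemma exists_mollifier (d : ℕ) : ∃ ρ : ℕ → (Fin d → ℂ) → ℝ, ∀ n, ContDiff ℝ ∞ (ρ n) ∧
    HasCompactSupport (ρ n) ∧ (∀ x, 0 ≤ ρ n x) ∧ ∫ x, ρ n x = 1 ∧
    ∀ x, 1 / ((n : ℝ) + 1) < ‖x‖ → ρ n x = 0 := by
  have h : ∀ n : ℕ, ∃ φ : ContDiffBump (0 : Fin d → ℂ), φ.rOut = 1 / ((n : ℝ) + 1) := fun n =>
    ⟨⟨1 / ((n : ℝ) + 1) / 2, 1 / ((n : ℝ) + 1), by positivity, half_lt_self (by positivity)⟩, rfl⟩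
  choose φ hφ using h
  refine ⟨fun n => (φ n).normed volume, fun n => ⟨(φ n).contDiff_normed,
    (φ n).hasCompactSupport_normed, (φ n).nonneg_normed, (φ n).integral_normed, fun x hx => ?_⟩⟩
  by_contra h
  have : x ∈ Function.support ((φ n).normed volume) := h
  rw [ContDiffBump.support_normed_eq, hφ] at this
  simp at this hx
  linarith

lemma tendsto_eLpNorm_mollify_sub {ρ : ℕ → (Fin d → ℂ) → ℝ}
    (hρ : ∀ n, ContDiff ℝ ∞ (ρ n) ∧ HasCompactSupport (ρ n) ∧ (∀ x, 0 ≤ ρ n x) ∧ ∫ x, ρ n x = 1 ∧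
      ∀ x, 1 / ((n : ℝ) + 1) < ‖x‖ → ρ n x = 0) (hF : MemLp F 2 volume) :
    Tendsto (fun n => eLpNorm (mollify (ρ n) F - F) 2 volume) atTop (𝓝 0) := by
  obtain ⟨F', hF', hFF'⟩ := hF.1
  have hF2 : MemLp F' 2 volume := hF.ae_eq hFF'
  have e : ∀ n, eLpNorm (mollify (ρ n) F - F) 2 volume
      = eLpNorm (mollify (ρ n) F' - F') 2 volume := fun n => by
    refine eLpNorm_congr_ae ?_
    have : mollify (ρ n) F = mollify (ρ n) F' := by
      funext x
      exact integral_congr_ae (hFF'.mono fun y hy => by simp only [hy])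
    rw [this]
    filter_upwards [hFF'] with y hy
    simp [hy]
  simp_rw [e]
  rw [ENNReal.tendsto_nhds_zero]
  intro ε hε
  obtain ⟨δ, hδ, h⟩ := eventually_eLpNorm_translate_sub_le hF2 hε
  have := tendsto_one_div_add_atTop_nhds_zero_nat (𝕜 := ℝ)
  filter_upwards [this.eventually (ge_mem_nhds hδ)] with n hn
  obtain ⟨h1, h2, h3, h4, h5⟩ := hρ n
  exact eLpNorm_mollify_sub_le hF' hF2 h1.continuous h3 h4 h2 h5 fun t ht => h t (ht.trans hn)

lemma memLp_mollify (hF : MemLp F 2 volume) (hρ : ContDiff ℝ ∞ ρ) (hρ0 : ∀ x, 0 ≤ ρ x)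
    (hρ1 : ∫ x, ρ x = 1) (hc : HasCompactSupport ρ) : MemLp (mollify ρ F) 2 volume := by
  obtain ⟨F', hF', hFF'⟩ := hF.1
  have hF2 : MemLp F' 2 volume := hF.ae_eq hFF'
  have e : mollify ρ F = mollify ρ F' := by
    funext x
    exact integral_congr_ae (hFF'.mono fun y hy => by simp only [hy])
  obtain ⟨r, hr⟩ := hc.isBounded.exists_norm_le
  have hr' : ∀ x, r < ‖x‖ → ρ x = 0 := fun x hx => by
    by_contra h
    exact absurd (hr x (subset_tsupport ρ h)) (by linarith)
  have h := eLpNorm_mollify_sub_le hF' hF2 hρ.continuous hρ0 hρ1 hc hr'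
    (ε := eLpNorm F' 2 volume + eLpNorm F' 2 volume) fun t _ => by
      have h1 : eLpNorm (fun x => F' (x - t)) 2 volume = eLpNorm F' 2 volume :=
        eLpNorm_comp_measurePreserving hF'.aestronglyMeasurable (measurePreserving_sub_right _ t)
      have h2 : MemLp (fun x => F' (x - t)) 2 volume :=
        hF2.comp_measurePreserving (measurePreserving_sub_right _ t)
      refine (eLpNorm_sub_le h2.1 hF2.1 (by norm_num)).trans ?_
      rw [h1]
  rw [e]
  have h3 : MemLp (mollify ρ F' - F') 2 volume :=
    ⟨(hρ.mollify hc (hF2.locallyIntegrable (by norm_num))).continuous.aestronglyMeasurable.sub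
      hF2.1, h.trans_lt (ENNReal.add_lt_top.2 ⟨hF2.2, hF2.2⟩)⟩
  simpa using h3.add hF2

end Mollify

/-! ### The a priori estimate for weakly closed forms -/

section Weak

open Filter Topology

lemma integrable_fun_sub {E F : Type*} [MeasurableSpace E] [NormedAddCommGroup F] {μ : Measure E}
    {f g : E → F} (hf : Integrable f μ) (hg : Integrable g μ) :
    Integrable (fun x => f x - g x) μ := hf.sub hg

lemma memLp_fun_add {E F : Type*} [MeasurableSpace E] [NormedAddCommGroup F] {μ : Measure E}
    {p : ℝ≥0∞} {f g : E → F} (hf : MemLp f p μ) (hg : MemLp g p μ) :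
    MemLp (fun x => f x + g x) p μ := hf.add hg

lemma memLp_fun_sub {E F : Type*} [MeasurableSpace E] [NormedAddCommGroup F] {μ : Measure E}
    {p : ℝ≥0∞} {f g : E → F} (hf : MemLp f p μ) (hg : MemLp g p μ) :
    MemLp (fun x => f x - g x) p μ := hf.sub hg

lemma inner_toLp_toLp {E : Type*} [MeasurableSpace E] {μ : Measure E} {f g : E → ℂ}
    (hf : MemLp f 2 μ) (hg : MemLp g 2 μ) :
    inner ℂ (hf.toLp f) (hg.toLp g) = ∫ x, g x * conj (f x) ∂μ := by
  rw [L2.inner_def]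
  refine integral_congr_ae ?_
  filter_upwards [hf.coeFn_toLp, hg.coeFn_toLp] with x h1 h2
  rw [h1, h2, RCLike.inner_apply]

lemma integral_norm_sq_eq_re {E : Type*} [MeasurableSpace E] {μ : Measure E} (f : E → ℂ) :
    ∫ x, ‖f x‖ ^ 2 ∂μ = (∫ x, f x * conj (f x) ∂μ).re := by
  have h : ∀ x, f x * conj (f x) = ((‖f x‖ ^ 2 : ℝ) : ℂ) := fun x => by
    rw [Complex.mul_conj']; simp
  simp_rw [h]
  rw [integral_complex_ofReal, Complex.ofReal_re]

lemma MeasureTheory.MemLp.integrable_mul_conj {E : Type*} [MeasurableSpace E] {μ : Measure E}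
    {f g : E → ℂ} (hf : MemLp f 2 μ) (hg : MemLp g 2 μ) :
    Integrable (fun x => f x * conj (g x)) μ :=
  hf.integrable_mul (q := 2) hg.star

lemma norm_toLp_sq {E : Type*} [MeasurableSpace E] {μ : Measure E} {f : E → ℂ}
    (hf : MemLp f 2 μ) : ‖hf.toLp f‖ ^ 2 = ∫ x, ‖f x‖ ^ 2 ∂μ := by
  rw [integral_norm_sq_eq_re, ← inner_toLp_toLp hf hf, inner_self_eq_norm_sq_to_K]
  simp [← Complex.ofReal_pow]

/-- Convergence in `L²` of a sequence of functions; the terms and the limit are required to be in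
`L²`. -/
def L2Tendsto {E : Type*} [MeasurableSpace E] (μ : Measure E) (f : ℕ → E → ℂ) (g : E → ℂ) : Prop :=
  (∀ n, MemLp (f n) 2 μ) ∧ MemLp g 2 μ ∧ Tendsto (fun n => eLpNorm (f n - g) 2 μ) atTop (𝓝 0)

namespace L2Tendsto

variable {E : Type*} [MeasurableSpace E] {μ : Measure E} {f f' : ℕ → E → ℂ} {g g' : E → ℂ}

lemma tendsto_toLp (h : L2Tendsto μ f g) :
    Tendsto (fun n => (h.1 n).toLp (f n)) atTop (𝓝 (h.2.1.toLp g)) := by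
  rw [tendsto_iff_edist_tendsto_0]
  simp_rw [Lp.edist_toLp_toLp]
  exact h.2.2

lemma of_tendsto_toLp (hf : ∀ n, MemLp (f n) 2 μ) (hg : MemLp g 2 μ)
    (h : Tendsto (fun n => (hf n).toLp (f n)) atTop (𝓝 (hg.toLp g))) : L2Tendsto μ f g := by
  rw [tendsto_iff_edist_tendsto_0] at h
  simp_rw [Lp.edist_toLp_toLp] at h
  exact ⟨hf, hg, h⟩

lemma add (h : L2Tendsto μ f g) (h' : L2Tendsto μ f' g') :
    L2Tendsto μ (fun n x => f n x + f' n x) (fun x => g x + g' x) :=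
  of_tendsto_toLp (fun n => (h.1 n).add (h'.1 n)) (h.2.1.add h'.2.1)
    (h.tendsto_toLp.add h'.tendsto_toLp)

lemma sub (h : L2Tendsto μ f g) (h' : L2Tendsto μ f' g') :
    L2Tendsto μ (fun n x => f n x - f' n x) (fun x => g x - g' x) :=
  of_tendsto_toLp (fun n => (h.1 n).sub (h'.1 n)) (h.2.1.sub h'.2.1)
    (h.tendsto_toLp.sub h'.tendsto_toLp)

lemma sum {ι : Type*} {s : Finset ι} {f : ι → ℕ → E → ℂ} {g : ι → E → ℂ}
    (h : ∀ i, L2Tendsto μ (f i) (g i)) :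
    L2Tendsto μ (fun n x => ∑ i ∈ s, f i n x) (fun x => ∑ i ∈ s, g i x) := by
  classical
  induction s using Finset.induction_on with
  | empty => simpa using ⟨fun _ => MemLp.zero', MemLp.zero', by simp⟩
  | insert i s hi ih =>
    simp_rw [Finset.sum_insert hi]
    exact (h i).add ih

lemma tendsto_integral_mul_conj (h : L2Tendsto μ f g) (h' : L2Tendsto μ f' g') :
    Tendsto (fun n => ∫ x, f n x * conj (f' n x) ∂μ) atTop (𝓝 (∫ x, g x * conj (g' x) ∂μ)) := by
  simp_rw [← inner_toLp_toLp h'.2.1 h.2.1, ← inner_toLp_toLp (h'.1 _) (h.1 _)]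
  exact h'.tendsto_toLp.inner h.tendsto_toLp

lemma tendsto_integral_norm_sq (h : L2Tendsto μ f g) :
    Tendsto (fun n => ∫ x, ‖f n x‖ ^ 2 ∂μ) atTop (𝓝 (∫ x, ‖g x‖ ^ 2 ∂μ)) := by
  simp_rw [integral_norm_sq_eq_re]
  exact (Complex.continuous_re.tendsto _).comp (h.tendsto_integral_mul_conj h)

/-- Multiplication by a function which is bounded on a set outside of which everything vanishes. -/
lemma mul_left [TopologicalSpace E] [BorelSpace E] (h : L2Tendsto μ f g) {q : E → ℂ}
    (hq : Continuous q) {K : Set E} (hK : IsCompact K) (hf : ∀ n x, x ∉ K → f n x = 0)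
    (hg : ∀ x, x ∉ K → g x = 0) :
    L2Tendsto μ (fun n x => q x * f n x) (fun x => q x * g x) := by
  obtain ⟨C, hC⟩ := hK.exists_bound_of_continuousOn hq.continuousOn
  have aux : ∀ w : E → ℂ, (∀ x, x ∉ K → w x = 0) → ∀ x, ‖q x * w x‖ ≤ |C| * ‖w x‖ := by
    intro w hw x
    by_cases hx : x ∈ K
    · rw [norm_mul]
      exact mul_le_mul_of_nonneg_right ((hC x hx).trans (le_abs_self C)) (norm_nonneg _)
    · simp [hw x hx]
  have hm : ∀ w : E → ℂ, MemLp w 2 μ → (∀ x, x ∉ K → w x = 0) → MemLp (fun x => q x * w x) 2 μ :=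
    fun w hw hw0 => hw.of_le_mul (hq.aestronglyMeasurable.mul hw.1)
      (Eventually.of_forall (aux w hw0))
  refine ⟨fun n => hm _ (h.1 n) (hf n), hm _ h.2.1 hg, ?_⟩
  have hle : ∀ n, eLpNorm ((fun x => q x * f n x) - fun x => q x * g x) 2 μ
      ≤ ENNReal.ofReal |C| * eLpNorm (f n - g) 2 μ := fun n => by
    refine eLpNorm_le_mul_eLpNorm_of_ae_le_mul (Eventually.of_forall fun x => ?_) 2
    have := aux (f n - g) (fun x hx => by simp [hf n x hx, hg x hx]) x
    simpa [mul_sub] using this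
  have h0 : Tendsto (fun n => ENNReal.ofReal |C| * eLpNorm (f n - g) 2 μ) atTop (𝓝 0) := by
    simpa using ENNReal.Tendsto.const_mul h.2.2 (Or.inr ENNReal.ofReal_ne_top)
  exact tendsto_of_tendsto_of_tendsto_of_le_of_le tendsto_const_nhds h0 (fun _ => zero_le) hle

end L2Tendsto

variable {d : ℕ} {ψ : (Fin d → ℂ) → ℝ}

lemma MeasureTheory.MemLp.continuous_mul {E : Type*} [TopologicalSpace E] [MeasurableSpace E]
    [BorelSpace E] {μ : Measure E} {g q : E → ℂ} (hg : MemLp g 2 μ) (hq : Continuous q) {K : Set E}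
    (hK : IsCompact K) (h0 : ∀ x, x ∉ K → g x = 0) : MemLp (fun x => q x * g x) 2 μ :=
  (L2Tendsto.mul_left (f := fun _ => g) ⟨fun _ => hg, hg, by simp⟩ hq hK (fun _ => h0) h0).2.1

lemma integral_leviForm (hψ : ContDiff ℝ 2 ψ) {H : Fin d → (Fin d → ℂ) → ℂ} {K : Set (Fin d → ℂ)}
    (hK : IsCompact K) (hH : ∀ j, MemLp (H j) 2 volume) (h0 : ∀ j z, z ∉ K → H j z = 0) :
    Integrable (fun z => leviForm ψ z fun j => H j z) ∧
    ∫ z, leviForm ψ z (fun j => H j z)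
      = (∑ j, ∑ k, ∫ z, (leviMatrix ψ z j k * H j z) * conj (H k z)).re := by
  have cL : ∀ j k, Integrable fun z => leviMatrix ψ z j k * H j z * conj (H k z) := fun j k =>
    ((hH j).continuous_mul (continuous_leviMatrix hψ j k) hK (h0 j)).integrable_mul_conj (hH k)
  have hi := integrable_finsetSum (Finset.univ : Finset (Fin d)) fun j _ =>
    integrable_finsetSum (Finset.univ : Finset (Fin d)) fun k _ => cL j k
  refine ⟨hi.re, ?_⟩
  simp_rw [← integral_finsetSum _ fun k _ => cL _ k]
  rw [← integral_finsetSum _ fun j _ => integrable_finsetSum _ fun k _ => cL j k]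
  exact integral_re hi

/-- The Bochner-Kodaira-Hörmander inequality for a compactly supported `L²` form `H` for which
`∑_j (∂_j - ψ_j) H_j = a` and `(∂̄_j + ψ_{j̄}) H_k - (∂̄_k + ψ_{k̄}) H_j = s_{jk}` are in `L²`
in the sense of distributions: mollify `H`. Multiplication by the derivatives of `ψ` does not
commute with the mollification, but the error tends to `0` in `L²`. -/
lemma leviForm_le_of_weak (hψ : ContDiff ℝ 2 ψ) {H : Fin d → (Fin d → ℂ) → ℂ}
    {a : (Fin d → ℂ) → ℂ} {s : Fin d → Fin d → (Fin d → ℂ) → ℂ} {K : Set (Fin d → ℂ)}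
    (hK : IsCompact K) (hH : ∀ j, MemLp (H j) 2 volume) (h0 : ∀ j z, z ∉ K → H j z = 0)
    (ha2 : MemLp a 2 volume) (hs2 : ∀ j k, MemLp (s j k) 2 volume)
    (ha : ∀ w, ContDiff ℝ 2 w → HasCompactSupport w →
      ∫ z, ∑ j, H j z * conj (twistedDbar ψ j w z) = - ∫ z, a z * conj (w z))
    (hs : ∀ j k w, ContDiff ℝ 2 w → HasCompactSupport w →
      ∫ z, (H k z * conj (twistedD ψ j w z) - H j z * conj (twistedD ψ k w z))
        = - ∫ z, s j k z * conj (w z)) :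
    2 * ∫ z, leviForm ψ z (fun j => H j z) ≤ (∫ z, ‖a z‖ ^ 2)
      + 2⁻¹ * ∑ j, ∑ k, ∫ z, ‖s j k z‖ ^ 2 := by
  obtain ⟨ρ, hρ⟩ := exists_mollifier d
  have hψ' : ∀ j, Continuous (wirtingerD j fun w => (ψ w : ℂ)) := fun j =>
    (hψ.ofReal_comp.wirtingerD (m := 0) (by norm_num) j).continuous
  have hψ'' : ∀ j, Continuous (wirtingerDbar j fun w => (ψ w : ℂ)) := fun j =>
    (hψ.ofReal_comp.wirtingerDbar (m := 0) (by norm_num) j).continuous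
  set K₁ := Metric.cthickening 1 K with hK₁
  have hK₁c : IsCompact K₁ := hK.cthickening
  have hKK : ∀ z, z ∉ K₁ → z ∉ K := fun z hz h => hz (Metric.self_subset_cthickening K h)
  have hloc : ∀ {F : (Fin d → ℂ) → ℂ}, MemLp F 2 volume → LocallyIntegrable F := fun hF =>
    hF.locallyIntegrable (by norm_num)
  have hM0 : ∀ n j z, z ∉ K₁ → mollify (ρ n) (H j) z = 0 := fun n j z hz =>
    mollify_eq_zero (hρ n).2.2.2.2 (h0 j) fun h => hz (Metric.cthickening_mono (by
      rw [div_le_one (by positivity)]; linarith [(n.cast_nonneg : (0 : ℝ) ≤ n)]) K h)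
  have hMs : ∀ n j, ContDiff ℝ ∞ (mollify (ρ n) (H j)) := fun n j =>
    (hρ n).1.mollify (hρ n).2.1 (hloc (hH j))
  have hMc : ∀ n j, HasCompactSupport (mollify (ρ n) (H j)) := fun n j =>
    HasCompactSupport.intro hK₁c (hM0 n j)
  have conv : ∀ {F : (Fin d → ℂ) → ℂ}, MemLp F 2 volume →
      Tendsto (fun n => eLpNorm (mollify (ρ n) F - F) 2 volume) atTop (𝓝 0) := fun hF =>
    tendsto_eLpNorm_mollify_sub hρ hF
  have hML : ∀ j, L2Tendsto volume (fun n => mollify (ρ n) (H j)) (H j) := fun j =>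
    ⟨fun n => (hMs n j).continuous.memLp_of_hasCompactSupport (hMc n j), hH j, conv (hH j)⟩
  have h0' : ∀ j z, z ∉ K₁ → H j z = 0 := fun j z hz => h0 j z (hKK z hz)
  -- the test functions `ρ (x - ·)`
  have tw : ∀ n x, ContDiff ℝ 2 fun y => (ρ n (x - y) : ℂ) := fun n x =>
    (((hρ n).1.of_le (WithTop.coe_le_coe.2 (le_top : (2 : ℕ∞) ≤ ⊤))).comp
      (contDiff_const.sub contDiff_id)).ofReal_comp
  have twc : ∀ n x, HasCompactSupport fun y => (ρ n (x - y) : ℂ) := fun n x =>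
    ((hρ n).2.1.comp_const_sub x).comp_left (g := ((↑) : ℝ → ℂ)) Complex.ofReal_zero
  have twD : ∀ n x j y, wirtingerD j (fun y => (ρ n (x - y) : ℂ)) y
      = - wirtingerD j (fun y => (ρ n y : ℂ)) (x - y) := fun n x j y => by
    simp only [wirtingerD, fderiv_comp_const_sub_apply (q := fun y => (ρ n y : ℂ))]; ring
  have twDb : ∀ n x j y, wirtingerDbar j (fun y => (ρ n (x - y) : ℂ)) y
      = - wirtingerDbar j (fun y => (ρ n y : ℂ)) (x - y) := fun n x j y => by
    simp only [wirtingerDbar, fderiv_comp_const_sub_apply (q := fun y => (ρ n y : ℂ))]; ring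
  have iH : ∀ {F : (Fin d → ℂ) → ℂ}, MemLp F 2 volume → ∀ n x,
      Integrable fun y => (ρ n (x - y) : ℂ) * F y := fun hF n x =>
    integrable_mul_of_locallyIntegrable (tw n x).continuous (twc n x) (hloc hF)
  have iD : ∀ {F : (Fin d → ℂ) → ℂ}, MemLp F 2 volume → ∀ n x j,
      Integrable fun y => wirtingerD j (fun y => (ρ n y : ℂ)) (x - y) * F y := fun hF n x j => by
    have h := integrable_mul_of_locallyIntegrable
      (((tw n x).wirtingerD (m := 0) (by norm_num) j).continuous) ((twc n x).wirtingerD j) (hloc hF)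
    refine h.neg.congr (Eventually.of_forall fun y => ?_)
    simp [twD]
  have iDb : ∀ {F : (Fin d → ℂ) → ℂ}, MemLp F 2 volume → ∀ n x j,
      Integrable fun y => wirtingerDbar j (fun y => (ρ n y : ℂ)) (x - y) * F y :=
    fun hF n x j => by
    have h := integrable_mul_of_locallyIntegrable
      (((tw n x).wirtingerDbar (m := 0) (by norm_num) j).continuous) ((twc n x).wirtingerDbar j)
      (hloc hF)
    refine h.neg.congr (Eventually.of_forall fun y => ?_)
    simp [twDb]
  have mψ : ∀ j k, MemLp (fun z => wirtingerD j (fun w => (ψ w : ℂ)) z * H k z) 2 volume :=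
    fun j k => (hH k).continuous_mul (hψ' j) hK (h0 k)
  have mψ' : ∀ j k, MemLp (fun z => wirtingerDbar j (fun w => (ψ w : ℂ)) z * H k z) 2 volume :=
    fun j k => (hH k).continuous_mul (hψ'' j) hK (h0 k)
  -- the divergence of the mollified form
  have eqa : ∀ n x, ∑ j, twistedD ψ j (mollify (ρ n) (H j)) x
      = mollify (ρ n) (fun z => a z + ∑ j, wirtingerD j (fun w => (ψ w : ℂ)) z * H j z) x
        - ∑ j, wirtingerD j (fun w => (ψ w : ℂ)) x * mollify (ρ n) (H j) x := fun n x => by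
    have h := ha _ (tw n x) (twc n x)
    simp only [twistedDbar, map_add, map_mul, ← wirtingerD_conj, Complex.conj_ofReal, twD] at h
    have e1 : ∀ y, ∑ j, H j y * (-wirtingerD j (fun y => (ρ n y : ℂ)) (x - y)
        + wirtingerD j (fun w => (ψ w : ℂ)) y * (ρ n (x - y) : ℂ))
        = (∑ j, (ρ n (x - y) : ℂ) * (wirtingerD j (fun w => (ψ w : ℂ)) y * H j y))
          - ∑ j, wirtingerD j (fun y => (ρ n y : ℂ)) (x - y) * H j y := fun y => by
      rw [← Finset.sum_sub_distrib]
      exact Finset.sum_congr rfl fun j _ => by ring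
    simp_rw [e1] at h
    rw [integral_sub (integrable_finsetSum _ fun j _ => iH (mψ j j) n x)
      (integrable_finsetSum _ fun j _ => iD (hH j) n x j),
      integral_finsetSum _ fun j _ => iD (hH j) n x j] at h
    simp only [twistedD, Finset.sum_sub_distrib]
    simp_rw [wirtingerD_mollify (hρ n).1 (hρ n).2.1 (hloc (hH _))]
    congr 1
    have e2 : mollify (ρ n) (fun z => a z + ∑ j, wirtingerD j (fun w => (ψ w : ℂ)) z * H j z) x
        = (∫ y, a y * (ρ n (x - y) : ℂ)) + ∫ y, ∑ j, (ρ n (x - y) : ℂ)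
          * (wirtingerD j (fun w => (ψ w : ℂ)) y * H j y) := by
      have i1 : Integrable fun y => a y * (ρ n (x - y) : ℂ) := by
        simpa only [mul_comm] using iH ha2 n x
      rw [← integral_add i1 (integrable_finsetSum _ fun j _ => iH (mψ j j) n x)]
      refine integral_congr_ae (Eventually.of_forall fun y => ?_)
      simp only [mul_add, Finset.mul_sum]
      ring
    rw [e2]
    linear_combination -h
  -- the exterior derivative of the mollified form
  have eqs : ∀ n j k x, twistedDbar ψ j (mollify (ρ n) (H k)) x
      - twistedDbar ψ k (mollify (ρ n) (H j)) x
      = mollify (ρ n) (fun z => s j k z - wirtingerDbar j (fun w => (ψ w : ℂ)) z * H k z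
          + wirtingerDbar k (fun w => (ψ w : ℂ)) z * H j z) x
        + (wirtingerDbar j (fun w => (ψ w : ℂ)) x * mollify (ρ n) (H k) x
          - wirtingerDbar k (fun w => (ψ w : ℂ)) x * mollify (ρ n) (H j) x) := fun n j k x => by
    have h := hs j k _ (tw n x) (twc n x)
    simp only [twistedD, map_sub, map_mul, ← wirtingerDbar_conj, Complex.conj_ofReal, twDb] at h
    have e1 : ∀ y, H k y * (-wirtingerDbar j (fun y => (ρ n y : ℂ)) (x - y)
          - wirtingerDbar j (fun w => (ψ w : ℂ)) y * (ρ n (x - y) : ℂ))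
        - H j y * (-wirtingerDbar k (fun y => (ρ n y : ℂ)) (x - y)
          - wirtingerDbar k (fun w => (ψ w : ℂ)) y * (ρ n (x - y) : ℂ))
        = ((ρ n (x - y) : ℂ) * (wirtingerDbar k (fun w => (ψ w : ℂ)) y * H j y)
          - (ρ n (x - y) : ℂ) * (wirtingerDbar j (fun w => (ψ w : ℂ)) y * H k y))
          - (wirtingerDbar j (fun y => (ρ n y : ℂ)) (x - y) * H k y
            - wirtingerDbar k (fun y => (ρ n y : ℂ)) (x - y) * H j y) := fun y => by ring
    simp_rw [e1] at h
    rw [integral_sub (integrable_fun_sub (iH (mψ' k j) n x) (iH (mψ' j k) n x))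
      (integrable_fun_sub (iDb (hH k) n x j) (iDb (hH j) n x k)), integral_sub (iH (mψ' k j) n x)
      (iH (mψ' j k) n x), integral_sub (iDb (hH k) n x j) (iDb (hH j) n x k)] at h
    simp only [twistedDbar]
    simp_rw [wirtingerDbar_mollify (hρ n).1 (hρ n).2.1 (hloc (hH _))]
    have e2 : mollify (ρ n) (fun z => s j k z - wirtingerDbar j (fun w => (ψ w : ℂ)) z * H k z
          + wirtingerDbar k (fun w => (ψ w : ℂ)) z * H j z) x
        = (∫ y, s j k y * (ρ n (x - y) : ℂ))
          - (∫ y, (ρ n (x - y) : ℂ) * (wirtingerDbar j (fun w => (ψ w : ℂ)) y * H k y))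
          + ∫ y, (ρ n (x - y) : ℂ) * (wirtingerDbar k (fun w => (ψ w : ℂ)) y * H j y) := by
      have i1 : Integrable fun y => s j k y * (ρ n (x - y) : ℂ) := by
        simpa only [mul_comm] using iH (hs2 j k) n x
      rw [← integral_sub i1 (iH (mψ' j k) n x),
        ← integral_add (integrable_fun_sub i1 (iH (mψ' j k) n x)) (iH (mψ' k j) n x)]
      refine integral_congr_ae (Eventually.of_forall fun y => ?_)
      ring
    rw [e2]
    linear_combination -h
  have hML' : ∀ {F : (Fin d → ℂ) → ℂ}, MemLp F 2 volume →
      L2Tendsto volume (fun n => mollify (ρ n) F) F := fun hF =>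
    ⟨fun n => memLp_mollify hF (hρ n).1 (hρ n).2.2.1 (hρ n).2.2.2.1 (hρ n).2.1, hF, conv hF⟩
  have lima : Tendsto (fun n => ∫ z, ‖∑ j, twistedD ψ j (mollify (ρ n) (H j)) z‖ ^ 2) atTop
      (𝓝 (∫ z, ‖a z‖ ^ 2)) := by
    simp_rw [eqa]
    have h := ((hML' (memLp_fun_add ha2 (memLp_finsetSum Finset.univ fun j _ => mψ j j))).sub
      (L2Tendsto.sum (s := Finset.univ) fun j =>
        (hML j).mul_left (hψ' j) hK₁c (fun n => hM0 n j) (h0' j))).tendsto_integral_norm_sq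
    simpa using h
  have lims : ∀ j k, Tendsto (fun n => ∫ z, ‖twistedDbar ψ j (mollify (ρ n) (H k)) z
      - twistedDbar ψ k (mollify (ρ n) (H j)) z‖ ^ 2) atTop (𝓝 (∫ z, ‖s j k z‖ ^ 2)) :=
      fun j k => by
    simp_rw [eqs]
    have h := ((hML' (memLp_fun_add (memLp_fun_sub (hs2 j k) (mψ' j k)) (mψ' k j))).add
      (((hML k).mul_left (hψ'' j) hK₁c (fun n => hM0 n k) (h0' k)).sub
        ((hML j).mul_left (hψ'' k) hK₁c (fun n => hM0 n j) (h0' j)))).tendsto_integral_norm_sq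
    have e : ∀ z, s j k z - wirtingerDbar j (fun w => (ψ w : ℂ)) z * H k z
        + wirtingerDbar k (fun w => (ψ w : ℂ)) z * H j z
        + (wirtingerDbar j (fun w => (ψ w : ℂ)) z * H k z
          - wirtingerDbar k (fun w => (ψ w : ℂ)) z * H j z) = s j k z := fun z => by ring
    simp_rw [e] at h
    exact h
  have limL : Tendsto (fun n => ∫ z, leviForm ψ z fun j => mollify (ρ n) (H j) z) atTop
      (𝓝 (∫ z, leviForm ψ z fun j => H j z)) := by
    rw [(integral_leviForm hψ hK hH h0).2]
    simp_rw [fun n => (integral_leviForm hψ hK₁c (fun j => (hML j).1 n) (hM0 n)).2]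
    refine (Complex.continuous_re.tendsto _).comp (tendsto_finsetSum _ fun j _ =>
      tendsto_finsetSum _ fun k _ => ?_)
    exact ((hML j).mul_left (continuous_leviMatrix hψ j k) hK₁c (fun n => hM0 n j)
      (h0' j)).tendsto_integral_mul_conj (hML k)
  refine le_of_tendsto_of_tendsto' (limL.const_mul 2) (lima.add ((tendsto_finsetSum _ fun j _ =>
    tendsto_finsetSum _ fun k _ => lims j k).const_mul 2⁻¹)) fun n => ?_
  exact leviForm_le_of_contDiff hψ
    (fun j => (hMs n j).of_le (WithTop.coe_le_coe.2 (le_top : (2 : ℕ∞) ≤ ⊤))) (hMc n)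

end Weak

/-! ### The a priori estimate with a cutoff function -/

section Core

open Filter Topology

variable {d : ℕ} {ψ : (Fin d → ℂ) → ℝ}

lemma norm_sum_mul_sq_le (a b : Fin d → ℂ) :
    ‖∑ j, a j * b j‖ ^ 2 ≤ (∑ j, ‖a j‖ ^ 2) * ∑ j, ‖b j‖ ^ 2 := by
  have h1 : ‖∑ j, a j * b j‖ ≤ ∑ j, ‖a j‖ * ‖b j‖ :=
    (norm_sum_le _ _).trans (Finset.sum_le_sum fun j _ => (norm_mul _ _).le)
  exact (pow_le_pow_left₀ (norm_nonneg _) h1 2).trans (Finset.sum_mul_sq_le_sq_mul_sq _ _ _)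

lemma sum_norm_wedge_sq_le (a b : Fin d → ℂ) :
    (2⁻¹ : ℝ) * ∑ j, ∑ k, ‖a j * b k - a k * b j‖ ^ 2
      ≤ (∑ j, ‖a j‖ ^ 2) * ∑ j, ‖b j‖ ^ 2 := by
  rw [sum_norm_sub_sq fun j k => a j * b k]
  have h1 : ∑ j, ∑ k, ‖a j * b k‖ ^ 2 = (∑ j, ‖a j‖ ^ 2) * ∑ j, ‖b j‖ ^ 2 := by
    rw [Finset.sum_mul_sum]
    simp_rw [norm_mul, mul_pow]
  have h2 : ∑ j, ∑ k, a k * b j * conj (a j * b k)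
      = (∑ k, a k * conj (b k)) * conj (∑ k, a k * conj (b k)) := by
    rw [mul_comm, map_sum, Finset.sum_mul_sum]
    refine Finset.sum_congr rfl fun j _ => Finset.sum_congr rfl fun k _ => ?_
    simp only [map_mul, Complex.conj_conj]; ring
  rw [h1, h2, Complex.mul_conj]
  simp only [Complex.ofReal_re]
  linarith [Complex.normSq_nonneg (∑ k, a k * conj (b k))]

/-- The pointwise bound for the terms produced by a cutoff function `θ` with `∂_j θ = t_j`. -/
lemma cutoff_terms_le (c h : ℂ) (t g : Fin d → ℂ) :
    ‖c * h + ∑ j, t j * g j‖ ^ 2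
        + 2⁻¹ * ∑ j, ∑ k, ‖conj (t j) * g k - conj (t k) * g j‖ ^ 2
      ≤ 2 * (‖c‖ ^ 2 * ‖h‖ ^ 2) + 3 * (∑ j, ‖t j‖ ^ 2) * ∑ j, ‖g j‖ ^ 2 := by
  have h1 := norm_sum_mul_sq_le t g
  have h2 := sum_norm_wedge_sq_le (fun j => conj (t j)) g
  simp only [RCLike.norm_conj] at h2
  have h3 : ‖c * h + ∑ j, t j * g j‖ ^ 2 ≤ 2 * (‖c‖ ^ 2 * ‖h‖ ^ 2) + 2 * ‖∑ j, t j * g j‖ ^ 2 := by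
    have h4 := norm_add_le (c * h) (∑ j, t j * g j)
    have h5 := pow_le_pow_left₀ (norm_nonneg _) h4 2
    have h6 := norm_mul c h
    rw [h6] at h5
    nlinarith [sq_nonneg (‖c‖ * ‖h‖ - ‖∑ j, t j * g j‖)]
  linarith

lemma leviForm_smul (ψ : (Fin d → ℂ) → ℝ) (z : Fin d → ℂ) (c : ℝ) (w : Fin d → ℂ) :
    leviForm ψ z (fun j => (c : ℂ) * w j) = c ^ 2 * leviForm ψ z w := by
  have : (∑ j, ∑ l, leviMatrix ψ z j l * ((c : ℂ) * w j) * conj ((c : ℂ) * w l))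
      = ((c ^ 2 : ℝ) : ℂ) * ∑ j, ∑ l, leviMatrix ψ z j l * w j * conj (w l) := by
    simp_rw [Finset.mul_sum]
    refine Finset.sum_congr rfl fun j _ => Finset.sum_congr rfl fun l _ => ?_
    simp only [map_mul, Complex.conj_ofReal]; push_cast; ring
  rw [leviForm, this, Complex.re_ofReal_mul, leviForm]

lemma twistedDbar_ofReal_mul {θ : (Fin d → ℂ) → ℝ} {w : (Fin d → ℂ) → ℂ} {z : Fin d → ℂ}
    (hθ : DifferentiableAt ℝ θ z) (hw : DifferentiableAt ℝ w z) (j : Fin d) :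
    twistedDbar ψ j (fun z => (θ z : ℂ) * w z) z
      = θ z * twistedDbar ψ j w z + wirtingerDbar j (fun z => (θ z : ℂ)) z * w z := by
  have h : DifferentiableAt ℝ (fun z => (θ z : ℂ)) z :=
    Complex.ofRealCLM.differentiableAt.comp z hθ
  rw [twistedDbar, wirtingerDbar_mul j h hw, twistedDbar]; ring

lemma twistedD_ofReal_mul {θ : (Fin d → ℂ) → ℝ} {w : (Fin d → ℂ) → ℂ} {z : Fin d → ℂ}
    (hθ : DifferentiableAt ℝ θ z) (hw : DifferentiableAt ℝ w z) (j : Fin d) :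
    twistedD ψ j (fun z => (θ z : ℂ) * w z) z
      = θ z * twistedD ψ j w z + wirtingerD j (fun z => (θ z : ℂ)) z * w z := by
  have h : DifferentiableAt ℝ (fun z => (θ z : ℂ)) z :=
    Complex.ofRealCLM.differentiableAt.comp z hθ
  rw [twistedD, wirtingerD_mul j h hw, twistedD]; ring

/-- `L²_{(0,1)}(ℂ^d)`, as the Hilbert sum of `d` copies of `L²(ℂ^d)`. -/
abbrev L2Forms (d : ℕ) : Type := PiLp 2 fun _ : Fin d => Lp ℂ 2 (volume : Measure (Fin d → ℂ))

/-- The form with components `f j`. -/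
def toForm (f : Fin d → (Fin d → ℂ) → ℂ) (hf : ∀ j, MemLp (f j) 2 volume) : L2Forms d :=
  WithLp.toLp 2 fun j => (hf j).toLp (f j)

lemma inner_toForm {f g : Fin d → (Fin d → ℂ) → ℂ} (hf : ∀ j, MemLp (f j) 2 volume)
    (hg : ∀ j, MemLp (g j) 2 volume) :
    inner ℂ (toForm f hf) (toForm g hg) = ∑ j, ∫ z, g j z * conj (f j z) := by
  rw [PiLp.inner_apply]
  exact Finset.sum_congr rfl fun j _ => inner_toLp_toLp (hf j) (hg j)

lemma norm_toForm_sq {f : Fin d → (Fin d → ℂ) → ℂ} (hf : ∀ j, MemLp (f j) 2 volume) :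
    ‖toForm f hf‖ ^ 2 = ∑ j, ∫ z, ‖f j z‖ ^ 2 := by
  rw [PiLp.norm_sq_eq_of_L2]
  exact Finset.sum_congr rfl fun j _ => norm_toLp_sq (hf j)

lemma toForm_coe (x : L2Forms d) :
    toForm (fun j => (x j : (Fin d → ℂ) → ℂ)) (fun j => Lp.memLp (x j)) = x := by
  ext1 j
  exact Lp.toLp_coeFn (x j) (Lp.memLp (x j))

lemma memLp_twistedDbar (hψ : ContDiff ℝ 2 ψ) {v : (Fin d → ℂ) → ℂ} (hv : ContDiff ℝ 2 v)
    (hc : HasCompactSupport v) (j : Fin d) : MemLp (twistedDbar ψ j v) 2 volume :=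
  (continuous_twistedDbar (hv.of_le (by norm_num)) (hψ.of_le (by norm_num))
    j).memLp_of_hasCompactSupport (hc.twistedDbar ψ j)

lemma memLp_twistedD (hψ : ContDiff ℝ 2 ψ) {v : (Fin d → ℂ) → ℂ} (hv : ContDiff ℝ 2 v)
    (hc : HasCompactSupport v) (j : Fin d) : MemLp (twistedD ψ j v) 2 volume :=
  (continuous_twistedD (hv.of_le (by norm_num)) (hψ.of_le (by norm_num))
    j).memLp_of_hasCompactSupport (hc.twistedD ψ j)

/-- The closure in `L²` of the exact forms `(∂̄ + ∂̄ψ) v`, for compactly supported `v`. -/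
def exactForms (hψ : ContDiff ℝ 2 ψ) : Submodule ℂ (L2Forms d) :=
  (Submodule.span ℂ {x | ∃ (v : (Fin d → ℂ) → ℂ) (hv : ContDiff ℝ 2 v) (hc : HasCompactSupport v),
    x = toForm (fun j => twistedDbar ψ j v) (memLp_twistedDbar hψ hv hc)}).topologicalClosure

lemma toForm_twistedDbar_mem (hψ : ContDiff ℝ 2 ψ) {v : (Fin d → ℂ) → ℂ} (hv : ContDiff ℝ 2 v)
    (hc : HasCompactSupport v) :
    toForm (fun j => twistedDbar ψ j v) (memLp_twistedDbar hψ hv hc) ∈ exactForms hψ :=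
  Submodule.le_topologicalClosure _ (Submodule.subset_span ⟨v, hv, hc, rfl⟩)

/-- Limits of exact forms are closed in the sense of distributions. -/
lemma exactForms_closed (hψ : ContDiff ℝ 2 ψ) {x : L2Forms d} (hx : x ∈ exactForms hψ)
    (j k : Fin d) {w : (Fin d → ℂ) → ℂ} (hw : ContDiff ℝ 2 w) (hc : HasCompactSupport w) :
    ∫ z, x k z * conj (twistedD ψ j w z) = ∫ z, x j z * conj (twistedD ψ k w z) := by
  have hψ1 : ContDiff ℝ 1 ψ := hψ.of_le (by norm_num)
  let T : L2Forms d →L[ℂ] ℂ :=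
    (innerSL ℂ ((memLp_twistedD hψ hw hc j).toLp _)).comp (PiLp.proj 2 _ k)
      - (innerSL ℂ ((memLp_twistedD hψ hw hc k).toLp _)).comp (PiLp.proj 2 _ j)
  have hT : ∀ y : L2Forms d, T y = (∫ z, y k z * conj (twistedD ψ j w z))
      - ∫ z, y j z * conj (twistedD ψ k w z) := fun y => by
    rw [← inner_toLp_toLp (memLp_twistedD hψ hw hc j) (Lp.memLp (y k)),
      ← inner_toLp_toLp (memLp_twistedD hψ hw hc k) (Lp.memLp (y j)), Lp.toLp_coeFn, Lp.toLp_coeFn]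
    rfl
  have hker : exactForms hψ ≤ LinearMap.ker (T : L2Forms d →ₗ[ℂ] ℂ) := by
    refine Submodule.topologicalClosure_minimal _ (Submodule.span_le.2 ?_) T.isClosed_ker
    rintro _ ⟨v, hv, hvc, rfl⟩
    change T _ = 0
    have hv1 : ∀ i, ContDiff ℝ 1 (twistedDbar ψ i v) := fun i => hv.twistedDbar hψ (by norm_num) i
    have e : ∀ i l, ∫ z, toForm (fun j => twistedDbar ψ j v) (memLp_twistedDbar hψ hv hvc) i z
        * conj (twistedD ψ l w z) = - ∫ z, twistedDbar ψ l (twistedDbar ψ i v) z * conj (w z) :=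
      fun i l => by
      rw [integral_twistedDbar_mul_conj hψ1 (hv1 i) (hw.of_le (by norm_num)) hc l, neg_neg]
      refine integral_congr_ae ?_
      filter_upwards [(memLp_twistedDbar hψ hv hvc i).coeFn_toLp] with z hz
      exact congrArg (· * _) hz
    rw [hT, e, e]
    simp_rw [twistedDbar_comm hψ hv j k]
    simp
  have := hker hx
  rw [LinearMap.mem_ker, ContinuousLinearMap.coe_coe, hT, sub_eq_zero] at this
  exact this

/-- The a priori estimate in dual form: `θ` is a cutoff function whose gradient is controlled by
the Levi form of `ψ`, up to a small `ε`. In the pairing with `(∂̄ + ∂̄ψ) u` the form `g` can be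
replaced by its projection `P` to the closure of the exact forms, which is closed and has the same
divergence as `g`; as `u` is supported where `θ = 1`, it can even be replaced by `θ P`, to which the
Bochner-Kodaira-Hörmander inequality applies. -/
lemma norm_integral_twistedDbar_sq_le (hψ : ContDiff ℝ 2 ψ) {θ : (Fin d → ℂ) → ℝ}
    (hθ : ContDiff ℝ 2 θ) (hθc : HasCompactSupport θ) (hθ01 : ∀ z, θ z ∈ Icc (0 : ℝ) 1) {ε : ℝ}
    (hlevi : ∀ z w, (θ z ^ 2 + 3 * (∑ j, ‖wirtingerD j (fun z => (θ z : ℂ)) z‖ ^ 2) - ε)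
      * ∑ j, ‖w j‖ ^ 2 ≤ 2 * (θ z ^ 2 * leviForm ψ z w)) (hε : 0 ≤ ε)
    {u : (Fin d → ℂ) → ℂ} {g : Fin d → (Fin d → ℂ) → ℂ} (hu : ContDiff ℝ 2 u)
    (huc : HasCompactSupport u) (hg : ∀ j, ContDiff ℝ 2 (g j)) (hgc : ∀ j, HasCompactSupport (g j))
    (hθu : ∀ z ∈ tsupport u, θ z = 1) :
    ‖∑ j, ∫ z, twistedDbar ψ j u z * conj (g j z)‖ ^ 2 ≤ (∑ j, ∫ z, ‖twistedDbar ψ j u z‖ ^ 2)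
      * (2 * (∫ z, ‖∑ j, twistedD ψ j (g j) z‖ ^ 2) + ε * ∑ j, ∫ z, ‖g j z‖ ^ 2) := by
  have hψ1 : ContDiff ℝ 1 ψ := hψ.of_le (by norm_num)
  have hθc' : HasCompactSupport fun z => (θ z : ℂ) :=
    hθc.comp_left (g := ((↑) : ℝ → ℂ)) Complex.ofReal_zero
  have hg2 : ∀ j, MemLp (g j) 2 volume := fun j =>
    (hg j).continuous.memLp_of_hasCompactSupport (hgc j)
  set h : (Fin d → ℂ) → ℂ := fun z => ∑ j, twistedD ψ j (g j) z with hh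
  have hh2 : MemLp h 2 volume := memLp_finsetSum _ fun j _ => memLp_twistedD hψ (hg j) (hgc j) j
  let G : L2Forms d := toForm g hg2
  have hclosed : IsClosed (exactForms hψ : Set (L2Forms d)) :=
    Submodule.isClosed_topologicalClosure _
  have : CompleteSpace (exactForms hψ) := hclosed.completeSpace_coe
  let P : L2Forms d := (exactForms hψ).starProjection G
  have hP : P ∈ exactForms hψ := Submodule.starProjection_apply_mem _ _
  have hPn : ‖P‖ ≤ ‖G‖ := Submodule.norm_starProjection_apply_le _ _
  have hPi : ∀ x ∈ exactForms hψ, inner ℂ x P = inner ℂ x G := fun x hx => by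
    have := Submodule.starProjection_inner_eq_zero (K := exactForms hψ) G x hx
    have h2 : inner ℂ x (G - P) = 0 := inner_eq_zero_symm.1 this
    rw [inner_sub_right, sub_eq_zero] at h2
    exact h2.symm
  let p : Fin d → (Fin d → ℂ) → ℂ := fun j => P j
  have hp2 : ∀ j, MemLp (p j) 2 volume := fun j => Lp.memLp (P j)
  have hPp : toForm p hp2 = P := toForm_coe P
  have cθ : Continuous fun z => (θ z : ℂ) := Complex.continuous_ofReal.comp hθ.continuous
  have ctD : ∀ j, Continuous (wirtingerD j fun z => (θ z : ℂ)) := fun j =>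
    (hθ.ofReal_comp.wirtingerD (m := 0) (by norm_num) j).continuous
  have ctDb : ∀ j, Continuous (wirtingerDbar j fun z => (θ z : ℂ)) := fun j =>
    (hθ.ofReal_comp.wirtingerDbar (m := 0) (by norm_num) j).continuous
  have bdd : ∀ {q f : (Fin d → ℂ) → ℂ}, Continuous q → HasCompactSupport q → MemLp f 2 volume →
      MemLp (fun z => q z * f z) 2 volume := fun {q f} hq hqc hf => by
    obtain ⟨C, hC⟩ := hqc.exists_bound_of_continuous hq
    refine hf.of_le_mul (c := C) (hq.aestronglyMeasurable.mul hf.1)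
      (Eventually.of_forall fun z => ?_)
    rw [norm_mul]
    exact mul_le_mul_of_nonneg_right (hC z) (norm_nonneg _)
  have hH2 : ∀ j, MemLp (fun z => (θ z : ℂ) * p j z) 2 volume := fun j => bdd cθ hθc' (hp2 j)
  have hH0 : ∀ j z, z ∉ tsupport θ → (θ z : ℂ) * p j z = 0 := fun j z hz => by
    simp [image_eq_zero_of_notMem_tsupport hz]
  have ha2 : MemLp (fun z => (θ z : ℂ) * h z
      + ∑ j, wirtingerD j (fun z => (θ z : ℂ)) z * p j z) 2 volume :=
    memLp_fun_add (bdd cθ hθc' hh2) (memLp_finsetSum _ fun j _ =>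
      bdd (ctD j) (hθc'.wirtingerD j) (hp2 j))
  have hs2 : ∀ j k, MemLp (fun z => wirtingerDbar j (fun z => (θ z : ℂ)) z * p k z
      - wirtingerDbar k (fun z => (θ z : ℂ)) z * p j z) 2 volume := fun j k =>
    memLp_fun_sub (bdd (ctDb j) (hθc'.wirtingerDbar j) (hp2 k))
      (bdd (ctDb k) (hθc'.wirtingerDbar k) (hp2 j))
  have hθw : ∀ {w : (Fin d → ℂ) → ℂ}, ContDiff ℝ 2 w → ContDiff ℝ 2 fun z => (θ z : ℂ) * w z :=
    fun hw => hθ.ofReal_comp.mul hw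
  have dθ : ∀ z, DifferentiableAt ℝ θ z := hθ.differentiable (by simp)
  have dw : ∀ {w : (Fin d → ℂ) → ℂ}, ContDiff ℝ 2 w → ∀ z, DifferentiableAt ℝ w z := fun hw =>
    hw.differentiable (by simp)
  have memw : ∀ {w : (Fin d → ℂ) → ℂ}, ContDiff ℝ 2 w → HasCompactSupport w → MemLp w 2 volume :=
    fun hw hwc => hw.continuous.memLp_of_hasCompactSupport hwc
  have key := leviForm_le_of_weak hψ hθc.isCompact hH2 hH0 ha2 hs2 ?_ ?_
  · have hpt : ∀ z, ‖(θ z : ℂ) * h z + ∑ j, wirtingerD j (fun z => (θ z : ℂ)) z * p j z‖ ^ 2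
        + 2⁻¹ * ∑ j, ∑ k, ‖wirtingerDbar j (fun z => (θ z : ℂ)) z * p k z
            - wirtingerDbar k (fun z => (θ z : ℂ)) z * p j z‖ ^ 2
        ≤ 2 * leviForm ψ z (fun j => (θ z : ℂ) * p j z) + (2 * ‖h z‖ ^ 2 + ε * ∑ j, ‖p j z‖ ^ 2)
          - ∑ j, ‖(θ z : ℂ) * p j z‖ ^ 2 := fun z => by
      have h1 := cutoff_terms_le (θ z : ℂ) (h z)
        (fun j => wirtingerD j (fun z => (θ z : ℂ)) z) (fun j => p j z)
      simp only [conj_wirtingerD_ofReal] at h1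
      have h2 := hlevi z fun j => p j z
      rw [leviForm_smul]
      have h3 : ∑ j, ‖(θ z : ℂ) * p j z‖ ^ 2 = θ z ^ 2 * ∑ j, ‖p j z‖ ^ 2 := by
        rw [Finset.mul_sum]
        refine Finset.sum_congr rfl fun j _ => ?_
        rw [norm_mul, mul_pow, Complex.norm_real, Real.norm_eq_abs, sq_abs]
      have h4 : ‖(θ z : ℂ)‖ ^ 2 * ‖h z‖ ^ 2 ≤ ‖h z‖ ^ 2 := by
        rw [Complex.norm_real, Real.norm_eq_abs, sq_abs]
        have : θ z ^ 2 ≤ 1 := pow_le_one₀ (hθ01 z).1 (hθ01 z).2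
        exact mul_le_of_le_one_left (by positivity) this
      rw [h3]
      linarith
    have isq : ∀ {f : (Fin d → ℂ) → ℂ}, MemLp f 2 volume → Integrable fun z => ‖f z‖ ^ 2 :=
      fun hf => hf.integrable_norm_pow (by norm_num)
    have iL := (integral_leviForm hψ hθc.isCompact hH2 hH0).1
    have i1 := isq ha2
    have i2 : Integrable fun z => 2⁻¹ * ∑ j, ∑ k, ‖wirtingerDbar j (fun z => (θ z : ℂ)) z * p k z
            - wirtingerDbar k (fun z => (θ z : ℂ)) z * p j z‖ ^ 2 :=
      (integrable_finsetSum _ fun j _ => integrable_finsetSum _ fun k _ =>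
        isq (hs2 j k)).const_mul _
    have i3 : Integrable fun z => 2 * ‖h z‖ ^ 2 + ε * ∑ j, ‖p j z‖ ^ 2 :=
      ((isq hh2).const_mul 2).add ((integrable_finsetSum _ fun j _ => isq (hp2 j)).const_mul ε)
    have i4 : Integrable fun z => ∑ j, ‖(θ z : ℂ) * p j z‖ ^ 2 :=
      integrable_finsetSum _ fun j _ => isq (hH2 j)
    have e1 : ∫ z, 2⁻¹ * ∑ j, ∑ k, ‖wirtingerDbar j (fun z => (θ z : ℂ)) z * p k z
            - wirtingerDbar k (fun z => (θ z : ℂ)) z * p j z‖ ^ 2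
        = 2⁻¹ * ∑ j, ∑ k, ∫ z, ‖wirtingerDbar j (fun z => (θ z : ℂ)) z * p k z
            - wirtingerDbar k (fun z => (θ z : ℂ)) z * p j z‖ ^ 2 := by
      rw [integral_const_mul, integral_finsetSum _ fun j _ => integrable_finsetSum _ fun k _ =>
        isq (hs2 j k)]
      congr 1
      exact Finset.sum_congr rfl fun j _ => integral_finsetSum _ fun k _ => isq (hs2 j k)
    have e2 : ∫ z, (2 * ‖h z‖ ^ 2 + ε * ∑ j, ‖p j z‖ ^ 2)
        = 2 * (∫ z, ‖h z‖ ^ 2) + ε * ‖P‖ ^ 2 := by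
      rw [integral_add ((isq hh2).const_mul 2)
        ((integrable_finsetSum _ fun j _ => isq (hp2 j)).const_mul ε), integral_const_mul,
        integral_const_mul, integral_finsetSum _ fun j _ => isq (hp2 j), ← hPp, norm_toForm_sq]
    have e3 : ∫ z, ∑ j, ‖(θ z : ℂ) * p j z‖ ^ 2 = ‖toForm _ hH2‖ ^ 2 := by
      rw [norm_toForm_sq, integral_finsetSum _ fun j _ => isq (hH2 j)]
    have hint := integral_mono (i1.add i2) (((iL.const_mul 2).add i3).sub i4) hpt
    simp only [Pi.add_apply, Pi.sub_apply] at hint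
    rw [integral_add i1 i2, integral_sub ((iL.const_mul 2).fun_add i3) i4,
      e1, integral_add (iL.const_mul 2) i3, integral_const_mul, e2, e3] at hint
    have hfin : ‖toForm _ hH2‖ ^ 2 ≤ 2 * (∫ z, ‖h z‖ ^ 2) + ε * ‖P‖ ^ 2 := by linarith
    have hPG : ε * ‖P‖ ^ 2 ≤ ε * ∑ j, ∫ z, ‖g j z‖ ^ 2 := by
      rw [← norm_toForm_sq hg2]
      exact mul_le_mul_of_nonneg_left (pow_le_pow_left₀ (norm_nonneg _) hPn 2) hε
    -- the pairing of `(∂̄ + ∂̄ψ) u` with `g` only sees `θ P`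
    have hpair : conj (∑ j, ∫ z, twistedDbar ψ j u z * conj (g j z))
        = inner ℂ (toForm _ (memLp_twistedDbar hψ hu huc)) (toForm _ hH2) := by
      have h1 := hPi _ (toForm_twistedDbar_mem hψ hu huc)
      rw [← hPp, inner_toForm, inner_toForm] at h1
      rw [inner_toForm, map_sum]
      have h2 : ∀ j, ∫ z, (θ z : ℂ) * p j z * conj (twistedDbar ψ j u z)
          = ∫ z, p j z * conj (twistedDbar ψ j u z) := fun j => by
        refine integral_congr_ae (Eventually.of_forall fun z => ?_)
        by_cases hz : z ∈ tsupport u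
        · simp [hθu z hz]
        · have : twistedDbar ψ j u z = 0 := by
            by_contra h'; exact hz (support_twistedDbar_subset ψ j u h')
          simp [this]
      simp_rw [h2]
      rw [h1]
      refine Finset.sum_congr rfl fun j _ => ?_
      rw [← integral_conj]
      simp [mul_comm]
    rw [← RCLike.norm_conj, hpair, ← norm_toForm_sq (memLp_twistedDbar hψ hu huc)]
    refine (pow_le_pow_left₀ (norm_nonneg _) (norm_inner_le_norm _ _) 2).trans ?_
    rw [mul_pow]
    exact mul_le_mul_of_nonneg_left (by linarith) (by positivity)
  · -- the divergence of `θ P` is `θ h + ∑_j (∂_j θ) P_j`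
    intro w hw hwc
    have hwc' : HasCompactSupport fun z => (θ z : ℂ) * w z := hwc.mul_left
    have h1 := hPi _ (toForm_twistedDbar_mem hψ (hθw hw) hwc')
    rw [← hPp, inner_toForm, inner_toForm] at h1
    have h2 : ∀ j, ∫ z, g j z * conj (twistedDbar ψ j (fun z => (θ z : ℂ) * w z) z)
        = - ∫ z, twistedD ψ j (g j) z * conj ((θ z : ℂ) * w z) := fun j => by
      rw [integral_twistedD_mul_conj hψ1 ((hg j).of_le (by norm_num))
        ((hθw hw).of_le (by norm_num)) (hgc j) j, neg_neg]
    simp_rw [h2] at h1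
    have i1 : ∀ j, Integrable fun z =>
        p j z * conj (twistedDbar ψ j (fun z => (θ z : ℂ) * w z) z) := fun j =>
      (hp2 j).integrable_mul_conj (memLp_twistedDbar hψ (hθw hw) hwc' j)
    have i2 : ∀ j, Integrable fun z => wirtingerD j (fun z => (θ z : ℂ)) z * p j z * conj (w z) :=
      fun j => (bdd (ctD j) (hθc'.wirtingerD j) (hp2 j)).integrable_mul_conj (memw hw hwc)
    have i3 : ∀ j, Integrable fun z => twistedD ψ j (g j) z * conj ((θ z : ℂ) * w z) := fun j =>
      (memLp_twistedD hψ (hg j) (hgc j) j).integrable_mul_conj (memw (hθw hw) hwc')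
    have e1 : ∀ z, ∑ j, (θ z : ℂ) * p j z * conj (twistedDbar ψ j w z)
        = (∑ j, p j z * conj (twistedDbar ψ j (fun z => (θ z : ℂ) * w z) z))
          - ∑ j, wirtingerD j (fun z => (θ z : ℂ)) z * p j z * conj (w z) := fun z => by
      rw [← Finset.sum_sub_distrib]
      refine Finset.sum_congr rfl fun j _ => ?_
      rw [twistedDbar_ofReal_mul (dθ z) (dw hw z)]
      simp only [map_add, map_mul, Complex.conj_ofReal, conj_wirtingerDbar_ofReal]
      ring
    have e2 : ∀ z, ((θ z : ℂ) * h z + ∑ j, wirtingerD j (fun z => (θ z : ℂ)) z * p j z) * conj (w z)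
        = (∑ j, twistedD ψ j (g j) z * conj ((θ z : ℂ) * w z))
          + ∑ j, wirtingerD j (fun z => (θ z : ℂ)) z * p j z * conj (w z) := fun z => by
      simp only [hh, add_mul, Finset.mul_sum, Finset.sum_mul, map_mul, Complex.conj_ofReal]
      congr 1
      exact Finset.sum_congr rfl fun j _ => by ring
    simp_rw [e1, e2]
    rw [integral_sub (integrable_finsetSum _ fun j _ => i1 j)
      (integrable_finsetSum _ fun j _ => i2 j), integral_add (integrable_finsetSum _ fun j _ => i3 j)
      (integrable_finsetSum _ fun j _ => i2 j), integral_finsetSum _ fun j _ => i1 j,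
      integral_finsetSum _ fun j _ => i3 j, h1, Finset.sum_neg_distrib]
    ring
  · -- the exterior derivative of `θ P` is `∂̄θ ∧ P`
    intro j k w hw hwc
    have hwc' : HasCompactSupport fun z => (θ z : ℂ) * w z := hwc.mul_left
    have h1 := exactForms_closed hψ hP j k (hθw hw) hwc'
    have i1 : ∀ j k, Integrable fun z => p k z * conj (twistedD ψ j (fun z => (θ z : ℂ) * w z) z) :=
      fun j k => (hp2 k).integrable_mul_conj (memLp_twistedD hψ (hθw hw) hwc' j)
    have i2 : Integrable fun z => (wirtingerDbar j (fun z => (θ z : ℂ)) z * p k z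
      - wirtingerDbar k (fun z => (θ z : ℂ)) z * p j z) * conj (w z) :=
      (hs2 j k).integrable_mul_conj (memw hw hwc)
    have e1 : ∀ z, (θ z : ℂ) * p k z * conj (twistedD ψ j w z)
        - (θ z : ℂ) * p j z * conj (twistedD ψ k w z)
        = (p k z * conj (twistedD ψ j (fun z => (θ z : ℂ) * w z) z)
          - p j z * conj (twistedD ψ k (fun z => (θ z : ℂ) * w z) z))
          - (wirtingerDbar j (fun z => (θ z : ℂ)) z * p k z
            - wirtingerDbar k (fun z => (θ z : ℂ)) z * p j z) * conj (w z) := fun z => by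
      rw [twistedD_ofReal_mul (dθ z) (dw hw z), twistedD_ofReal_mul (dθ z) (dw hw z)]
      simp only [map_add, map_mul, Complex.conj_ofReal, conj_wirtingerD_ofReal]
      ring
    simp_rw [e1]
    rw [integral_sub (integrable_fun_sub (i1 j k) (i1 k j)) i2, integral_sub (i1 j k) (i1 k j), h1,
      sub_self, zero_sub]

end Core

/-! ### Cutoff functions and Levi forms -/

section Cutoff

open Filter Topology

/-- A smooth cutoff function which is `1` near the closed set `K` and is supported in the open set
`N`. -/
lemma exists_smooth_cutoff {E : Type*} [NormedAddCommGroup E] [NormedSpace ℝ E]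
    [FiniteDimensional ℝ E] {K N : Set E} (hK : IsClosed K) (hN : IsOpen N) (h : K ⊆ N) :
    ∃ β : E → ℝ, ContDiff ℝ ∞ β ∧ (∀ x, β x ∈ Icc (0 : ℝ) 1) ∧ (∀ x ∈ K, ∀ᶠ y in 𝓝 x, β y = 1) ∧
      tsupport β ⊆ N := by
  obtain ⟨f, h0, h1, hf⟩ := exists_contMDiffMap_zero_one_nhds_of_isClosed (n := (⊤ : ℕ∞))
    (modelWithCornersSelf ℝ E) hN.isClosed_compl hK (disjoint_compl_left_iff_subset.2 h)
  refine ⟨f, f.contMDiff.contDiff, hf, fun x hx => ?_, fun x hx => ?_⟩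
  · exact (eventually_nhdsSet_iff_forall.1 h1) x hx
  · by_contra hxN
    have := (eventually_nhdsSet_iff_forall.1 h0) x hxN
    exact (notMem_tsupport_iff_eventuallyEq.2 this) hx

/-- A function vanishing near each point outside the open set `s` is as smooth as its restriction
to `s`. -/
lemma ContDiffOn.contDiff_of_eventually_zero {E F : Type*} [NormedAddCommGroup E]
    [NormedSpace ℝ E] [NormedAddCommGroup F] [NormedSpace ℝ F] {f : E → F} {s : Set E}
    {n : WithTop ℕ∞} (hf : ContDiffOn ℝ n f s) (hs : IsOpen s)
    (h : ∀ x, x ∉ s → ∀ᶠ y in 𝓝 x, f y = 0) : ContDiff ℝ n f := by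
  rw [contDiff_iff_contDiffAt]
  intro x
  by_cases hx : x ∈ s
  · exact hf.contDiffAt (hs.mem_nhds hx)
  · exact contDiffAt_const.congr_of_eventuallyEq (h x hx)

/-- The power `x_+^(n+1)` of the positive part is differentiable for `n ≥ 1`. -/
lemma hasDerivAt_posPart_pow (n : ℕ) (hn : 1 ≤ n) (x : ℝ) :
    HasDerivAt (fun x : ℝ => (max x 0) ^ (n + 1)) ((n + 1) * (max x 0) ^ n) x := by
  rcases lt_trichotomy x 0 with hx | rfl | hx
  · have h : (fun x : ℝ => (max x 0) ^ (n + 1)) =ᶠ[𝓝 x] fun _ => 0 := by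
      filter_upwards [gt_mem_nhds hx] with y hy
      rw [max_eq_right hy.le]; simp
    rw [max_eq_right hx.le, zero_pow (by omega), mul_zero]
    exact (hasDerivAt_const x (0 : ℝ)).congr_of_eventuallyEq h
  · have h : (fun x : ℝ => (max x 0) ^ (n + 1)) =O[𝓝 0] fun x => ‖x - 0‖ ^ (n + 1) := by
      refine Asymptotics.IsBigO.of_bound 1 (Eventually.of_forall fun y => ?_)
      rw [one_mul, norm_pow, norm_pow, sub_zero, norm_norm]
      refine pow_le_pow_left₀ (norm_nonneg _) ?_ _
      rw [Real.norm_eq_abs, Real.norm_eq_abs, abs_of_nonneg (le_max_right _ _)]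
      exact max_le (le_abs_self y) (abs_nonneg y)
    have h2 := (h.hasFDerivAt (by omega)).hasDerivAt
    rw [max_self, zero_pow (by omega), mul_zero]
    simpa using h2
  · have h : (fun x : ℝ => (max x 0) ^ (n + 1)) =ᶠ[𝓝 x] fun x => x ^ (n + 1) := by
      filter_upwards [lt_mem_nhds hx] with y hy
      rw [max_eq_left hy.le]
    rw [max_eq_left hx.le]
    simpa using (hasDerivAt_pow (n + 1) x).congr_of_eventuallyEq h

lemma contDiff_posPart_cube : ContDiff ℝ 2 fun x : ℝ => (max x 0) ^ 3 := by
  have h2 : deriv (fun x : ℝ => (max x 0) ^ 3) = fun x => 3 * (max x 0) ^ 2 := by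
    funext x
    rw [(hasDerivAt_posPart_pow 2 (by norm_num) x).deriv]; norm_num
  have h1 : deriv (fun x : ℝ => (max x 0) ^ 2) = fun x => 2 * (max x 0) := by
    funext x
    rw [(hasDerivAt_posPart_pow 1 le_rfl x).deriv]; norm_num
  have c1 : ContDiff ℝ 1 fun x : ℝ => (max x 0) ^ 2 := by
    rw [contDiff_one_iff_deriv, h1]
    exact ⟨fun x => (hasDerivAt_posPart_pow 1 le_rfl x).differentiableAt, by fun_prop⟩
  rw [show (2 : WithTop ℕ∞) = 1 + 1 by norm_num, contDiff_succ_iff_deriv, h2]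
  exact ⟨fun x => (hasDerivAt_posPart_pow 2 (by norm_num) x).differentiableAt, by simp,
    contDiff_const.mul c1⟩

/-- A `C²` step function: `0` for `y ≤ 0`, `1` for `y ≥ 1`, and `1 - (1 - y³)³` in between. -/
def cubicStep (y : ℝ) : ℝ := 1 - (max (1 - (max y 0) ^ 3) 0) ^ 3

lemma contDiff_cubicStep : ContDiff ℝ 2 cubicStep :=
  contDiff_const.sub (contDiff_posPart_cube.comp (contDiff_const.sub contDiff_posPart_cube))

lemma hasDerivAt_cubicStep (y : ℝ) :
    HasDerivAt cubicStep (9 * (max (1 - (max y 0) ^ 3) 0) ^ 2 * (max y 0) ^ 2) y := by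
  have h1 := hasDerivAt_posPart_pow 2 (by norm_num) y
  have h2 := (hasDerivAt_posPart_pow 2 (by norm_num) (1 - (max y 0) ^ 3)).comp y
    (h1.const_sub 1)
  have h3 := h2.const_sub 1
  unfold cubicStep
  refine h3.congr_deriv ?_
  push_cast; ring

lemma cubicStep_of_nonpos {y : ℝ} (hy : y ≤ 0) : cubicStep y = 0 := by
  simp [cubicStep, max_eq_right hy]

lemma cubicStep_of_one_le {y : ℝ} (hy : 1 ≤ y) : cubicStep y = 1 := by
  have : (1 : ℝ) ≤ y ^ 3 := one_le_pow₀ hy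
  rw [cubicStep, max_eq_left (by linarith : (0 : ℝ) ≤ y), max_eq_right (by linarith)]; simp

lemma cubicStep_mem_Icc (y : ℝ) : cubicStep y ∈ Icc (0 : ℝ) 1 := by
  have h1 : 0 ≤ max (1 - (max y 0) ^ 3) 0 := le_max_right _ _
  have h2 : max (1 - (max y 0) ^ 3) 0 ≤ 1 :=
    max_le (by linarith [pow_nonneg (le_max_right y 0) 3]) zero_le_one
  have h3 : (max (1 - (max y 0) ^ 3) 0) ^ 3 ≤ 1 := pow_le_one₀ h1 h2
  exact ⟨by unfold cubicStep; linarith, by unfold cubicStep; linarith [pow_nonneg h1 3]⟩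

/-- The step function satisfies `B (S')² ≤ ε + E S²` as soon as `E` is large: near the zero of `S`,
`S ≥ y³` and `S' = O(y²)`. The derivative is written without its factor `9`. -/
lemma cubicStep_deriv_sq_le {y B E ε : ℝ} (hy0 : 0 ≤ y) (hy1 : y ≤ 1) (hB : 0 ≤ B) (hε : 0 < ε)
    (hE : 0 ≤ E) (hBE : B ^ 3 ≤ ε * E ^ 2) :
    B * (max (1 - (max y 0) ^ 3) 0 ^ 2 * (max y 0) ^ 2) ^ 2 ≤ ε + E * cubicStep y ^ 2 := by
  have h3 : y ^ 3 ≤ 1 := pow_le_one₀ hy0 hy1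
  have h30 : 0 ≤ y ^ 3 := by positivity
  rw [cubicStep, max_eq_left hy0, max_eq_left (by linarith : (0 : ℝ) ≤ 1 - y ^ 3)]
  have hS : y ^ 3 ≤ 1 - (1 - y ^ 3) ^ 3 := by
    nlinarith [mul_nonneg h30 (sub_nonneg.2 h3), mul_nonneg (mul_nonneg h30 (sub_nonneg.2 h3))
      (sub_nonneg.2 h3), mul_nonneg (mul_nonneg h30 (sub_nonneg.2 h3)) h30]
  have hS2 : (y ^ 3) ^ 2 ≤ (1 - (1 - y ^ 3) ^ 3) ^ 2 := pow_le_pow_left₀ h30 hS 2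
  have hle : ((1 - y ^ 3) ^ 2 * y ^ 2) ^ 2 ≤ (y ^ 2) ^ 2 := by
    refine pow_le_pow_left₀ (by positivity) ?_ 2
    exact mul_le_of_le_one_left (by positivity) (pow_le_one₀ (by linarith) (by linarith))
  set t := y ^ 2 with ht
  have ht0 : 0 ≤ t := by positivity
  have h6 : (y ^ 3) ^ 2 = t ^ 3 := by rw [ht]; ring
  have main : B * t ^ 2 ≤ ε + E * t ^ 3 := by
    by_cases hc : B ≤ E * t
    · nlinarith [mul_le_mul_of_nonneg_right hc (sq_nonneg t)]
    · push Not at hc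
      have hE0 : 0 ≤ E * t := by positivity
      have h1 : (E * t) ^ 2 ≤ B ^ 2 := pow_le_pow_left₀ hE0 hc.le 2
      have h2 : 0 ≤ E * t ^ 3 := by positivity
      by_cases hE' : E = 0
      · subst hE'
        have : B = 0 := by
          have hB3 : B ^ 3 ≤ 0 := by simpa using hBE
          by_contra hB0
          have : 0 < B := lt_of_le_of_ne hB (Ne.symm hB0)
          have := pow_pos this 3
          linarith
        rw [this]; simp; exact hε.le
      · have hEpos : 0 < E ^ 2 := by positivity
        have h4 : E ^ 2 * (B * t ^ 2) ≤ E ^ 2 * ε := by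
          calc E ^ 2 * (B * t ^ 2) = B * (E * t) ^ 2 := by ring
            _ ≤ B * B ^ 2 := mul_le_mul_of_nonneg_left h1 hB
            _ = B ^ 3 := by ring
            _ ≤ E ^ 2 * ε := by linarith
        have := le_of_mul_le_mul_left h4 hEpos
        linarith
  calc B * ((1 - y ^ 3) ^ 2 * t) ^ 2 ≤ B * t ^ 2 := mul_le_mul_of_nonneg_left hle hB
    _ ≤ ε + E * t ^ 3 := main
    _ ≤ _ := by rw [← h6]; linarith [mul_le_mul_of_nonneg_left hS2 hE]

variable {d : ℕ} {ψ χ : (Fin d → ℂ) → ℝ} {z : Fin d → ℂ}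

lemma leviMatrix_congr (h : ψ =ᶠ[𝓝 z] χ) : leviMatrix ψ z = leviMatrix χ z := by
  have h' : (fun w => (ψ w : ℂ)) =ᶠ[𝓝 z] fun w => (χ w : ℂ) := h.mono fun w hw => by simp [hw]
  funext j l
  rw [leviMatrix_eq, leviMatrix_eq]
  exact wirtingerD_congr j (h'.eventuallyEq_nhds.mono fun w hw => wirtingerDbar_congr l hw)

lemma leviForm_congr (h : ψ =ᶠ[𝓝 z] χ) (w : Fin d → ℂ) : leviForm ψ z w = leviForm χ z w := by
  simp only [leviForm, leviMatrix_congr h]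

lemma ContDiffAt.ofReal_comp {n : WithTop ℕ∞} (hψ : ContDiffAt ℝ n ψ z) :
    ContDiffAt ℝ n (fun z => (ψ z : ℂ)) z :=
  Complex.ofRealCLM.contDiff.contDiffAt.comp z hψ

lemma ContDiffOn.ofReal_comp {n : WithTop ℕ∞} {s : Set (Fin d → ℂ)} (hψ : ContDiffOn ℝ n ψ s) :
    ContDiffOn ℝ n (fun z => (ψ z : ℂ)) s :=
  Complex.ofRealCLM.contDiff.comp_contDiffOn hψ

lemma differentiableAt_wirtingerDbar {f : (Fin d → ℂ) → ℂ} (hf : ContDiffAt ℝ 2 f z) (j : Fin d) :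
    DifferentiableAt ℝ (wirtingerDbar j f) z := by
  have h := fun v => differentiableAt_fderiv_apply hf v
  have e : wirtingerDbar j f = fun y => (2 : ℂ)⁻¹ * (fderiv ℝ f y (Pi.single j 1)
      + Complex.I * fderiv ℝ f y (Pi.single j Complex.I)) := by
    funext y; simp only [wirtingerDbar]; ring
  rw [e]
  exact ((h _).add ((h _).const_mul _)).const_mul _

lemma eventually_differentiableAt {E F : Type*} [NormedAddCommGroup E] [NormedSpace ℝ E]
    [NormedAddCommGroup F] [NormedSpace ℝ F] {f : E → F} {x : E} (hf : ContDiffAt ℝ 2 f x) :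
    ∀ᶠ y in 𝓝 x, DifferentiableAt ℝ f y := by
  filter_upwards [hf.eventually (by simp)] with y hy
  exact hy.differentiableAt (by simp)

lemma leviMatrix_add (hψ : ContDiffAt ℝ 2 ψ z) (hχ : ContDiffAt ℝ 2 χ z) :
    leviMatrix (fun w => ψ w + χ w) z = leviMatrix ψ z + leviMatrix χ z := by
  funext j l
  have e : wirtingerDbar l (fun w => ((ψ w + χ w : ℝ) : ℂ)) =ᶠ[𝓝 z] fun w =>
      wirtingerDbar l (fun w => (ψ w : ℂ)) w + wirtingerDbar l (fun w => (χ w : ℂ)) w := by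
    filter_upwards [eventually_differentiableAt hψ.ofReal_comp,
      eventually_differentiableAt hχ.ofReal_comp] with w h1 h2
    rw [← wirtingerDbar_add l h1 h2]
    push_cast; rfl
  rw [leviMatrix_eq, wirtingerD_congr j e, wirtingerD_add j
    (differentiableAt_wirtingerDbar hψ.ofReal_comp l)
    (differentiableAt_wirtingerDbar hχ.ofReal_comp l)]
  rfl

lemma leviForm_add (hψ : ContDiffAt ℝ 2 ψ z) (hχ : ContDiffAt ℝ 2 χ z) (w : Fin d → ℂ) :
    leviForm (fun w => ψ w + χ w) z w = leviForm ψ z w + leviForm χ z w := by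
  simp only [leviForm, leviMatrix_add hψ hχ, Matrix.add_apply, add_mul, Finset.sum_add_distrib,
    Complex.add_re]

/-- The Levi form of a composition with a function of one real variable. -/
lemma leviForm_comp {p p' : ℝ → ℝ} {p'' : ℝ} (hp : ∀ x, HasDerivAt p (p' x) x)
    (hp' : HasDerivAt p' p'' (ψ z)) (hψ : ContDiffAt ℝ 2 ψ z) (w : Fin d → ℂ) :
    leviForm (fun z => p (ψ z)) z w = p' (ψ z) * leviForm ψ z w
      + p'' * ‖∑ j, wirtingerD j (fun z => (ψ z : ℂ)) z * w j‖ ^ 2 := by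
  have dψ : DifferentiableAt ℝ ψ z := hψ.differentiableAt (by simp)
  have hm : ∀ j l, leviMatrix (fun z => p (ψ z)) z j l = p' (ψ z) * leviMatrix ψ z j l
      + p'' * (wirtingerD j (fun z => (ψ z : ℂ)) z * wirtingerDbar l (fun z => (ψ z : ℂ)) z) :=
      fun j l => by
    have e : wirtingerDbar l (fun w => ((p (ψ w) : ℝ) : ℂ)) =ᶠ[𝓝 z] fun w =>
        ((p' (ψ w) : ℝ) : ℂ) * wirtingerDbar l (fun w => (ψ w : ℂ)) w := by
      filter_upwards [eventually_differentiableAt hψ] with w h1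
      exact wirtingerDbar_comp_real l (hp _) h1
    have d1 : DifferentiableAt ℝ (fun w => ((p' (ψ w) : ℝ) : ℂ)) z :=
      Complex.ofRealCLM.differentiableAt.comp z (hp'.differentiableAt.comp z dψ)
    rw [leviMatrix_eq, wirtingerD_congr j e, wirtingerD_mul j d1
      (differentiableAt_wirtingerDbar hψ.ofReal_comp l), wirtingerD_comp_real j hp' dψ,
      leviMatrix_eq]
    ring
  have e2 : (((‖∑ j, wirtingerD j (fun z => (ψ z : ℂ)) z * w j‖ ^ 2 : ℝ)) : ℂ)
      = ∑ j, ∑ l, wirtingerD j (fun z => (ψ z : ℂ)) z * wirtingerDbar l (fun z => (ψ z : ℂ)) z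
        * w j * conj (w l) := by
    rw [Complex.ofReal_pow, ← Complex.mul_conj', map_sum, Finset.sum_mul_sum]
    refine Finset.sum_congr rfl fun j _ => Finset.sum_congr rfl fun l _ => ?_
    rw [map_mul, conj_wirtingerD_ofReal]; ring
  have e3 : ∑ j, ∑ l, leviMatrix (fun z => p (ψ z)) z j l * w j * conj (w l)
      = (p' (ψ z) : ℂ) * (∑ j, ∑ l, leviMatrix ψ z j l * w j * conj (w l))
        + (p'' : ℂ) * ((‖∑ j, wirtingerD j (fun z => (ψ z : ℂ)) z * w j‖ ^ 2 : ℝ) : ℂ) := by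
    rw [e2]
    simp_rw [Finset.mul_sum, ← Finset.sum_add_distrib]
    refine Finset.sum_congr rfl fun j _ => Finset.sum_congr rfl fun l _ => ?_
    rw [hm]; ring
  rw [leviForm, e3, Complex.add_re, Complex.re_ofReal_mul, Complex.re_ofReal_mul,
    Complex.ofReal_re, leviForm]

lemma leviForm_const_mul (c : ℝ) (hψ : ContDiffAt ℝ 2 ψ z) (w : Fin d → ℂ) :
    leviForm (fun z => c * ψ z) z w = c * leviForm ψ z w := by
  rw [leviForm_comp (p := fun x => c * x) (p' := fun _ => c) (p'' := 0)
    (fun x => by simpa using (hasDerivAt_id x).const_mul c) (hasDerivAt_const _ _) hψ]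
  simp

lemma contDiff_sum_norm_sq : ContDiff ℝ ∞ fun z : Fin d → ℂ => ∑ j, ‖z j‖ ^ 2 :=
  ContDiff.sum fun j _ => (contDiff_norm_sq ℝ).comp (contDiff_apply ℝ ℂ j)

lemma hasFDerivAt_sum_norm_sq (z : Fin d → ℂ) :
    HasFDerivAt (fun z : Fin d → ℂ => ((∑ j, ‖z j‖ ^ 2 : ℝ) : ℂ))
      (∑ j, (z j • (Complex.conjCLE : ℂ →L[ℝ] ℂ).comp (ContinuousLinearMap.proj j)
        + conj (z j) • (ContinuousLinearMap.proj j : (Fin d → ℂ) →L[ℝ] ℂ))) z := by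
  have e : (fun z : Fin d → ℂ => ((∑ j, ‖z j‖ ^ 2 : ℝ) : ℂ)) = fun z => ∑ j, z j * conj (z j) := by
    funext z
    push_cast
    exact Finset.sum_congr rfl fun j _ => (Complex.mul_conj' _).symm
  rw [e]
  refine HasFDerivAt.fun_sum fun j _ => ?_
  have h1 : HasFDerivAt (fun z : Fin d → ℂ => z j) (ContinuousLinearMap.proj j) z :=
    (ContinuousLinearMap.proj (R := ℝ) (φ := fun _ : Fin d => ℂ) j).hasFDerivAt
  exact h1.mul (Complex.conjCLE.hasFDerivAt.comp z h1)

lemma wirtingerDbar_sum_norm_sq (l : Fin d) (z : Fin d → ℂ) :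
    wirtingerDbar l (fun z : Fin d → ℂ => ((∑ j, ‖z j‖ ^ 2 : ℝ) : ℂ)) z = z l := by
  rw [wirtingerDbar, (hasFDerivAt_sum_norm_sq z).fderiv]
  simp only [_root_.sum_apply, _root_.add_apply, _root_.smul_apply, smul_eq_mul,
    ContinuousLinearMap.coe_comp, Function.comp_apply, ContinuousLinearMap.proj_apply,
    Finset.sum_add_distrib]
  have h1 : ∀ c : ℂ, ∑ j, z j * (Complex.conjCLE : ℂ →L[ℝ] ℂ) ((Pi.single l c : Fin d → ℂ) j)
      = z l * conj c := fun c => by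
    rw [Finset.sum_eq_single l]
    · simp
    · intro j _ hj; simp [Pi.single_eq_of_ne hj]
    · simp
  have h2 : ∀ c : ℂ, ∑ j, conj (z j) * ((Pi.single l c : Fin d → ℂ) j) = conj (z l) * c :=
      fun c => by
    rw [Finset.sum_eq_single l]
    · simp
    · intro j _ hj; simp [Pi.single_eq_of_ne hj]
    · simp
  rw [h1, h1, h2, h2]
  simp only [map_one, Complex.conj_I]
  linear_combination (-(z l) / 2 + conj (z l) / 2) * Complex.I_mul_I

lemma leviForm_sum_norm_sq (z w : Fin d → ℂ) :
    leviForm (fun z => ∑ j, ‖z j‖ ^ 2) z w = ∑ j, ‖w j‖ ^ 2 := by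
  have hm : ∀ j l, leviMatrix (fun z : Fin d → ℂ => ∑ j, ‖z j‖ ^ 2) z j l
      = if j = l then 1 else 0 := by
    intro j l
    have e : wirtingerDbar l (fun z : Fin d → ℂ => ((∑ j, ‖z j‖ ^ 2 : ℝ) : ℂ)) = fun z => z l := by
      funext z; exact wirtingerDbar_sum_norm_sq l z
    have h1 : fderiv ℝ (fun z : Fin d → ℂ => z l) z
        = ContinuousLinearMap.proj (R := ℝ) (φ := fun _ : Fin d => ℂ) l :=
      (ContinuousLinearMap.proj (R := ℝ) (φ := fun _ : Fin d => ℂ) l).fderiv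
    rw [leviMatrix_eq, e, wirtingerD, h1]
    simp only [ContinuousLinearMap.proj_apply]
    by_cases h : j = l
    · subst h; simp
    · simp [h]
  simp only [leviForm, hm, ite_mul, one_mul, zero_mul, Finset.sum_ite_eq, Finset.mem_univ, if_true]
  rw [Complex.re_sum]
  refine Finset.sum_congr rfl fun j _ => ?_
  rw [Complex.mul_conj', ← Complex.ofReal_pow, Complex.ofReal_re]

end Cutoff

/-! ### The `L²` estimate on a domain with a strictly pseudoconvex exhaustion -/

section Exhaustion

open Filter Topology

variable {d : ℕ} {Γ W : Set (Fin d → ℂ)} {r ψ : (Fin d → ℂ) → ℝ}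

lemma twistedDbar_congr_of_tsupport {φ : (Fin d → ℂ) → ℝ} {u : (Fin d → ℂ) → ℂ}
    (h : ∀ z ∈ tsupport u, φ =ᶠ[𝓝 z] ψ) (j : Fin d) : twistedDbar φ j u = twistedDbar ψ j u := by
  funext z
  by_cases hz : z ∈ tsupport u
  · have h' : (fun w => (φ w : ℂ)) =ᶠ[𝓝 z] fun w => (ψ w : ℂ) :=
      (h z hz).mono fun w hw => by simp [hw]
    rw [twistedDbar, twistedDbar, wirtingerDbar_congr j h']
  · simp [twistedDbar, wirtingerDbar_eq_zero j hz, image_eq_zero_of_notMem_tsupport hz]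

lemma twistedD_congr_of_tsupport {φ : (Fin d → ℂ) → ℝ} {u : (Fin d → ℂ) → ℂ}
    (h : ∀ z ∈ tsupport u, φ =ᶠ[𝓝 z] ψ) (j : Fin d) : twistedD φ j u = twistedD ψ j u := by
  funext z
  by_cases hz : z ∈ tsupport u
  · have h' : (fun w => (φ w : ℂ)) =ᶠ[𝓝 z] fun w => (ψ w : ℂ) :=
      (h z hz).mono fun w hw => by simp [hw]
    rw [twistedD, twistedD, wirtingerD_congr j h']
  · simp [twistedD, wirtingerD_eq_zero j hz, image_eq_zero_of_notMem_tsupport hz]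

/-- The weight `A (δ - r)_+³`, steep near the boundary `r = 0`, has Levi form at least
`3 A c (δ - r)_+²` where `-r` has Levi form at least `c`. -/
lemma le_leviForm_barrier (hr : ContDiff ℝ 2 r) {A δ c : ℝ} (hA : 0 ≤ A) {z : Fin d → ℂ}
    (w : Fin d → ℂ) (h : r z < δ → leviForm r z w ≤ -c * ∑ j, ‖w j‖ ^ 2) :
    3 * A * c * (max (δ - r z) 0) ^ 2 * ∑ j, ‖w j‖ ^ 2
      ≤ leviForm (fun z => A * (max (δ - r z) 0) ^ 3) z w := by
  have hp : ∀ x, HasDerivAt (fun x : ℝ => A * (max (δ - x) 0) ^ 3)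
      (-(3 * A) * (max (δ - x) 0) ^ 2) x := fun x => by
    have h1 := (hasDerivAt_posPart_pow 2 (by norm_num) (δ - x)).comp x
      ((hasDerivAt_id x).const_sub δ)
    refine (h1.const_mul A).congr_deriv ?_
    push_cast; ring
  have hp' : HasDerivAt (fun x : ℝ => -(3 * A) * (max (δ - x) 0) ^ 2)
      (6 * A * max (δ - r z) 0) (r z) := by
    have h1 := (hasDerivAt_posPart_pow 1 le_rfl (δ - r z)).comp (r z)
      ((hasDerivAt_id (r z)).const_sub δ)
    refine (h1.const_mul (-(3 * A))).congr_deriv ?_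
    push_cast; ring
  rw [leviForm_comp (p := fun x => A * (max (δ - x) 0) ^ 3) hp hp' hr.contDiffAt]
  have h0 : 0 ≤ max (δ - r z) 0 := le_max_right _ _
  have h1 : 0 ≤ 6 * A * max (δ - r z) 0
      * ‖∑ j, wirtingerD j (fun z => (r z : ℂ)) z * w j‖ ^ 2 := by positivity
  have h2 : 3 * A * c * (max (δ - r z) 0) ^ 2 * ∑ j, ‖w j‖ ^ 2
      ≤ -(3 * A) * (max (δ - r z) 0) ^ 2 * leviForm r z w := by
    rcases lt_or_ge (r z) δ with hz | hz
    · have := mul_le_mul_of_nonneg_left (h hz)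
        (by positivity : 0 ≤ 3 * A * (max (δ - r z) 0) ^ 2)
      linarith
    · rw [max_eq_right (by linarith)]; simp
  linarith

/-- If `-r` is strictly plurisubharmonic near the boundary of the bounded set `Γ = {r > 0}` and the
Levi form of `ψ` is at least `1` on `Γ`, then `|(∂̄_ψ u, g)|² ≤ 2 ‖∂̄_ψ u‖² ‖∂̄_ψ^* g‖²` for
compactly supported `u` and `g`, even though `g` is not `∂̄_ψ`-closed and `Γ` has a boundary. The
weight is modified near the boundary, where its Levi form has to beat the derivatives of a cutoff
function. -/
lemma norm_integral_twistedDbar_sq_le_of_exhaustion (hΓ : IsOpen Γ) (hb : Bornology.IsBounded Γ)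
    (hr : ContDiff ℝ 2 r) (hr0 : ∀ z ∈ Γ, 0 < r z) (hr1 : ∀ z ∈ frontier Γ, r z = 0)
    (hW : IsOpen W) (hΓW : frontier Γ ⊆ W) {c : ℝ} (hc : 0 < c)
    (hWc : ∀ z ∈ W, ∀ w, leviForm r z w ≤ -c * ∑ j, ‖w j‖ ^ 2) (hψ : ContDiffOn ℝ 2 ψ Γ)
    (hψl : ∀ z ∈ Γ, ∀ w, ∑ j, ‖w j‖ ^ 2 ≤ leviForm ψ z w)
    {u : (Fin d → ℂ) → ℂ} {g : Fin d → (Fin d → ℂ) → ℂ} (hu : ContDiff ℝ 2 u)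
    (huc : HasCompactSupport u) (huΓ : tsupport u ⊆ Γ) (hg : ∀ j, ContDiff ℝ 2 (g j))
    (hgc : ∀ j, HasCompactSupport (g j)) (hgΓ : ∀ j, tsupport (g j) ⊆ Γ) :
    ‖∑ j, ∫ z, twistedDbar ψ j u z * conj (g j z)‖ ^ 2
      ≤ 2 * (∑ j, ∫ z, ‖twistedDbar ψ j u z‖ ^ 2) * ∫ z, ‖∑ j, twistedD ψ j (g j) z‖ ^ 2 := by
  have hcΓ : IsCompact (closure Γ) := hb.isCompact_closure
  have hfr : ∀ z ∈ closure Γ, z ∉ Γ → z ∈ frontier Γ := fun z h1 h2 => by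
    rw [frontier, hΓ.interior_eq]; exact ⟨h1, h2⟩
  set K : Set (Fin d → ℂ) := tsupport u ∪ ⋃ j, tsupport (g j) with hK
  have hKc : IsCompact K := huc.isCompact.union (isCompact_iUnion fun j => (hgc j).isCompact)
  have hKΓ : K ⊆ Γ := union_subset huΓ (iUnion_subset hgΓ)
  -- `{r < δ}` is close to the boundary and does not meet the supports of `u` and `g`
  obtain ⟨δ, hδ, hδK⟩ : ∃ δ, 0 < δ ∧ ∀ z ∈ K ∪ (closure Γ \ W), δ < r z := by
    obtain ⟨δ, hδ, h⟩ := (hKc.union (hcΓ.diff hW)).exists_forall_le' (a := 0)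
      hr.continuous.continuousOn (fun z hz => by
        rcases hz with hz | hz
        · exact hr0 z (hKΓ hz)
        · by_contra h0
          exact hz.2 (hΓW (hfr z hz.1 fun h => h0 (hr0 z h))))
    exact ⟨δ / 2, by linarith, fun z hz => by linarith [h z hz]⟩
  have hδW : ∀ z ∈ Γ, r z < δ → z ∈ W := fun z hz hzδ => by
    by_contra h
    exact absurd (hδK z (Or.inr ⟨subset_closure hz, h⟩)) (by linarith)
  obtain ⟨M, hM0, hM⟩ : ∃ M, 0 ≤ M ∧
      ∀ z ∈ closure Γ, ∑ j, ‖wirtingerD j (fun z => (r z : ℂ)) z‖ ^ 2 ≤ M := by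
    have hcont : Continuous fun z => ∑ j, ‖wirtingerD j (fun z => (r z : ℂ)) z‖ ^ 2 :=
      continuous_finsetSum _ fun j _ =>
        ((hr.ofReal_comp.wirtingerD (m := 0) (by norm_num) j).continuous.norm).pow 2
    obtain ⟨M, hM⟩ := hcΓ.bddAbove_image hcont.continuousOn
    exact ⟨max M 0, le_max_right _ _, fun z hz =>
      (hM (mem_image_of_mem _ hz)).trans (le_max_left _ _)⟩
  -- the compact set on which the cutoff function lives
  set L : Set (Fin d → ℂ) := closure Γ ∩ {z | δ / 4 ≤ r z} with hL
  have hLcl : IsClosed L := isClosed_closure.inter (isClosed_le continuous_const hr.continuous)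
  have hLc : IsCompact L := hcΓ.of_isClosed_subset hLcl inter_subset_left
  have hLΓ : L ⊆ Γ := fun z hz => by
    by_contra h
    have := hr1 z (hfr z hz.1 h)
    have h2 : δ / 4 ≤ r z := hz.2
    linarith
  have hKL : K ⊆ L := fun z hz => ⟨subset_closure (hKΓ hz), by
    have := hδK z (Or.inl hz)
    change δ / 4 ≤ r z; linarith⟩
  classical
  set θ : (Fin d → ℂ) → ℝ := fun z => if z ∈ Γ then cubicStep ((r z - δ / 4) / (δ / 4)) else 0
    with hθdef
  have hθL : ∀ z, z ∉ L → θ z = 0 := fun z hz => by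
    by_cases hzΓ : z ∈ Γ
    · have : r z < δ / 4 := by
        by_contra h
        exact hz ⟨subset_closure hzΓ, not_lt.1 h⟩
      simp only [hθdef, if_pos hzΓ]
      exact cubicStep_of_nonpos (div_nonpos_of_nonpos_of_nonneg (by linarith) (by linarith))
    · simp [hθdef, hzΓ]
  have hθnear : ∀ z ∈ Γ, θ =ᶠ[𝓝 z] fun z => cubicStep ((r z - δ / 4) / (δ / 4)) := fun z hz => by
    filter_upwards [hΓ.mem_nhds hz] with y hy
    simp [hθdef, hy]
  have hθ0near : ∀ z, z ∉ L → ∀ᶠ y in 𝓝 z, θ y = 0 := fun z hz => by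
    filter_upwards [hLcl.isOpen_compl.mem_nhds hz] with y hy using hθL y hy
  have hθ : ContDiff ℝ 2 θ := by
    refine ContDiffOn.contDiff_of_eventually_zero (s := Γ) (fun z hz => ?_) hΓ
      fun z hz => hθ0near z fun h => hz (hLΓ h)
    have h1 : ContDiff ℝ 2 fun z => cubicStep ((r z - δ / 4) / (δ / 4)) :=
      contDiff_cubicStep.comp ((hr.sub contDiff_const).div_const _)
    exact (h1.contDiffAt.congr_of_eventuallyEq (hθnear z hz)).contDiffWithinAt
  have hθc : HasCompactSupport θ := HasCompactSupport.intro hLc hθL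
  have hθ01 : ∀ z, θ z ∈ Icc (0 : ℝ) 1 := fun z => by
    by_cases hz : z ∈ Γ
    · simp only [hθdef, if_pos hz]; exact cubicStep_mem_Icc _
    · simp [hθdef, hz]
  have hθu : ∀ z ∈ tsupport u, θ z = 1 := fun z hz => by
    have hzK : z ∈ K := Or.inl hz
    have h1 := hδK z (Or.inl hzK)
    simp only [hθdef, if_pos (hKΓ hzK)]
    refine cubicStep_of_one_le ?_
    rw [le_div_iff₀ (by linarith)]; linarith
  obtain ⟨β, hβ, -, hβ1, hβΓ⟩ := exists_smooth_cutoff hLcl hΓ hLΓ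
  set G := ∑ j, ∫ z, ‖g j z‖ ^ 2 with hG
  set P := ∑ j, ∫ z, ‖twistedDbar ψ j u z‖ ^ 2 with hP
  set R := ∫ z, ‖∑ j, twistedD ψ j (g j) z‖ ^ 2 with hR
  have main : ∀ ε : ℝ, 0 < ε →
      ‖∑ j, ∫ z, twistedDbar ψ j u z * conj (g j z)‖ ^ 2 ≤ P * (2 * R + ε * G) := by
    intro ε hε
    -- `B` bounds `3 |∂θ|²`, where `81 = 9²` comes from the derivative of `cubicStep` and `16 / δ²`
    -- from the rescaling; `A` is so large that the barrier gains `E S²` where `δ / 4 ≤ r ≤ δ / 2`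
    set B : ℝ := 3 * 81 * (16 / δ ^ 2) * M with hB
    have hB0 : 0 ≤ B := by positivity
    set E : ℝ := B ^ 3 / ε + 1 with hE
    have hE1 : 1 ≤ E := by
      have : 0 ≤ B ^ 3 / ε := by positivity
      linarith
    have hBE : B ^ 3 ≤ ε * E ^ 2 := by
      have h1 : E ≤ E ^ 2 := by nlinarith
      have h2 : B ^ 3 ≤ ε * E := by
        rw [hE, mul_add, mul_div_cancel₀ _ hε.ne']; linarith
      exact h2.trans (mul_le_mul_of_nonneg_left h1 hε.le)
    set A : ℝ := E / (3 / 2 * c * δ ^ 2) with hA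
    have hA0 : 0 ≤ A := by positivity
    have hAE : 3 / 2 * A * c * δ ^ 2 = E := by
      rw [hA]; field_simp
    set χ : (Fin d → ℂ) → ℝ := fun z => A * (max (δ - r z) 0) ^ 3 with hχ
    have hχc : ContDiff ℝ 2 χ :=
      contDiff_const.mul (contDiff_posPart_cube.comp (contDiff_const.sub hr))
    -- the modified weight is defined everywhere and agrees with `ψ` on the supports of `u` and `g`
    set φ : (Fin d → ℂ) → ℝ := fun z => β z * (ψ z + χ z) with hφdef
    have hφ : ContDiff ℝ 2 φ := by
      refine ContDiffOn.contDiff_of_eventually_zero (s := Γ) ?_ hΓ fun z hz => ?_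
      · exact (hβ.of_le (WithTop.coe_le_coe.2 (le_top : (2 : ℕ∞) ≤ ⊤))).contDiffOn.mul
          (hψ.add hχc.contDiffOn)
      · have : z ∉ tsupport β := fun h => hz (hβΓ h)
        filter_upwards [(notMem_tsupport_iff_eventuallyEq.1 this)] with y hy
        simp [hφdef, hy]
    have hφL : ∀ z ∈ L, φ =ᶠ[𝓝 z] fun z => ψ z + χ z := fun z hz => by
      filter_upwards [hβ1 z hz] with y hy
      simp [hφdef, hy]
    have hφK : ∀ z ∈ K, φ =ᶠ[𝓝 z] ψ := fun z hz => by
      filter_upwards [hφL z (hKL hz),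
        (isOpen_lt continuous_const hr.continuous).mem_nhds (hδK z (Or.inl hz))] with y hy hy2
      have hy3 : δ < r y := hy2
      rw [hy]
      simp [hχ, max_eq_right (by linarith : δ - r y ≤ 0)]
    have hlevi : ∀ z w, (θ z ^ 2 + 3 * (∑ j, ‖wirtingerD j (fun z => (θ z : ℂ)) z‖ ^ 2) - ε)
        * ∑ j, ‖w j‖ ^ 2 ≤ 2 * (θ z ^ 2 * leviForm φ z w) := by
      intro z w
      have hw0 : 0 ≤ ∑ j, ‖w j‖ ^ 2 := Finset.sum_nonneg fun j _ => by positivity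
      by_cases hz : z ∈ L
      · have hzΓ := hLΓ hz
        have hψz : ContDiffAt ℝ 2 ψ z := hψ.contDiffAt (hΓ.mem_nhds hzΓ)
        rw [leviForm_congr (hφL z hz), leviForm_add hψz hχc.contDiffAt]
        have h1 := hψl z hzΓ w
        have h2 : 3 * A * c * (max (δ - r z) 0) ^ 2 * ∑ j, ‖w j‖ ^ 2 ≤ leviForm χ z w :=
          le_leviForm_barrier hr hA0 w fun h => hWc z (hδW z hzΓ h) w
        have h3 : 3 * (∑ j, ‖wirtingerD j (fun z => (θ z : ℂ)) z‖ ^ 2)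
            ≤ ε + 6 * A * c * (max (δ - r z) 0) ^ 2 * θ z ^ 2 := by
          set y := (r z - δ / 4) / (δ / 4) with hy
          have hθz : θ z = cubicStep y := by simp [hθdef, hzΓ, hy]
          have hd : ∀ j, wirtingerD j (fun z => (θ z : ℂ)) z
              = ((9 * (max (1 - (max y 0) ^ 3) 0) ^ 2 * (max y 0) ^ 2 * (4 / δ) : ℝ) : ℂ)
                * wirtingerD j (fun z => (r z : ℂ)) z := fun j => by
            have e1 : (fun z => (θ z : ℂ)) =ᶠ[𝓝 z]
                fun z => ((cubicStep ((r z - δ / 4) / (δ / 4)) : ℝ) : ℂ) :=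
              (hθnear z hzΓ).mono fun w hw => by simp [hw]
            have e2 : HasDerivAt (fun x => cubicStep ((x - δ / 4) / (δ / 4)))
                (9 * (max (1 - (max y 0) ^ 3) 0) ^ 2 * (max y 0) ^ 2 * (4 / δ)) (r z) := by
              have := (hasDerivAt_cubicStep y).comp (r z)
                (((hasDerivAt_id (r z)).sub_const (δ / 4)).div_const (δ / 4))
              refine this.congr_deriv ?_
              rw [one_div_div]
            rw [wirtingerD_congr j e1]
            exact wirtingerD_comp_real (s := r) j e2 (hr.differentiable (by simp) z)
          set q := max (1 - (max y 0) ^ 3) 0 ^ 2 * (max y 0) ^ 2 with hq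
          have hsum : 3 * (∑ j, ‖wirtingerD j (fun z => (θ z : ℂ)) z‖ ^ 2) ≤ B * q ^ 2 := by
            have e : ∑ j, ‖wirtingerD j (fun z => (θ z : ℂ)) z‖ ^ 2
                = 81 * q ^ 2 * (16 / δ ^ 2) * ∑ j, ‖wirtingerD j (fun z => (r z : ℂ)) z‖ ^ 2 := by
              rw [Finset.mul_sum]
              refine Finset.sum_congr rfl fun j _ => ?_
              rw [hd, norm_mul, mul_pow, Complex.norm_real, Real.norm_eq_abs, sq_abs, hq]
              field_simp; ring
            rw [e]
            have := mul_le_mul_of_nonneg_left (hM z hz.1)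
              (by positivity : 0 ≤ 3 * (81 * q ^ 2 * (16 / δ ^ 2)))
            calc _ = 3 * (81 * q ^ 2 * (16 / δ ^ 2))
                  * ∑ j, ‖wirtingerD j (fun z => (r z : ℂ)) z‖ ^ 2 := by ring
              _ ≤ _ := this
              _ = B * q ^ 2 := by rw [hB]; ring
          refine hsum.trans ?_
          have hzr : δ / 4 ≤ r z := hz.2
          have hy0 : 0 ≤ y := div_nonneg (by linarith) (by linarith)
          rcases le_or_gt 1 y with hy1 | hy1
          · -- the derivative of the cutoff function vanishes
            have hq0 : q = 0 := by
              have : (1 : ℝ) ≤ y ^ 3 := one_le_pow₀ hy1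
              rw [hq, max_eq_left hy0, max_eq_right (by linarith)]; simp
            rw [hq0]
            have : 0 ≤ 6 * A * c * (max (δ - r z) 0) ^ 2 * θ z ^ 2 := by positivity
            simp only [ne_eq, OfNat.ofNat_ne_zero, not_false_eq_true, zero_pow, mul_zero]
            linarith
          · have hrz : r z ≤ δ / 2 := by
              rw [hy, div_lt_one (by linarith)] at hy1; linarith
            have h4 : B * q ^ 2 ≤ ε + E * cubicStep y ^ 2 :=
              cubicStep_deriv_sq_le hy0 hy1.le hB0 hε (by linarith) hBE
            have h5 : δ / 2 ≤ max (δ - r z) 0 := (by linarith : δ / 2 ≤ δ - r z).trans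
              (le_max_left _ _)
            have h6 : (δ / 2) ^ 2 ≤ (max (δ - r z) 0) ^ 2 := pow_le_pow_left₀ (by linarith) h5 2
            have h7 : E ≤ 6 * A * c * (max (δ - r z) 0) ^ 2 := by
              rw [← hAE]
              have := mul_le_mul_of_nonneg_left h6 (by positivity : 0 ≤ 6 * A * c)
              calc _ = 6 * A * c * (δ / 2) ^ 2 := by ring
                _ ≤ _ := this
            rw [hθz]
            have := mul_le_mul_of_nonneg_right h7 (sq_nonneg (cubicStep y))
            linarith
        have hθ2 : 0 ≤ θ z ^ 2 := sq_nonneg _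
        have h8 := mul_le_mul_of_nonneg_left (add_le_add h1 h2) hθ2
        have h9 := mul_le_mul_of_nonneg_right h3 hw0
        have h10 : 0 ≤ θ z ^ 2 * ∑ j, ‖w j‖ ^ 2 := mul_nonneg hθ2 hw0
        nlinarith
      · have e : (fun z => (θ z : ℂ)) =ᶠ[𝓝 z] fun _ => (0 : ℂ) :=
          (hθ0near z hz).mono fun y hy => by simp [hy]
        have e2 : ∀ j, wirtingerD j (fun z => (θ z : ℂ)) z = 0 := fun j => by
          rw [wirtingerD_congr j e]; simp [wirtingerD]
        simp only [hθL z hz, e2]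
        simp only [ne_eq, OfNat.ofNat_ne_zero, not_false_eq_true, zero_pow, norm_zero,
          Finset.sum_const_zero, mul_zero, add_zero, zero_sub, zero_mul]
        nlinarith
    have h := norm_integral_twistedDbar_sq_le hφ hθ hθc hθ01 hlevi hε.le hu huc hg hgc hθu
    rw [hP, hR]
    simpa only [twistedDbar_congr_of_tsupport fun z hz => hφK z (Or.inl hz),
      fun j => twistedD_congr_of_tsupport (u := g j)
        (fun z hz => hφK z (Or.inr (mem_iUnion.2 ⟨j, hz⟩))) j] using h
  have hlim : Tendsto (fun ε : ℝ => P * (2 * R + ε * G)) (𝓝[>] 0) (𝓝 (P * (2 * R + 0 * G))) := by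
    refine Tendsto.mono_left ?_ nhdsWithin_le_nhds
    exact (by fun_prop : Continuous fun ε : ℝ => P * (2 * R + ε * G)).tendsto 0
  have := ge_of_tendsto hlim (by filter_upwards [self_mem_nhdsWithin] with ε hε using main ε hε)
  linarith

/-- On the compact boundary `F` of a strictly pseudoconvex domain, `ρ` can be replaced by
`ρ + B ρ²`, which has positive definite Levi form near `F`. -/
lemma exists_leviForm_ge_near_frontier {F U : Set (Fin d → ℂ)} {ρ : (Fin d → ℂ) → ℝ}
    (hF : IsCompact F) (hU : IsOpen U) (hFU : F ⊆ U) (hρ : ContDiffOn ℝ 2 ρ U)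
    (hρ0 : ∀ p ∈ F, ρ p = 0)
    (hpos : ∀ p ∈ F, ∀ w : Fin d → ℂ, w ≠ 0 →
      ∑ j, wirtingerD j (fun v => (ρ v : ℂ)) p * w j = 0 → 0 < leviForm ρ p w) :
    ∃ B c : ℝ, ∃ W, 0 ≤ B ∧ 0 < c ∧ IsOpen W ∧ F ⊆ W ∧ W ⊆ U ∧
      ∀ z ∈ W, ∀ w, c * ∑ j, ‖w j‖ ^ 2 ≤ leviForm (fun z => ρ z + B * ρ z ^ 2) z w := by
  set S : Set (Fin d → ℂ) := {w | ∑ j, ‖w j‖ ^ 2 = 1} with hS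
  have hnorm : Continuous fun w : Fin d → ℂ => ∑ j, ‖w j‖ ^ 2 := contDiff_sum_norm_sq.continuous
  have hSc : IsCompact S := by
    refine Metric.isCompact_of_isClosed_isBounded (isClosed_eq hnorm continuous_const) ?_
    refine (Metric.isBounded_closedBall (x := (0 : Fin d → ℂ)) (r := 1)).subset fun w hw => ?_
    rw [mem_closedBall_zero_iff, pi_norm_le_iff_of_nonneg zero_le_one]
    intro j
    have h1 : ‖w j‖ ^ 2 ≤ ∑ j, ‖w j‖ ^ 2 :=
      Finset.single_le_sum (f := fun j => ‖w j‖ ^ 2) (fun j _ => by positivity) (Finset.mem_univ j)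
    rw [show ∑ j, ‖w j‖ ^ 2 = 1 from hw] at h1
    nlinarith [norm_nonneg (w j)]
  have hS0 : ∀ w ∈ S, w ≠ 0 := by
    rintro w hw rfl
    simp [hS] at hw
  set V : Set ((Fin d → ℂ) × (Fin d → ℂ)) := U ×ˢ univ with hV
  have hVo : IsOpen V := hU.prod isOpen_univ
  have hfst : ∀ {f : (Fin d → ℂ) → ℂ}, ContinuousOn f U → ContinuousOn
      (fun x : (Fin d → ℂ) × (Fin d → ℂ) => f x.1) V := fun hf =>
    hf.comp continuous_fst.continuousOn fun x hx => hx.1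
  have hρc : ContinuousOn (fun x : (Fin d → ℂ) × (Fin d → ℂ) => ρ x.1) V :=
    hρ.continuousOn.comp continuous_fst.continuousOn fun x hx => hx.1
  have hD : ∀ j, ContinuousOn (wirtingerD j fun z => (ρ z : ℂ)) U := fun j =>
    (hρ.ofReal_comp.wirtingerD (m := 0) hU (by norm_num) j).continuousOn
  have hm : ∀ j l, ContinuousOn (fun z => leviMatrix ρ z j l) U := fun j l => by
    simp only [leviMatrix_eq]
    exact ((hρ.ofReal_comp.wirtingerDbar (m := 1) hU (by norm_num) l).wirtingerD (m := 0) hU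
      (by norm_num) j).continuousOn
  set a : (Fin d → ℂ) × (Fin d → ℂ) → ℝ := fun x => leviForm ρ x.1 x.2 with ha
  have hac : ContinuousOn a V := by
    refine Complex.continuous_re.comp_continuousOn ?_
    refine continuousOn_finsetSum _ fun j _ => continuousOn_finsetSum _ fun l _ => ?_
    exact ((hfst (hm j l)).mul (by fun_prop)).mul (by fun_prop)
  set b : (Fin d → ℂ) × (Fin d → ℂ) → ℝ :=
    fun x => ‖∑ j, wirtingerD j (fun v => (ρ v : ℂ)) x.1 * x.2 j‖ ^ 2 with hb
  have hbc : ContinuousOn b V := by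
    refine ContinuousOn.pow (ContinuousOn.norm ?_) 2
    exact continuousOn_finsetSum _ fun j _ => (hfst (hD j)).mul (by fun_prop)
  have hb0 : ∀ x, 0 ≤ b x := fun x => by positivity
  have hlevi : ∀ B : ℝ, ∀ z ∈ U, ∀ w, leviForm (fun z => ρ z + B * ρ z ^ 2) z w
      = (1 + 2 * B * ρ z) * a (z, w) + 2 * B * b (z, w) := fun B z hz w => by
    have hp : ∀ x : ℝ, HasDerivAt (fun x => x + B * x ^ 2) (1 + 2 * B * x) x := fun x => by
      refine ((hasDerivAt_id x).add ((hasDerivAt_pow 2 x).const_mul B)).congr_deriv ?_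
      push_cast; ring
    have hp' : HasDerivAt (fun x : ℝ => 1 + 2 * B * x) (2 * B) (ρ z) := by
      simpa using ((hasDerivAt_id (ρ z)).const_mul (2 * B)).const_add 1
    exact leviForm_comp (p := fun x => x + B * x ^ 2) hp hp' (hρ.contDiffAt (hU.mem_nhds hz)) w
  set O : ℕ → Set ((Fin d → ℂ) × (Fin d → ℂ)) := fun n =>
    V ∩ (fun x => (1 + 2 * n * ρ x.1) * a x + 2 * n * b x) ⁻¹' Ioi (1 / ((n : ℝ) + 1)) with hO
  have hOo : ∀ n, IsOpen (O n) := fun n => by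
    refine ContinuousOn.isOpen_inter_preimage ?_ hVo isOpen_Ioi
    exact (((hρc.const_smul (2 * n : ℝ)).const_add 1 |>.congr fun x _ => by simp).mul hac).add
      (hbc.const_smul (2 * n : ℝ) |>.congr fun x _ => by simp)
  obtain ⟨n, hn⟩ : ∃ n, F ×ˢ S ⊆ O n := by
    set O' : ℕ → Set ((Fin d → ℂ) × (Fin d → ℂ)) := fun n =>
      V ∩ (fun x => a x + 2 * n * b x) ⁻¹' Ioi (1 / ((n : ℝ) + 1)) with hO'
    -- on `F`, where `ρ = 0`, the Levi form is `a + 2 n b`; it increases with `n`, and `a > 0`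
    -- where `b = 0`
    obtain ⟨n, hn⟩ := (hF.prod hSc).elim_directed_cover O' (fun n => by
        refine ContinuousOn.isOpen_inter_preimage ?_ hVo isOpen_Ioi
        exact hac.add (hbc.const_smul (2 * n : ℝ) |>.congr fun x _ => by simp)) (by
        rintro ⟨p, w⟩ ⟨hp, hw⟩
        have hpV : (p, w) ∈ V := ⟨hFU hp, mem_univ _⟩
        rw [mem_iUnion]
        by_cases hb' : b (p, w) = 0
        · have ha0 : 0 < a (p, w) := hpos p hp w (hS0 w hw) (by simpa [hb] using hb')
          obtain ⟨n, hn⟩ := exists_nat_one_div_lt ha0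
          exact ⟨n, hpV, by simpa [hb'] using hn⟩
        · have hb1 : 0 < b (p, w) := lt_of_le_of_ne (hb0 _) (Ne.symm hb')
          obtain ⟨n, hn⟩ := exists_nat_gt ((1 - a (p, w)) / b (p, w))
          rw [div_lt_iff₀ hb1] at hn
          refine ⟨n, hpV, ?_⟩
          have h1 : 1 / ((n : ℝ) + 1) ≤ 1 := by
            rw [div_le_one (by positivity)]; linarith [(Nat.cast_nonneg n : (0 : ℝ) ≤ n)]
          have h2 : 0 ≤ (n : ℝ) * b (p, w) := by positivity
          change 1 / ((n : ℝ) + 1) < a (p, w) + 2 * n * b (p, w)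
          linarith) (by
        refine (monotone_nat_of_le_succ fun n => ?_).directed_le
        rintro x ⟨hx, hx2⟩
        refine ⟨hx, ?_⟩
        have hx3 : 1 / ((n : ℝ) + 1) < a x + 2 * n * b x := hx2
        change 1 / (((n + 1 : ℕ) : ℝ) + 1) < a x + 2 * ((n + 1 : ℕ) : ℝ) * b x
        have h1 : 1 / (((n + 1 : ℕ) : ℝ) + 1) ≤ 1 / ((n : ℝ) + 1) := by
          apply one_div_le_one_div_of_le (by positivity); push_cast; linarith
        have := hb0 x
        push_cast at h1 ⊢
        linarith)
    refine ⟨n, fun x hx => ⟨(hn hx).1, ?_⟩⟩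
    have := (hn hx).2
    simp only [mem_preimage, mem_Ioi] at this ⊢
    rw [hρ0 x.1 hx.1]
    simpa using this
  obtain ⟨W, T, hWo, -, hFW, hST, hWT⟩ := generalized_tube_lemma hF hSc (hOo n) hn
  refine ⟨n, 1 / ((n : ℝ) + 1), W ∩ U, by positivity, by positivity, hWo.inter hU,
    subset_inter hFW hFU, inter_subset_right, fun z hz w => ?_⟩
  by_cases hw : ∑ j, ‖w j‖ ^ 2 = 0
  · have hw' : w = 0 := by
      funext j
      have := (Finset.sum_eq_zero_iff_of_nonneg (fun j _ => by positivity)).1 hw j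
        (Finset.mem_univ j)
      simpa using this
    subst hw'
    simp [leviForm]
  · have hw0 : 0 < ∑ j, ‖w j‖ ^ 2 :=
      lt_of_le_of_ne (Finset.sum_nonneg fun j _ => by positivity) (Ne.symm hw)
    set s := Real.sqrt (∑ j, ‖w j‖ ^ 2) with hs
    have hs0 : 0 < s := Real.sqrt_pos.2 hw0
    have hs2 : s ^ 2 = ∑ j, ‖w j‖ ^ 2 := Real.sq_sqrt hw0.le
    set v : Fin d → ℂ := fun j => (s : ℂ)⁻¹ * w j with hv
    have hvS : v ∈ S := by
      change ∑ j, ‖v j‖ ^ 2 = 1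
      simp only [hv, norm_mul, mul_pow, norm_inv, Complex.norm_real, Real.norm_eq_abs, inv_pow,
        sq_abs]
      rw [← Finset.mul_sum, ← hs2, inv_mul_cancel₀ (by positivity)]
    have h1 : (z, v) ∈ O n := hWT ⟨hz.1, hST hvS⟩
    have h2 : 1 / ((n : ℝ) + 1) < leviForm (fun z => ρ z + n * ρ z ^ 2) z v := by
      rw [hlevi n z hz.2]; exact h1.2
    have hwv : w = fun j => (s : ℂ) * v j := by
      funext j
      have : (s : ℂ) ≠ 0 := by exact_mod_cast hs0.ne'
      simp only [hv]; field_simp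
    have h3 : leviForm (fun z => ρ z + n * ρ z ^ 2) z w
        = s ^ 2 * leviForm (fun z => ρ z + n * ρ z ^ 2) z v := by
      conv_lhs => rw [hwv]
      rw [leviForm_smul]
    rw [h3, hs2, mul_comm]
    exact mul_le_mul_of_nonneg_left h2.le hw0.le

lemma leviForm_nonneg_of_posSemidef {z : Fin d → ℂ} (h : (leviMatrix ψ z).PosSemidef)
    (w : Fin d → ℂ) : 0 ≤ leviForm ψ z w := by
  have := h.dotProduct_mulVec_nonneg (fun j => conj (w j))
  rw [Complex.le_def] at this
  refine le_of_le_of_eq this.1 ?_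
  simp only [leviForm, dotProduct, Matrix.mulVec, Finset.mul_sum, Pi.star_apply, RCLike.star_def,
    Complex.conj_conj]
  refine congrArg Complex.re (Finset.sum_congr rfl fun j _ => Finset.sum_congr rfl fun l _ => ?_)
  ring

/-- The `L²` estimate for the weight `η μ + |z|²` on a bounded strictly pseudoconvex domain, or on
`ℂ^d`, exhausted by balls. The constant depends neither on `η ≥ 0` nor on `μ`. -/
lemma norm_integral_twistedDbar_sq_le_of_psh {Γ : Set (Fin d → ℂ)} {μ : (Fin d → ℂ) → ℝ}
    (hΓ : Γ = univ ∨ IsBoundedStrictlyPseudoconvexDomain Γ) (hμ : ContDiffOn ℝ 2 μ Γ)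
    (hpsh : ∀ z ∈ Γ, (leviMatrix μ z).PosSemidef) {η : ℝ} (hη : 0 ≤ η)
    {u : (Fin d → ℂ) → ℂ} {g : Fin d → (Fin d → ℂ) → ℂ} (hu : ContDiff ℝ 2 u)
    (huc : HasCompactSupport u) (huΓ : tsupport u ⊆ Γ) (hg : ∀ j, ContDiff ℝ 2 (g j))
    (hgc : ∀ j, HasCompactSupport (g j)) (hgΓ : ∀ j, tsupport (g j) ⊆ Γ) :
    ‖∑ j, ∫ z, twistedDbar (fun z => η * μ z + ∑ j, ‖z j‖ ^ 2) j u z * conj (g j z)‖ ^ 2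
      ≤ 2 * (∑ j, ∫ z, ‖twistedDbar (fun z => η * μ z + ∑ j, ‖z j‖ ^ 2) j u z‖ ^ 2)
        * ∫ z, ‖∑ j, twistedD (fun z => η * μ z + ∑ j, ‖z j‖ ^ 2) j (g j) z‖ ^ 2 := by
  have h2 : (2 : WithTop ℕ∞) ≤ ((⊤ : ℕ∞) : WithTop ℕ∞) :=
    WithTop.coe_le_coe.2 (le_top : (2 : ℕ∞) ≤ ⊤)
  have hn2 : ContDiff ℝ 2 fun z : Fin d → ℂ => ∑ j, ‖z j‖ ^ 2 := contDiff_sum_norm_sq.of_le h2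
  have hψ : ContDiffOn ℝ 2 (fun z => η * μ z + ∑ j, ‖z j‖ ^ 2) Γ :=
    (contDiffOn_const.mul hμ).add hn2.contDiffOn
  have hΓo : IsOpen Γ := by
    rcases hΓ with rfl | h
    · exact isOpen_univ
    · exact h.1
  have hψl : ∀ z ∈ Γ, ∀ w, ∑ j, ‖w j‖ ^ 2 ≤ leviForm (fun z => η * μ z + ∑ j, ‖z j‖ ^ 2) z w := by
    intro z hz w
    have hμz : ContDiffAt ℝ 2 μ z := hμ.contDiffAt (hΓo.mem_nhds hz)
    rw [leviForm_add (contDiffAt_const.mul hμz) hn2.contDiffAt, leviForm_sum_norm_sq,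
      leviForm_const_mul _ hμz]
    have := mul_nonneg hη (leviForm_nonneg_of_posSemidef (hpsh z hz) w)
    linarith
  -- on `ℂ^d`, work in a ball containing the supports
  rcases hΓ with rfl | ⟨-, -, hb, U, ρ, hU, hfU, hρ, hΓU, hfr⟩
  · have hKc : IsCompact (tsupport u ∪ ⋃ j, tsupport (g j)) :=
      huc.isCompact.union (isCompact_iUnion fun j => (hgc j).isCompact)
    obtain ⟨R, hR⟩ := hKc.bddAbove_image hn2.continuous.continuousOn
    have hRK : ∀ z ∈ tsupport u ∪ ⋃ j, tsupport (g j), ∑ j, ‖z j‖ ^ 2 < R + 1 := fun z hz =>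
      lt_of_le_of_lt (hR (mem_image_of_mem _ hz)) (by linarith)
    have hlevi : ∀ z w, leviForm (fun z : Fin d → ℂ => R + 1 - ∑ j, ‖z j‖ ^ 2) z w
        = -1 * ∑ j, ‖w j‖ ^ 2 := fun z w => by
      rw [leviForm_comp (p := fun x => R + 1 - x) (p' := fun _ => -1) (p'' := 0)
        (fun x => by simpa using (hasDerivAt_id x).const_sub (R + 1)) (hasDerivAt_const _ _)
        hn2.contDiffAt, leviForm_sum_norm_sq]
      ring
    refine norm_integral_twistedDbar_sq_le_of_exhaustion (W := univ) (c := 1)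
      (r := fun z => R + 1 - ∑ j, ‖z j‖ ^ 2) (Γ := {z | ∑ j, ‖z j‖ ^ 2 < R + 1})
      (isOpen_lt hn2.continuous continuous_const) ?_ (contDiff_const.sub hn2)
      (fun z hz => sub_pos.2 hz) (fun z hz => ?_) isOpen_univ (subset_univ _) one_pos
      (fun z _ w => (hlevi z w).le) (hψ.mono (subset_univ _)) (fun z _ w => hψl z (mem_univ _) w)
      hu huc (fun z hz => hRK z (Or.inl hz)) hg hgc
      (fun j z hz => hRK z (Or.inr (mem_iUnion.2 ⟨j, hz⟩)))
    · refine (Metric.isBounded_closedBall (x := (0 : Fin d → ℂ)) (r := |R| + 2)).subset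
        fun z hz => ?_
      rw [mem_closedBall_zero_iff, pi_norm_le_iff_of_nonneg (by positivity)]
      intro j
      have h1 : ‖z j‖ ^ 2 ≤ ∑ j, ‖z j‖ ^ 2 :=
        Finset.single_le_sum (f := fun j => ‖z j‖ ^ 2) (fun j _ => by positivity)
          (Finset.mem_univ j)
      have h3 : ∑ j, ‖z j‖ ^ 2 < R + 1 := hz
      nlinarith [norm_nonneg (z j), le_abs_self R, abs_nonneg R]
    · have : ∑ j, ‖z j‖ ^ 2 = R + 1 := frontier_lt_subset_eq hn2.continuous continuous_const hz
      rw [this, sub_self]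
  · have hρ0 : ∀ p ∈ frontier Γ, ρ p = 0 := fun p hp => by
      have hpU := hfU hp
      have hpΓ : p ∉ Γ := fun h => by
        rw [frontier, hΓo.interior_eq] at hp; exact hp.2 h
      refine le_antisymm ?_ ?_
      · by_contra! h
        have hev : ∀ᶠ z in 𝓝 p, 0 < ρ z ∧ z ∈ U :=
          ((hρ.continuousOn.continuousAt (hU.mem_nhds hpU)).eventually (lt_mem_nhds h)).and
            (hU.mem_nhds hpU)
        obtain ⟨z, hz, hzΓ⟩ := mem_closure_iff_nhds.1 hp.1 _ hev
        have : z ∈ {z ∈ U | ρ z < 0} := hΓU ▸ ⟨hzΓ, hz.2⟩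
        exact absurd this.2 (by linarith [hz.1])
      · by_contra! h
        have : p ∈ Γ ∩ U := hΓU ▸ ⟨hpU, h⟩
        exact hpΓ this.1
    have hFc : IsCompact (frontier Γ) := hb.isCompact_closure.of_isClosed_subset
      isClosed_frontier frontier_subset_closure
    obtain ⟨B, c, W, hB, hc, hW, hFW, hWU, hWc⟩ := exists_leviForm_ge_near_frontier hFc hU hfU hρ
      hρ0 fun p hp w hw h => (hfr p hp).2 w hw h
    set N : Set (Fin d → ℂ) := U ∩ (fun z => 1 + B * ρ z) ⁻¹' Ioi 0 with hN
    have hNo : IsOpen N := by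
      refine ContinuousOn.isOpen_inter_preimage ?_ hU isOpen_Ioi
      exact continuousOn_const.add (continuousOn_const.mul hρ.continuousOn)
    have hFN : frontier Γ ⊆ N := fun p hp => ⟨hfU hp, by
      change 0 < 1 + B * ρ p
      rw [hρ0 p hp]; simp⟩
    obtain ⟨β, hβ, hβ01, hβ1, hβN⟩ := exists_smooth_cutoff isClosed_frontier hNo hFN
    -- `r` is `-(ρ + B ρ²)` near the boundary, `1` away from it, and positive in between
    set r : (Fin d → ℂ) → ℝ := fun z => β z * (-(ρ z + B * ρ z ^ 2) - 1) + 1 with hr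
    have hrc : ContDiff ℝ 2 r := by
      refine ContDiff.add (ContDiffOn.contDiff_of_eventually_zero (s := U) ?_ hU fun z hz => ?_)
        contDiff_const
      · exact (hβ.of_le h2).contDiffOn.mul
          ((hρ.add (contDiffOn_const.mul (hρ.pow 2))).neg.sub contDiffOn_const)
      · have : z ∉ tsupport β := fun h => hz (hβN h).1
        filter_upwards [(notMem_tsupport_iff_eventuallyEq.1 this)] with y hy
        simp [hy]
    have hr0 : ∀ z ∈ Γ, 0 < r z := fun z hz => by
      by_cases hzN : z ∈ N
      · have h3 : ρ z < 0 := by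
          have : z ∈ {z ∈ U | ρ z < 0} := hΓU ▸ ⟨hz, hzN.1⟩
          exact this.2
        have h4 : 0 < 1 + B * ρ z := hzN.2
        have h5 : 0 < -(ρ z + B * ρ z ^ 2) := by nlinarith
        obtain ⟨h6, h7⟩ := hβ01 z
        change 0 < β z * (-(ρ z + B * ρ z ^ 2) - 1) + 1
        rcases h6.eq_or_lt with h8 | h8
        · rw [← h8]; simp
        · nlinarith [mul_pos h8 h5]
      · have : z ∉ tsupport β := fun h => hzN (hβN h)
        simp [hr, image_eq_zero_of_notMem_tsupport this]
    have hrF : ∀ z ∈ frontier Γ, r z = 0 := fun z hz => by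
      simp [hr, (hβ1 z hz).self_of_nhds, hρ0 z hz]
    set W' : Set (Fin d → ℂ) := W ∩ interior {z | β z = 1} with hW'
    refine norm_integral_twistedDbar_sq_le_of_exhaustion hΓo hb hrc hr0 hrF (W := W')
      (hW.inter isOpen_interior) (fun z hz => ⟨hFW hz, mem_interior_iff_mem_nhds.2 (hβ1 z hz)⟩) hc
      (fun z hz w => ?_) hψ hψl hu huc huΓ hg hgc hgΓ
    have e : r =ᶠ[𝓝 z] fun z => -1 * (ρ z + B * ρ z ^ 2) := by
      filter_upwards [mem_interior_iff_mem_nhds.1 hz.2] with y hy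
      have hy : β y = 1 := hy
      simp [hr, hy]
    have hρz : ContDiffAt ℝ 2 (fun z => ρ z + B * ρ z ^ 2) z :=
      (hρ.add (contDiffOn_const.mul (hρ.pow 2))).contDiffAt (hU.mem_nhds (hWU hz.1))
    rw [leviForm_congr e, leviForm_const_mul _ hρz]
    have := hWc z hz.1 w
    linarith

end Exhaustion

/-! ### The partial Fourier transform of test functions -/

section PartialFourier

open Filter Topology FourierTransform

variable {E F : Type} [NormedAddCommGroup E] [NormedAddCommGroup F]

lemma HasCompactSupport.slice {M : Type} [Zero M] {u : E × ℝ → M} (hu : HasCompactSupport u)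
    (z : E) : HasCompactSupport fun t => u (z, t) :=
  HasCompactSupport.intro (hu.isCompact.image continuous_snd) fun t ht =>
    image_eq_zero_of_notMem_tsupport fun h => ht ⟨(z, t), h, rfl⟩

lemma exists_integrable_bound {u : E × ℝ → F} (hu : Continuous u) (hc : HasCompactSupport u) :
    ∃ b : ℝ → ℝ, Integrable b ∧ ∀ x, ‖u x‖ ≤ b x.2 := by
  obtain ⟨C, hC⟩ := hc.exists_bound_of_continuous hu
  have hT : IsCompact (Prod.snd '' tsupport u) := hc.isCompact.image continuous_snd
  refine ⟨(Prod.snd '' tsupport u).indicator fun _ => C,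
    (integrable_indicator_iff hT.measurableSet).2 (integrableOn_const hT.measure_lt_top.ne),
    fun x => ?_⟩
  by_cases hx : x.2 ∈ Prod.snd '' tsupport u
  · rw [indicator_of_mem hx]; exact hC x
  · rw [indicator_of_notMem hx,
      image_eq_zero_of_notMem_tsupport fun h => hx ⟨x, h, rfl⟩, norm_zero]

lemma integrable_slice {u : E × ℝ → F} (hu : Continuous u) (hc : HasCompactSupport u) (z : E) :
    Integrable fun t => u (z, t) :=
  (hu.comp (by fun_prop : Continuous fun t : ℝ => (z, t))).integrable_of_hasCompactSupport
    (hc.slice z)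

variable [NormedSpace ℂ F]

/-- The Fourier transform `∫ e^{-2πitξ} u(z, t) dt` in the last variable, at `x = (z, ξ)`. The
frequency `η` of `frequencyCutoff` is `2πξ`. -/
def partialFourier (u : E × ℝ → F) (x : E × ℝ) : F := 𝓕 (fun t => u (x.1, t)) x.2

lemma partialFourier_eq {E : Type} (u : E × ℝ → F) (x : E × ℝ) :
    partialFourier u x = ∫ t, 𝐞 (-(t * x.2)) • u (x.1, t) := Real.fourier_real_eq _ _

lemma continuous_partialFourier {u : E × ℝ → F} (hu : Continuous u) (hc : HasCompactSupport u) :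
    Continuous (partialFourier u) := by
  obtain ⟨b, hb, hub⟩ := exists_integrable_bound hu hc
  have e : partialFourier u = fun x => ∫ t, 𝐞 (-(t * x.2)) • u (x.1, t) :=
    funext (partialFourier_eq u)
  rw [e]
  refine continuous_of_dominated (fun x => ?_) (fun x => .of_forall fun t => ?_) hb
    (.of_forall fun t => ?_)
  · exact Continuous.aestronglyMeasurable (by fun_prop)
  · rw [Circle.norm_smul]; exact hub (x.1, t)
  · fun_prop

lemma exists_norm_partialFourier_le {u : E × ℝ → F} (hu : Continuous u)
    (hc : HasCompactSupport u) : ∃ C, 0 ≤ C ∧ ∀ x, ‖partialFourier u x‖ ≤ C := by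
  obtain ⟨b, hb, hub⟩ := exists_integrable_bound hu hc
  have hb0 : ∀ t, 0 ≤ b t := fun t => (norm_nonneg _).trans (hub (0, t))
  refine ⟨∫ t, b t, integral_nonneg hb0, fun x => ?_⟩
  rw [partialFourier_eq]
  exact norm_integral_le_of_norm_le hb (.of_forall fun t => by
    rw [Circle.norm_smul]; exact hub (x.1, t))

lemma partialFourier_eq_zero {u : E × ℝ → F} {z : E} (hz : z ∉ Prod.fst '' tsupport u) (ξ : ℝ) :
    partialFourier u (z, ξ) = 0 := by
  rw [partialFourier_eq]
  refine integral_eq_zero_of_ae (.of_forall fun t => ?_)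
  simp [image_eq_zero_of_notMem_tsupport fun h => hz ⟨(z, t), h, rfl⟩]

lemma HasCompactSupport.partialFourier {u : E × ℝ → F} (hc : HasCompactSupport u) (ξ : ℝ) :
    HasCompactSupport fun z => partialFourier u (z, ξ) :=
  HasCompactSupport.intro (hc.isCompact.image continuous_fst) fun _ hz =>
    partialFourier_eq_zero hz ξ

lemma tsupport_partialFourier_subset {u : E × ℝ → F} (hc : HasCompactSupport u) (ξ : ℝ) :
    tsupport (fun z => _root_.partialFourier u (z, ξ)) ⊆ Prod.fst '' tsupport u :=
  closure_minimal (fun z hz => by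
    by_contra h
    exact hz (partialFourier_eq_zero h ξ)) (hc.isCompact.image continuous_fst).isClosed

variable [NormedSpace ℝ E]

lemma ContDiff.slice {n : WithTop ℕ∞} {u : E × ℝ → F} (hu : ContDiff ℝ n u) (z : E) :
    ContDiff ℝ n fun t => u (z, t) :=
  hu.comp (contDiff_prodMk_right z)

lemma partialFourier_add {E : Type} {u v : E × ℝ → F} {x : E × ℝ}
    (hu : Integrable fun t => u (x.1, t)) (hv : Integrable fun t => v (x.1, t)) :
    partialFourier (fun y => u y + v y) x = partialFourier u x + partialFourier v x := by
  simp only [partialFourier_eq, smul_add]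
  refine integral_add ?_ ?_
  · exact (Real.fourierIntegral_convergent_iff (μ := volume) (V := ℝ) x.2).2 hu
      |>.congr (.of_forall fun t => by simp [mul_comm])
  · exact (Real.fourierIntegral_convergent_iff (μ := volume) (V := ℝ) x.2).2 hv
      |>.congr (.of_forall fun t => by simp [mul_comm])

lemma partialFourier_mul_fst {E : Type} (a : E → ℂ) (u : E × ℝ → ℂ) (x : E × ℝ) :
    partialFourier (fun y => a y.1 * u y) x = a x.1 * partialFourier u x := by
  simp only [partialFourier_eq, ← integral_const_mul]
  refine integral_congr_ae (.of_forall fun t => ?_)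
  simp only [Circle.smul_def, smul_eq_mul]; ring

lemma hasFDerivAt_partialFourier {u : E × ℝ → F} (hu : ContDiff ℝ 1 u)
    (hc : HasCompactSupport u) (z : E) (ξ : ℝ) :
    HasFDerivAt (fun z => partialFourier u (z, ξ))
      (partialFourier (fun x => (fderiv ℝ u x).comp (ContinuousLinearMap.inl ℝ E ℝ)) (z, ξ)) z := by
  have hD : Continuous fun x => (fderiv ℝ u x).comp (ContinuousLinearMap.inl ℝ E ℝ) :=
    (hu.continuous_fderiv (by simp)).clm_comp continuous_const
  have hDc : HasCompactSupport fun x => (fderiv ℝ u x).comp (ContinuousLinearMap.inl ℝ E ℝ) :=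
    (hc.fderiv ℝ).comp_left (g := fun A : E × ℝ →L[ℝ] F => A.comp (ContinuousLinearMap.inl ℝ E ℝ))
      (by simp)
  obtain ⟨b, hb, hub⟩ := exists_integrable_bound hD hDc
  simp only [partialFourier_eq]
  refine hasFDerivAt_integral_of_dominated_of_fderiv_le (𝕜 := ℝ) (s := univ) (bound := b)
    (F := fun z t => 𝐞 (-(t * ξ)) • u (z, t))
    (F' := fun z t => 𝐞 (-(t * ξ)) • (fderiv ℝ u (z, t)).comp (ContinuousLinearMap.inl ℝ E ℝ))
    univ_mem ?_ ?_ ?_ ?_ hb ?_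
  · exact .of_forall fun z => Continuous.aestronglyMeasurable (by
      have := hu.continuous; fun_prop)
  · exact ((by have := hu.continuous; fun_prop :
      Continuous fun t => 𝐞 (-(t * ξ)) • u (z, t))).integrable_of_hasCompactSupport
      ((hc.slice z).smul_left (f := fun t => 𝐞 (-(t * ξ))))
  · exact Continuous.aestronglyMeasurable (by fun_prop)
  · refine .of_forall fun t y _ => ?_
    rw [Circle.smul_def, norm_smul, Circle.norm_coe, one_mul]; exact hub (y, t)
  · refine .of_forall fun t y _ => ?_
    have h1 : HasFDerivAt (fun z => u (z, t)) ((fderiv ℝ u (y, t)).comp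
        (ContinuousLinearMap.inl ℝ E ℝ)) y :=
      (hu.differentiable (by simp) (y, t)).hasFDerivAt.comp y (hasFDerivAt_prodMk_left y t)
    simpa only [Circle.smul_def] using! h1.const_smul (𝐞 (-(t * ξ)) : ℂ)

lemma contDiff_partialFourier {u : E × ℝ → F} (hu : ContDiff ℝ ∞ u) (hc : HasCompactSupport u)
    (ξ : ℝ) (n : ℕ) : ContDiff ℝ n fun z => partialFourier u (z, ξ) := by
  induction n generalizing F with
  | zero =>
    exact contDiff_zero.2 ((continuous_partialFourier hu.continuous hc).comp (by fun_prop))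
  | succ n ih =>
    have hu1 : ContDiff ℝ 1 u := hu.of_le (by simp)
    push_cast
    rw [contDiff_succ_iff_fderiv]
    refine ⟨fun z => (hasFDerivAt_partialFourier hu1 hc z ξ).differentiableAt, by simp, ?_⟩
    have e : fderiv ℝ (fun z => partialFourier u (z, ξ)) = fun z =>
        partialFourier (fun x => (fderiv ℝ u x).comp (ContinuousLinearMap.inl ℝ E ℝ)) (z, ξ) :=
      funext fun z => (hasFDerivAt_partialFourier hu1 hc z ξ).fderiv
    rw [e]
    refine ih ?_ ?_
    · exact (hu.fderiv_right (m := ∞) (by simp)).clm_comp contDiff_const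
    · exact (hc.fderiv ℝ).comp_left
        (g := fun A : E × ℝ →L[ℝ] F => A.comp (ContinuousLinearMap.inl ℝ E ℝ)) (by simp)

lemma fderiv_partialFourier_apply {u : E × ℝ → F} (hu : ContDiff ℝ 1 u)
    (hc : HasCompactSupport u) (z : E) (ξ : ℝ) (v : E) :
    fderiv ℝ (fun z => partialFourier u (z, ξ)) z v
      = partialFourier (fun x => fderiv ℝ u x (v, 0)) (z, ξ) := by
  have hD : Continuous fun x => (fderiv ℝ u x).comp (ContinuousLinearMap.inl ℝ E ℝ) :=
    (hu.continuous_fderiv (by simp)).clm_comp continuous_const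
  have hDc : HasCompactSupport fun x => (fderiv ℝ u x).comp (ContinuousLinearMap.inl ℝ E ℝ) :=
    (hc.fderiv ℝ).comp_left (g := fun A : E × ℝ →L[ℝ] F => A.comp (ContinuousLinearMap.inl ℝ E ℝ))
      (by simp)
  rw [(hasFDerivAt_partialFourier hu hc z ξ).fderiv]
  simp only [partialFourier]
  rw [Real.fourier_continuousLinearMap_apply (integrable_slice hD hDc z)]
  simp

lemma partialFourier_fderiv_snd {u : E × ℝ → F} (hu : ContDiff ℝ 1 u)
    (hc : HasCompactSupport u) (x : E × ℝ) :
    partialFourier (fun y => fderiv ℝ u y (0, 1)) x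
      = (2 * Real.pi * Complex.I * x.2) • partialFourier u x := by
  have hs : ContDiff ℝ 1 fun t => u (x.1, t) := hu.slice x.1
  have hd : deriv (fun t => u (x.1, t)) = fun t => fderiv ℝ u (x.1, t) (0, 1) := by
    funext t
    have h1 := (hu.differentiable (by simp) (x.1, t)).hasFDerivAt.comp_hasDerivAt t
      ((hasDerivAt_const t x.1).prodMk (hasDerivAt_id t))
    exact h1.deriv
  have h := congrFun (Real.fourier_deriv (integrable_slice hu.continuous hc x.1)
    (hs.differentiable (by simp)) ((hs.continuous_deriv (by simp)).integrable_of_hasCompactSupport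
      (hc.slice x.1).deriv)) x.2
  rw [hd] at h
  exact h

/-- The partial Fourier transform of a test function decays in frequency, uniformly in `z`. -/
lemma exists_norm_partialFourier_le_inv {u : E × ℝ → F} (hu : ContDiff ℝ ∞ u)
    (hc : HasCompactSupport u) : ∃ C, 0 ≤ C ∧ ∀ x, ‖partialFourier u x‖ ≤ C * (1 + x.2 ^ 2)⁻¹ := by
  -- the second derivative in `t` gives a factor `ξ²`
  set u1 : E × ℝ → F := fun y => fderiv ℝ u y (0, 1) with hu1
  set u2 : E × ℝ → F := fun y => fderiv ℝ u1 y (0, 1) with hu2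
  have c1 : ContDiff ℝ ∞ u1 := (hu.fderiv_right (m := ∞) (by simp)).clm_apply contDiff_const
  have c2 : ContDiff ℝ ∞ u2 := (c1.fderiv_right (m := ∞) (by simp)).clm_apply contDiff_const
  have s1 : HasCompactSupport u1 := hc.fderiv_apply ℝ _
  have s2 : HasCompactSupport u2 := s1.fderiv_apply ℝ _
  obtain ⟨C, hC0, hC⟩ := exists_norm_partialFourier_le hu.continuous hc
  obtain ⟨C', hC'0, hC'⟩ := exists_norm_partialFourier_le c2.continuous s2
  refine ⟨C + C', by positivity, fun x => ?_⟩
  rw [← div_eq_mul_inv, le_div_iff₀ (by positivity), mul_add, mul_one]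
  refine add_le_add (hC x) (le_trans ?_ (hC' x))
  rw [hu2, partialFourier_fderiv_snd (c1.of_le (by simp)) s1, hu1,
    partialFourier_fderiv_snd (hu.of_le (by simp)) hc, smul_smul, norm_smul]
  have hn : ‖(2 * Real.pi * Complex.I * x.2) * (2 * Real.pi * Complex.I * x.2)‖
      = (2 * Real.pi) ^ 2 * x.2 ^ 2 := by
    rw [← sq, norm_pow]
    simp only [norm_mul, Complex.norm_real, Complex.norm_I, Complex.norm_ofNat, Real.norm_eq_abs,
      abs_of_pos Real.pi_pos, mul_one, mul_pow, sq_abs]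
  rw [hn, mul_comm]
  have h1 : (1 : ℝ) ≤ (2 * Real.pi) ^ 2 := one_le_pow₀ (by linarith [Real.pi_gt_three])
  have h2 : x.2 ^ 2 ≤ (2 * Real.pi) ^ 2 * x.2 ^ 2 := le_mul_of_one_le_left (sq_nonneg _) h1
  exact mul_le_mul_of_nonneg_right h2 (norm_nonneg _)

/-- Plancherel's theorem on each line `{z} × ℝ`. -/
lemma lintegral_enorm_sq_partialFourier {u : E × ℝ → ℂ} (hu : ContDiff ℝ ∞ u)
    (hc : HasCompactSupport u) (z : E) :
    ∫⁻ ξ, ‖partialFourier u (z, ξ)‖ₑ ^ 2 = ∫⁻ t, ‖u (z, t)‖ₑ ^ 2 := by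
  set f := (hc.slice z).toSchwartzMap (hu.slice z) with hf
  have key : ∀ g : SchwartzMap ℝ ℂ, ∫⁻ t, ‖g t‖ₑ ^ 2 = ENNReal.ofReal (∫ t, ‖g t‖ ^ 2) := by
    intro g
    have hg : MemLp g 2 volume := g.memLp 2 volume
    rw [ofReal_integral_eq_lintegral_ofReal hg.norm.integrable_sq
      (.of_forall fun t => by positivity)]
    refine lintegral_congr fun t => ?_
    rw [ENNReal.ofReal_pow (norm_nonneg _), ofReal_norm]
  have h1 := key f
  have h2 := key (𝓕 f)
  rw [SchwartzMap.integral_norm_sq_fourier, ← h1] at h2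
  exact h2

lemma integrable_partialFourier_slice {u : E × ℝ → ℂ} (hu : ContDiff ℝ ∞ u)
    (hc : HasCompactSupport u) (z : E) : Integrable fun ξ => partialFourier u (z, ξ) := by
  obtain ⟨C, -, hC⟩ := exists_norm_partialFourier_le_inv hu hc
  refine (integrable_inv_one_add_sq.const_mul C).mono' ?_ (.of_forall fun ξ => hC (z, ξ))
  exact ((continuous_partialFourier hu.continuous hc).comp (by fun_prop :
    Continuous fun ξ : ℝ => (z, ξ))).aestronglyMeasurable

end PartialFourier

/-! ### The partial Fourier transform on `L²(X)` and frequency multipliers -/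

section Multiplier

open Filter Topology FourierTransform

/-- Parseval's identity in the form which needs no square integrability. -/
lemma integral_fourierInv_mul_conj {f g : ℝ → ℂ} (hf : Integrable f) (hg : Integrable g) :
    ∫ t, 𝓕⁻ f t * conj (g t) = ∫ ξ, f ξ * conj (𝓕 g ξ) := by
  have h := VectorFourier.integral_sesq_fourierIntegral_eq_neg_flip (μ := volume) (ν := volume)
    (e := 𝐞) (L := innerₗ ℝ) (innerSL ℂ) Real.continuous_fourierChar (by fun_prop) hg hf
  simp only [innerSL_apply_apply, RCLike.inner_apply, flip_innerₗ] at h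
  exact h.symm

lemma eLpNorm_two_eq {α F : Type*} [MeasurableSpace α] [NormedAddCommGroup F] (f : α → F)
    (μ : Measure α) : eLpNorm f 2 μ = (∫⁻ x, ‖f x‖ₑ ^ 2 ∂μ) ^ (1 / 2 : ℝ) := by
  rw [eLpNorm_eq_lintegral_rpow_enorm_toReal (by simp) (by simp)]
  simp

namespace TubeCR

variable {d : ℕ} (X : TubeCR d)

/-- The measure `e^{-2|z|²} dλ(z)` on the base. -/
def baseMeasure : Measure (Fin d → ℂ) :=
  (volume.restrict X.base).withDensity fun z => ENNReal.ofReal (Real.exp (-2 * ∑ j, ‖z j‖ ^ 2))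

lemma measurable_baseDensity :
    Measurable fun z : Fin d → ℂ => ENNReal.ofReal (Real.exp (-2 * ∑ j, ‖z j‖ ^ 2)) :=
  (by fun_prop : Continuous fun z : Fin d → ℂ =>
    Real.exp (-2 * ∑ j, ‖z j‖ ^ 2)).measurable.ennreal_ofReal

instance : SFinite X.baseMeasure := by unfold baseMeasure; infer_instance

lemma measure_eq_prod : X.measure = X.baseMeasure.prod volume := by
  rw [baseMeasure, prod_withDensity_left measurable_baseDensity, measure,
    restrict_withDensity X.carrier.isOpen.measurableSet]
  congr 1
  rw [Measure.volume_eq_prod, ← Measure.restrict_univ (μ := (volume : Measure ℝ)),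
    Measure.prod_restrict, Measure.restrict_univ]
  rfl

lemma integral_baseMeasure {F : Type*} [NormedAddCommGroup F] [NormedSpace ℝ F]
    (f : (Fin d → ℂ) → F) :
    ∫ z, f z ∂X.baseMeasure = ∫ z in X.base, Real.exp (-2 * ∑ j, ‖z j‖ ^ 2) • f z := by
  rw [baseMeasure, integral_withDensity_eq_integral_toReal_smul measurable_baseDensity (by simp)]
  refine integral_congr_ae (.of_forall fun z => ?_)
  simp only [ENNReal.toReal_ofReal (Real.exp_pos _).le]

/-- A locally integrable function on `X` which is orthogonal to all test functions vanishes. -/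
lemma ae_eq_zero_of_integral_mul_test {f : (Fin d → ℂ) × ℝ → ℂ}
    (hf : LocallyIntegrable f X.measure)
    (h : ∀ g : 𝓓(X.carrier, ℂ), ∫ x, f x * g x ∂X.measure = 0) : f =ᵐ[X.measure] 0 := by
  have h1 : ∀ᵐ x ∂X.measure, x ∈ (X.carrier : Set _) → f x = 0 := by
    refine X.carrier.isOpen.ae_eq_zero_of_integral_contDiff_smul_eq_zero
      (hf.locallyIntegrableOn _) fun g hg hgc hgs => ?_
    have hc : HasCompactSupport fun x => (g x : ℂ) :=
      hgc.comp_left (g := ((↑) : ℝ → ℂ)) Complex.ofReal_zero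
    have hs : tsupport (fun x => (g x : ℂ)) ⊆ X.carrier :=
      (closure_mono (Function.support_comp_subset (g := ((↑) : ℝ → ℂ))
        Complex.ofReal_zero g)).trans hgs
    rw [← h ⟨fun x => (g x : ℂ), hg.ofReal_comp, hc, hs⟩]
    refine integral_congr_ae (.of_forall fun x => ?_)
    simp only [Complex.real_smul]
    exact mul_comm _ _
  have h2 : ∀ᵐ x ∂X.measure, x ∈ (X.carrier : Set _) :=
    ae_restrict_mem X.carrier.isOpen.measurableSet
  filter_upwards [h1, h2] with x hx hx2 using hx hx2

/-- `toL2` as a linear map. -/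
def toL2Linear : 𝓓(X.carrier, ℂ) →ₗ[ℂ] X.L2 where
  toFun := X.toL2
  map_add' _ _ := rfl
  map_smul' _ _ := rfl

/-- The complex conjugate of a test function. -/
def conjTest (u : 𝓓(X.carrier, ℂ)) : 𝓓(X.carrier, ℂ) :=
  ⟨fun x => conj (u x), u.contDiff.conj_comp, u.hasCompactSupport.conj_comp,
    (closure_mono fun x hx => by simpa using hx : tsupport (fun x => conj (u x)) ⊆ tsupport u).trans
      u.tsupport_subset⟩

lemma toL2_coeFn (u : 𝓓(X.carrier, ℂ)) : X.toL2 u =ᵐ[X.measure] u := MemLp.coeFn_toLp _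

lemma inner_toL2_left (u : 𝓓(X.carrier, ℂ)) (x : X.L2) :
    inner ℂ (X.toL2 u) x = ∫ p, x p * conj (u p) ∂X.measure := by
  rw [L2.inner_def]
  refine integral_congr_ae ?_
  filter_upwards [X.toL2_coeFn u] with p hp
  rw [hp, RCLike.inner_apply]

lemma eq_zero_of_inner_toL2_eq_zero {x : X.L2} (h : ∀ u, inner ℂ (X.toL2 u) x = 0) : x = 0 := by
  refine Lp.eq_zero_iff_ae_eq_zero.2 (X.ae_eq_zero_of_integral_mul_test
    ((Lp.memLp x).locallyIntegrable (by norm_num)) fun g => ?_)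
  rw [← h (X.conjTest g), inner_toL2_left]
  refine integral_congr_ae (.of_forall fun p => ?_)
  change _ = x p * conj (conj (g p))
  rw [Complex.conj_conj]

lemma denseRange_toL2 : DenseRange X.toL2Linear := by
  have h : (LinearMap.range X.toL2Linear)ᗮ = ⊥ := by
    rw [Submodule.eq_bot_iff]
    intro x hx
    refine X.eq_zero_of_inner_toL2_eq_zero fun u => ?_
    exact (Submodule.mem_orthogonal _ _).1 hx _ (LinearMap.mem_range_self _ u)
  have := Submodule.topologicalClosure_eq_top_iff.2 h
  rw [DenseRange, dense_iff_closure_eq]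
  have h2 := congrArg (fun s : Submodule ℂ X.L2 => (s : Set X.L2)) this
  rwa [Submodule.topologicalClosure_coe, LinearMap.coe_range, Submodule.top_coe] at h2

lemma eLpNorm_partialFourier (u : 𝓓(X.carrier, ℂ)) :
    eLpNorm (partialFourier u) 2 X.measure = eLpNorm u 2 X.measure := by
  have hm := continuous_partialFourier u.continuous u.hasCompactSupport
  rw [eLpNorm_two_eq, eLpNorm_two_eq, measure_eq_prod,
    lintegral_prod _ (hm.measurable.enorm.pow_const 2).aemeasurable,
    lintegral_prod _ (u.continuous.measurable.enorm.pow_const 2).aemeasurable]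
  congr 1
  exact lintegral_congr fun z => lintegral_enorm_sq_partialFourier u.contDiff u.hasCompactSupport z

lemma memLp_partialFourier (u : 𝓓(X.carrier, ℂ)) : MemLp (partialFourier u) 2 X.measure :=
  ⟨(continuous_partialFourier u.continuous u.hasCompactSupport).aestronglyMeasurable, by
    rw [eLpNorm_partialFourier]; exact (X.memLp_test u).2⟩

/-- The partial Fourier transform from test functions to `L²`. -/
def fourierTest : 𝓓(X.carrier, ℂ) →ₗ[ℂ] X.L2 where
  toFun u := (X.memLp_partialFourier u).toLp
  map_add' u v := by
    rw [← MemLp.toLp_add]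
    exact MemLp.toLp_congr _ _ (.of_forall fun x =>
      partialFourier_add (integrable_slice u.continuous u.hasCompactSupport x.1)
        (integrable_slice v.continuous v.hasCompactSupport x.1))
  map_smul' c u := by
    rw [RingHom.id_apply, ← MemLp.toLp_const_smul]
    exact MemLp.toLp_congr _ _ (.of_forall fun x => partialFourier_mul_fst (fun _ => c) u x)

lemma norm_fourierTest (u : 𝓓(X.carrier, ℂ)) : ‖X.fourierTest u‖ = ‖X.toL2Linear u‖ := by
  change ‖(X.memLp_partialFourier u).toLp‖ = ‖(X.memLp_test u).toLp‖
  rw [Lp.norm_toLp, Lp.norm_toLp, eLpNorm_partialFourier]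

/-- The partial Fourier transform in `t` on `L²(X)`, an isometry into `L²(X)`. -/
def fourierL2 : X.L2 →L[ℂ] X.L2 := X.fourierTest.extendOfNorm X.toL2Linear

lemma fourierL2_toL2 (u : 𝓓(X.carrier, ℂ)) : X.fourierL2 (X.toL2 u) = X.fourierTest u :=
  LinearMap.extendOfNorm_eq X.denseRange_toL2
    ⟨1, fun u => by rw [one_mul, norm_fourierTest]⟩ u

lemma coeFn_fourierL2_toL2 (u : 𝓓(X.carrier, ℂ)) :
    X.fourierL2 (X.toL2 u) =ᵐ[X.measure] partialFourier u := by
  rw [fourierL2_toL2]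
  exact MemLp.coeFn_toLp (X.memLp_partialFourier u)

/-- The function `σ(ξ)` of the frequency, as an essentially bounded function. -/
def symbol (σ : ℝ → ℝ) (hσ : Continuous σ) (hb : ∀ ξ, ‖σ ξ‖ ≤ 1) : Lp ℂ ∞ X.measure :=
  (memLp_top_of_bound (f := fun x : (Fin d → ℂ) × ℝ => (σ x.2 : ℂ)) (C := 1)
    (Continuous.aestronglyMeasurable (by fun_prop))
    (.of_forall fun x => by rw [Complex.norm_real]; exact hb x.2)).toLp

/-- Multiplication by the function `σ(ξ)` of the frequency. -/
def freqMul (σ : ℝ → ℝ) (hσ : Continuous σ) (hb : ∀ ξ, ‖σ ξ‖ ≤ 1) : X.L2 →L[ℂ] X.L2 :=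
  (ContinuousLinearMap.mul ℂ ℂ).holderL X.measure ∞ 2 2 (X.symbol σ hσ hb)

lemma coeFn_freqMul {σ : ℝ → ℝ} (hσ : Continuous σ) (hb : ∀ ξ, ‖σ ξ‖ ≤ 1) (x : X.L2) :
    X.freqMul σ hσ hb x =ᵐ[X.measure] fun p => (σ p.2 : ℂ) * x p := by
  have h1 : X.freqMul σ hσ hb x =ᵐ[X.measure] _ :=
    (ContinuousLinearMap.mul ℂ ℂ).coeFn_holder (r := 2) (X.symbol σ hσ hb) x
  have h2 : X.symbol σ hσ hb =ᵐ[X.measure] fun p => (σ p.2 : ℂ) := MemLp.coeFn_toLp _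
  filter_upwards [h1, h2] with p hp hp2
  rw [hp, hp2]; rfl

/-- The Fourier multiplier `σ(D_t / 2π)` on `L²(X)`, with `D_t = -i ∂/∂t`. The adjoint of the
isometry `fourierL2` plays the role of the inverse Fourier transform, so that surjectivity is not needed. -/
def multiplier (σ : ℝ → ℝ) (hσ : Continuous σ) (hb : ∀ ξ, ‖σ ξ‖ ≤ 1) : X.L2 →L[ℂ] X.L2 :=
  (ContinuousLinearMap.adjoint X.fourierL2).comp ((X.freqMul σ hσ hb).comp X.fourierL2)

variable {σ : ℝ → ℝ} (hσ : Continuous σ) (hb : ∀ ξ, ‖σ ξ‖ ≤ 1)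

lemma inner_multiplier (x y : X.L2) :
    inner ℂ x (X.multiplier σ hσ hb y)
      = ∫ p, (σ p.2 : ℂ) * (X.fourierL2 y p * conj (X.fourierL2 x p)) ∂X.measure := by
  rw [multiplier, ContinuousLinearMap.comp_apply, ContinuousLinearMap.adjoint_inner_right,
    ContinuousLinearMap.comp_apply, L2.inner_def]
  refine integral_congr_ae ?_
  filter_upwards [X.coeFn_freqMul hσ hb (X.fourierL2 y)] with p hp
  rw [hp, RCLike.inner_apply, mul_assoc]

lemma inner_multiplier_comm (x y : X.L2) :
    inner ℂ (X.multiplier σ hσ hb x) y = inner ℂ x (X.multiplier σ hσ hb y) := by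
  rw [← inner_conj_symm, inner_multiplier, inner_multiplier, ← integral_conj]
  refine integral_congr_ae (.of_forall fun p => ?_)
  simp only [map_mul, Complex.conj_ofReal, Complex.conj_conj]
  ring

lemma inner_toL2_multiplier_toL2 (u v : 𝓓(X.carrier, ℂ)) :
    inner ℂ (X.toL2 v) (X.multiplier σ hσ hb (X.toL2 u))
      = ∫ p, (σ p.2 : ℂ) * (partialFourier u p * conj (partialFourier v p)) ∂X.measure := by
  rw [inner_multiplier]
  refine integral_congr_ae ?_
  filter_upwards [X.coeFn_fourierL2_toL2 u, X.coeFn_fourierL2_toL2 v] with p hp hp2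
  rw [hp, hp2]

lemma integrable_symbol_mul {f : (Fin d → ℂ) × ℝ → ℂ} (hf : Integrable f X.measure)
    (hσ : Continuous σ) (hb : ∀ ξ, ‖σ ξ‖ ≤ 1) :
    Integrable (fun p => (σ p.2 : ℂ) * f p) X.measure :=
  hf.bdd_mul (c := 1) (Continuous.aestronglyMeasurable (by fun_prop))
    (.of_forall fun x => by rw [Complex.norm_real]; exact hb x.2)

/-- The frequency cutoff of a test function is a fibrewise inverse Fourier transform. -/
lemma frequencyCutoff_eq (τ : ℝ → ℝ) (u : (Fin d → ℂ) × ℝ → ℂ) (x : (Fin d → ℂ) × ℝ) :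
    frequencyCutoff τ u x
      = 𝓕⁻ (fun ξ => (τ (2 * Real.pi * ξ) : ℂ) * partialFourier u (x.1, ξ)) x.2 := by
  have hpi : (2 * Real.pi : ℝ) ≠ 0 := by positivity
  have h1 : ∀ η : ℝ, (∫ θ : ℝ, Complex.exp (Complex.I * ((x.2 - θ : ℝ) : ℂ) * (η : ℂ))
      * u (x.1, θ) * (τ η : ℂ)) = (fun ξ : ℝ => 𝐞 (ξ * x.2) • ((τ (2 * Real.pi * ξ) : ℂ)
        * partialFourier u (x.1, ξ))) ((2 * Real.pi)⁻¹ * η) := fun η => by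
    simp only [partialFourier_eq, Circle.smul_def, smul_eq_mul, ← integral_const_mul]
    refine integral_congr_ae (.of_forall fun θ => ?_)
    simp only [Real.fourierChar_apply]
    rw [mul_inv_cancel_left₀ hpi]
    have e1 : 2 * Real.pi * ((2 * Real.pi)⁻¹ * η * x.2) = η * x.2 := by field_simp
    have e2 : 2 * Real.pi * (-(θ * ((2 * Real.pi)⁻¹ * η))) = -(θ * η) := by field_simp
    rw [e1, e2]
    have e3 : Complex.exp (Complex.I * ((x.2 - θ : ℝ) : ℂ) * (η : ℂ))
        = Complex.exp (((η * x.2 : ℝ) : ℂ) * Complex.I)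
          * Complex.exp (((-(θ * η) : ℝ) : ℂ) * Complex.I) := by
      rw [← Complex.exp_add]; congr 1; push_cast; ring
    rw [e3]; ring
  rw [frequencyCutoff, integral_congr_ae (.of_forall h1), 
    Measure.integral_comp_mul_left (fun ξ : ℝ => 𝐞 (ξ * x.2) • ((τ (2 * Real.pi * ξ) : ℂ)
        * partialFourier u (x.1, ξ))), Real.fourierInv_eq]
  simp only [inv_inv, abs_of_pos (by positivity : 0 < 2 * Real.pi), Complex.real_smul]
  rw [← mul_assoc]
  have : (1 / (2 * Real.pi) : ℂ) * ((2 * Real.pi : ℝ) : ℂ) = 1 := by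
    push_cast
    have : (Real.pi : ℂ) ≠ 0 := by exact_mod_cast Real.pi_ne_zero
    field_simp
  rw [this, one_mul]
  refine integral_congr_ae (.of_forall fun ξ => ?_)
  simp [mul_comm]

lemma continuous_fourierInv_partialFourier (u : 𝓓(X.carrier, ℂ)) (hσ : Continuous σ)
    (hb : ∀ ξ, ‖σ ξ‖ ≤ 1) : Continuous fun x : (Fin d → ℂ) × ℝ =>
      𝓕⁻ (fun ξ => (σ ξ : ℂ) * partialFourier u (x.1, ξ)) x.2 := by
  obtain ⟨C, hC0, hC⟩ := exists_norm_partialFourier_le_inv u.contDiff u.hasCompactSupport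
  have hc := continuous_partialFourier u.continuous u.hasCompactSupport
  simp only [Real.fourierInv_eq]
  refine continuous_of_dominated (bound := fun ξ => C * (1 + ξ ^ 2)⁻¹) (fun x => ?_)
    (fun x => .of_forall fun ξ => ?_) (integrable_inv_one_add_sq.const_mul C)
    (.of_forall fun ξ => ?_)
  · exact Continuous.aestronglyMeasurable (by fun_prop)
  · rw [Circle.norm_smul, norm_mul, Complex.norm_real]
    exact (mul_le_of_le_one_left (norm_nonneg _) (hb ξ)).trans (hC (x.1, ξ))
  · fun_prop

/-- On test functions the Fourier multiplier is given by the integral formula. -/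
lemma coeFn_multiplier_toL2 (u : 𝓓(X.carrier, ℂ)) :
    X.multiplier σ hσ hb (X.toL2 u) =ᵐ[X.measure] fun x =>
      𝓕⁻ (fun ξ => (σ ξ : ℂ) * partialFourier u (x.1, ξ)) x.2 := by
  set q : (Fin d → ℂ) × ℝ → ℂ := fun x =>
    𝓕⁻ (fun ξ => (σ ξ : ℂ) * partialFourier u (x.1, ξ)) x.2 with hq
  have hqc : Continuous q := X.continuous_fourierInv_partialFourier u hσ hb
  have hli : LocallyIntegrable (X.multiplier σ hσ hb (X.toL2 u)) X.measure :=
    (Lp.memLp _).locallyIntegrable (by norm_num)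
  have main : (fun x => X.multiplier σ hσ hb (X.toL2 u) x - q x) =ᵐ[X.measure] 0 := by
    refine X.ae_eq_zero_of_integral_mul_test (hli.sub hqc.locallyIntegrable) fun g => ?_
    set v := X.conjTest g with hv
    have hgv : ∀ x, g x = conj (v x) := fun x => (Complex.conj_conj _).symm
    have i2 : Integrable (fun x => q x * g x) X.measure :=
      (hqc.mul g.continuous).integrable_of_hasCompactSupport g.hasCompactSupport.mul_left
    have i1 : Integrable (fun x => X.multiplier σ hσ hb (X.toL2 u) x * g x) X.measure :=
      (Lp.memLp _).integrable_mul (X.memLp_test g)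
    have e1 : ∫ x, X.multiplier σ hσ hb (X.toL2 u) x * g x ∂X.measure
        = ∫ p, (σ p.2 : ℂ) * (partialFourier u p * conj (partialFourier v p)) ∂X.measure := by
      rw [← X.inner_toL2_multiplier_toL2 hσ hb, inner_toL2_left]
      simp only [hgv]
    have i3 : Integrable (fun p => (σ p.2 : ℂ) * (partialFourier u p * conj (partialFourier v p)))
        X.measure :=
      X.integrable_symbol_mul ((X.memLp_partialFourier u).integrable_mul_conj
        (X.memLp_partialFourier v)) hσ hb
    have e2 : ∫ x, (X.multiplier σ hσ hb (X.toL2 u) x - q x) * g x ∂X.measure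
        = (∫ x, X.multiplier σ hσ hb (X.toL2 u) x * g x ∂X.measure)
          - ∫ x, q x * g x ∂X.measure := by
      rw [← integral_sub i1 i2]
      simp only [sub_mul]
    rw [e2, e1, sub_eq_zero]
    rw [measure_eq_prod] at i2 i3 ⊢
    rw [integral_prod _ i2, integral_prod _ i3]
    refine integral_congr_ae (.of_forall fun z => ?_)
    have hf : Integrable fun ξ => (σ ξ : ℂ) * partialFourier u (z, ξ) :=
      (integrable_partialFourier_slice u.contDiff u.hasCompactSupport z).bdd_mul (c := 1)
        (Continuous.aestronglyMeasurable (by fun_prop))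
        (.of_forall fun x => by rw [Complex.norm_real]; exact hb x)
    have := integral_fourierInv_mul_conj hf
      (integrable_slice v.continuous v.hasCompactSupport z)
    simp only [hgv, hq]
    rw [this]
    exact integral_congr_ae (.of_forall fun ξ => by
      simp only [partialFourier]; ring)
  filter_upwards [main] with x hx
  exact sub_eq_zero.1 hx

end TubeCR

end Multiplier

/-! ### The tangential Cauchy-Riemann operator and its formal adjoint on test functions -/

section FormalAdjoint

open Filter Topology FourierTransform

variable {d : ℕ}

lemma wirtingerDbar_exp_sum_norm_sq (c : ℝ) (j : Fin d) (z : Fin d → ℂ) :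
    wirtingerDbar j (fun z : Fin d → ℂ => ((Real.exp (c * ∑ j, ‖z j‖ ^ 2) : ℝ) : ℂ)) z
      = c * ((Real.exp (c * ∑ j, ‖z j‖ ^ 2) : ℝ) : ℂ) * z j := by
  have h1 : HasDerivAt (fun x : ℝ => Real.exp (c * x))
      (c * Real.exp (c * ∑ j, ‖z j‖ ^ 2)) (∑ j, ‖z j‖ ^ 2) := by
    refine (((hasDerivAt_id _).const_mul c).exp).congr_deriv ?_
    simp [mul_comm]
  rw [wirtingerDbar_comp_real (s := fun z : Fin d → ℂ => ∑ j, ‖z j‖ ^ 2) j h1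
    (contDiff_sum_norm_sq.differentiable (by simp) z), wirtingerDbar_sum_norm_sq]
  push_cast; ring

lemma wirtingerD_exp_sum_norm_sq (c : ℝ) (j : Fin d) (z : Fin d → ℂ) :
    wirtingerD j (fun z : Fin d → ℂ => ((Real.exp (c * ∑ j, ‖z j‖ ^ 2) : ℝ) : ℂ)) z
      = c * ((Real.exp (c * ∑ j, ‖z j‖ ^ 2) : ℝ) : ℂ) * conj (z j) := by
  rw [← conj_wirtingerDbar_ofReal, wirtingerDbar_exp_sum_norm_sq, map_mul, map_mul,
    Complex.conj_ofReal, Complex.conj_ofReal]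

lemma contDiff_exp_sum_norm_sq (c : ℝ) :
    ContDiff ℝ ∞ fun z : Fin d → ℂ => ((Real.exp (c * ∑ j, ‖z j‖ ^ 2) : ℝ) : ℂ) :=
  (Real.contDiff_exp.comp (contDiff_const.mul contDiff_sum_norm_sq)).ofReal_comp

namespace TubeCR

variable (X : TubeCR d)

lemma contDiffOn_wirtingerDbar_weight (j : Fin d) :
    ContDiffOn ℝ ∞ (wirtingerDbar j fun z => (X.weight z : ℂ)) X.base :=
  X.contDiffOn_weight.ofReal_comp.wirtingerDbar X.isOpen_base (by simp) j

/-- The product of a test function on `X` with a smooth function on the base is smooth. -/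
lemma contDiff_fst_mul {a : (Fin d → ℂ) → ℂ} (ha : ContDiffOn ℝ ∞ a X.base)
    {u : (Fin d → ℂ) × ℝ → ℂ} (hu : ContDiff ℝ ∞ u) (hs : tsupport u ⊆ X.carrier) :
    ContDiff ℝ ∞ fun x => a x.1 * u x := by
  refine ContDiffOn.contDiff_of_eventually_zero (s := X.carrier) ?_ X.carrier.isOpen
    fun x hx => ?_
  · exact (ha.comp contDiff_fst.contDiffOn fun x hx => hx.1).mul hu.contDiffOn
  · filter_upwards [notMem_tsupport_iff_eventuallyEq.1 fun h => hx (hs h)] with y hy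
    simp [hy]

lemma fderiv_apply_eq_zero {u : (Fin d → ℂ) × ℝ → ℂ} {x : (Fin d → ℂ) × ℝ} (h : x ∉ tsupport u)
    (v : (Fin d → ℂ) × ℝ) : fderiv ℝ u x v = 0 :=
  image_eq_zero_of_notMem_tsupport (f := fun x => fderiv ℝ u x v) fun h2 =>
    h (tsupport_fderiv_apply_subset ℝ v h2)

lemma contDiff_fderiv_apply {u : (Fin d → ℂ) × ℝ → ℂ} (hu : ContDiff ℝ ∞ u)
    (v : (Fin d → ℂ) × ℝ) : ContDiff ℝ ∞ fun x => fderiv ℝ u x v :=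
  (hu.fderiv_right (m := ∞) (by simp)).clm_apply contDiff_const

lemma contDiff_Zbar (u : 𝓓(X.carrier, ℂ)) (j : Fin d) : ContDiff ℝ ∞ (X.Zbar j u) := by
  have h := contDiff_fderiv_apply u.contDiff
  have h2 := X.contDiff_fst_mul (X.contDiffOn_wirtingerDbar_weight j) (h (0, 1))
    ((tsupport_fderiv_apply_subset ℝ _).trans u.tsupport_subset)
  have e : X.Zbar j u = fun x => (fderiv ℝ u x (Pi.single j 1, 0)
      + Complex.I * fderiv ℝ u x (Pi.single j Complex.I, 0)) / 2
        - Complex.I * (wirtingerDbar j (fun z => (X.weight z : ℂ)) x.1 * fderiv ℝ u x (0, 1)) := by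
    funext x; simp only [Zbar]; ring
  rw [e]
  exact (((h _).add (contDiff_const.mul (h _))).div_const _).sub (contDiff_const.mul h2)

lemma tsupport_Zbar_subset (u : (Fin d → ℂ) × ℝ → ℂ) (j : Fin d) :
    tsupport (X.Zbar j u) ⊆ tsupport u := by
  refine closure_minimal (fun x hx => ?_) (isClosed_tsupport u)
  by_contra h
  have h' : ∀ v, fderiv ℝ u x v = 0 := fderiv_apply_eq_zero h
  exact hx (by simp [Zbar, h'])

/-- `Z̄_j u` as a test function. -/
def ZbarTest (j : Fin d) (u : 𝓓(X.carrier, ℂ)) : 𝓓(X.carrier, ℂ) :=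
  ⟨X.Zbar j u, X.contDiff_Zbar u j, X.hasCompactSupport_Zbar u j,
    (X.tsupport_Zbar_subset u j).trans u.tsupport_subset⟩

lemma ZbarTest_coe (j : Fin d) (u : 𝓓(X.carrier, ℂ)) : ⇑(X.ZbarTest j u) = X.Zbar j u := rfl

lemma fderiv_fst_mul_snd {a : (Fin d → ℂ) → ℂ} {u : (Fin d → ℂ) × ℝ → ℂ}
    {x : (Fin d → ℂ) × ℝ} (hu : DifferentiableAt ℝ u x)
    (hau : DifferentiableAt ℝ (fun x => a x.1 * u x) x) :
    fderiv ℝ (fun x => a x.1 * u x) x (0, 1) = a x.1 * fderiv ℝ u x (0, 1) := by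
  have hl : HasDerivAt (fun t : ℝ => (x.1, t)) ((0, 1) : (Fin d → ℂ) × ℝ) x.2 :=
    (hasDerivAt_const x.2 x.1).prodMk (hasDerivAt_id x.2)
  have h1 : HasDerivAt (fun t : ℝ => a x.1 * u (x.1, t))
      (fderiv ℝ (fun x => a x.1 * u x) x (0, 1)) x.2 :=
    HasFDerivAt.comp_hasDerivAt (f := fun t : ℝ => (x.1, t)) x.2 hau.hasFDerivAt hl
  have h2 : HasDerivAt (fun t : ℝ => u (x.1, t)) (fderiv ℝ u x (0, 1)) x.2 :=
    HasFDerivAt.comp_hasDerivAt (f := fun t : ℝ => (x.1, t)) x.2 hu.hasFDerivAt hl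
  exact h1.unique (h2.const_mul (a x.1))

lemma setIntegral_carrier_eq {f : (Fin d → ℂ) × ℝ → ℂ} (u : 𝓓(X.carrier, ℂ))
    (h : ∀ x, u x = 0 → f x = 0) : ∫ x in (X.carrier : Set _), f x = ∫ x, f x :=
  setIntegral_eq_integral_of_forall_compl_eq_zero fun x hx =>
    h x (image_eq_zero_of_notMem_tsupport fun h => hx (u.tsupport_subset h))

/-- Integration by parts for `Z̄_j`. -/
lemma integral_Zbar_mul (u φ : 𝓓(X.carrier, ℂ)) (j : Fin d) :
    ∫ x, X.Zbar j u x * φ x = -∫ x, u x * X.Zbar j φ x := by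
  have h1 : ContDiff ℝ 1 u := u.contDiff.of_le (by simp)
  have h2 : ContDiff ℝ 1 φ := φ.contDiff.of_le (by simp)
  set a : (Fin d → ℂ) → ℂ := wirtingerDbar j fun z => (X.weight z : ℂ) with ha
  have hau : ContDiff ℝ 1 fun x => a x.1 * u x :=
    (X.contDiff_fst_mul (X.contDiffOn_wirtingerDbar_weight j) u.contDiff u.tsupport_subset).of_le
      (by simp)
  have hauc : HasCompactSupport fun x => a x.1 * u x := u.hasCompactSupport.mul_left
  have : (volume : Measure ((Fin d → ℂ) × ℝ)).IsAddHaarMeasure := by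
    rw [Measure.volume_eq_prod]; exact Measure.prod.instIsAddHaarMeasure _ _
  have ibp : ∀ v, ∫ x, u x * fderiv ℝ φ x v = -∫ x, fderiv ℝ u x v * φ x := fun v =>
    integral_mul_fderiv_of_hasCompactSupport h1 h2 u.hasCompactSupport v
  have ibp' := integral_mul_fderiv_of_hasCompactSupport (μ := volume) hau h2 hauc (0, 1)
  have e0 : ∀ x, fderiv ℝ (fun x => a x.1 * u x) x (0, 1) = a x.1 * fderiv ℝ u x (0, 1) :=
    fun x => fderiv_fst_mul_snd (h1.differentiable (by simp) x) (hau.differentiable (by simp) x)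
  simp only [e0] at ibp'
  have c1 : ∀ v, Continuous fun x => fderiv ℝ u x v := fun v =>
    (contDiff_fderiv_apply u.contDiff v).continuous
  have c2 : ∀ v, Continuous fun x => fderiv ℝ φ x v := fun v =>
    (contDiff_fderiv_apply φ.contDiff v).continuous
  have i1 : ∀ v, Integrable fun x => u x * fderiv ℝ φ x v := fun v =>
    (u.continuous.mul (c2 v)).integrable_of_hasCompactSupport u.hasCompactSupport.mul_right
  have i2 : ∀ v, Integrable fun x => fderiv ℝ u x v * φ x := fun v =>
    ((c1 v).mul φ.continuous).integrable_of_hasCompactSupport φ.hasCompactSupport.mul_left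
  have i3 : Integrable fun x => a x.1 * u x * fderiv ℝ φ x (0, 1) :=
    (hau.continuous.mul (c2 _)).integrable_of_hasCompactSupport hauc.mul_right
  have i4 : Integrable fun x => a x.1 * fderiv ℝ u x (0, 1) * φ x := by
    simp only [← e0]
    exact (((hau.continuous_fderiv (by simp)).clm_apply continuous_const).mul
      φ.continuous).integrable_of_hasCompactSupport φ.hasCompactSupport.mul_left
  have e1 : ∀ x, X.Zbar j u x * φ x = 2⁻¹ * (fderiv ℝ u x (Pi.single j 1, 0) * φ x
      + Complex.I * (fderiv ℝ u x (Pi.single j Complex.I, 0) * φ x))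
        - Complex.I * (a x.1 * fderiv ℝ u x (0, 1) * φ x) := fun x => by
    simp only [Zbar, ha]; ring
  have e2 : ∀ x, u x * X.Zbar j φ x = 2⁻¹ * (u x * fderiv ℝ φ x (Pi.single j 1, 0)
      + Complex.I * (u x * fderiv ℝ φ x (Pi.single j Complex.I, 0)))
        - Complex.I * (a x.1 * u x * fderiv ℝ φ x (0, 1)) := fun x => by
    simp only [Zbar, ha]; ring
  simp_rw [e1, e2]
  rw [integral_sub (((i2 _).fun_add ((i2 _).const_mul _)).const_mul _) (i4.const_mul _),
    integral_sub (((i1 _).fun_add ((i1 _).const_mul _)).const_mul _) (i3.const_mul _),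
    integral_const_mul, integral_const_mul, integral_const_mul, integral_const_mul,
    integral_add (i1 _) ((i1 _).const_mul _), integral_add (i2 _) ((i2 _).const_mul _),
    integral_const_mul, integral_const_mul, ibp, ibp, ibp']
  ring

lemma Zbar_mul {u v : (Fin d → ℂ) × ℝ → ℂ} {x : (Fin d → ℂ) × ℝ} (j : Fin d)
    (hu : DifferentiableAt ℝ u x) (hv : DifferentiableAt ℝ v x) :
    X.Zbar j (fun y => u y * v y) x = u x * X.Zbar j v x + v x * X.Zbar j u x := by
  simp only [Zbar, fderiv_fun_mul hu hv, _root_.add_apply, _root_.smul_apply, smul_eq_mul]; ring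

/-- On functions of `z` alone, `Z̄_j` is `∂/∂z̄_j`. -/
lemma Zbar_comp_fst {a : (Fin d → ℂ) → ℂ} {x : (Fin d → ℂ) × ℝ} (j : Fin d)
    (ha : DifferentiableAt ℝ a x.1) : X.Zbar j (fun y => a y.1) x = wirtingerDbar j a x.1 := by
  have h : fderiv ℝ (fun y : (Fin d → ℂ) × ℝ => a y.1) x
      = (fderiv ℝ a x.1).comp (ContinuousLinearMap.fst ℝ (Fin d → ℂ) ℝ) :=
    (ha.hasFDerivAt.comp x hasFDerivAt_fst).fderiv
  simp [Zbar, wirtingerDbar, h]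

/-- The vector field `Z_j`, as the conjugate of `Z̄_j`. -/
lemma conj_Zbar_conj (u : (Fin d → ℂ) × ℝ → ℂ) (j : Fin d) (x : (Fin d → ℂ) × ℝ) :
    conj (X.Zbar j (fun y => conj (u y)) x)
      = (fderiv ℝ u x (Pi.single j 1, 0) - Complex.I * fderiv ℝ u x (Pi.single j Complex.I, 0)) / 2
        + Complex.I * wirtingerD j (fun z => (X.weight z : ℂ)) x.1 * fderiv ℝ u x (0, 1) := by
  have h : fderiv ℝ (fun w => conj (u w)) x = (Complex.conjCLE : ℂ →L[ℝ] ℂ).comp (fderiv ℝ u x) :=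
    Complex.conjCLE.comp_fderiv
  simp only [Zbar, h]
  simp [conj_wirtingerDbar_ofReal, map_ofNat, sub_eq_add_neg]

/-- The test function `e^{-2|z|²} φ̄`. -/
def weightedConj (ψ : 𝓓(X.carrier, ℂ)) : 𝓓(X.carrier, ℂ) :=
  ⟨fun x => ((Real.exp (-2 * ∑ j, ‖x.1 j‖ ^ 2) : ℝ) : ℂ) * conj (ψ x),
    ((contDiff_exp_sum_norm_sq (-2)).comp contDiff_fst).mul ψ.contDiff.conj_comp,
    ψ.hasCompactSupport.conj_comp.mul_left,
    (closure_mono fun x hx => by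
      by_contra h
      exact hx (by simp [Function.notMem_support.1 h])).trans ψ.tsupport_subset⟩

/-- The formal adjoint `-∑_j (Z_j - 2 z̄_j) ψ_j` of `∂̄_b` in the weighted space `L²(X)`. -/
def formalAdjointFun (ψ : Fin d → 𝓓(X.carrier, ℂ)) (x : (Fin d → ℂ) × ℝ) : ℂ :=
  -∑ j, (conj (X.Zbar j (fun y => conj (ψ j y)) x) - 2 * conj (x.1 j) * ψ j x)

lemma density_mul_conj_formalAdjointFun (ψ : Fin d → 𝓓(X.carrier, ℂ)) (x : (Fin d → ℂ) × ℝ) :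
    (density x : ℂ) * conj (X.formalAdjointFun ψ x)
      = -∑ j, X.Zbar j (X.weightedConj (ψ j)) x := by
  rw [formalAdjointFun, map_neg, mul_neg, map_sum, Finset.mul_sum]
  refine congrArg Neg.neg (Finset.sum_congr rfl fun j _ => ?_)
  have hd : DifferentiableAt ℝ (fun z : Fin d → ℂ =>
      ((Real.exp (-2 * ∑ j, ‖z j‖ ^ 2) : ℝ) : ℂ)) x.1 :=
    (contDiff_exp_sum_norm_sq (-2)).differentiable (by simp) x.1
  have hψ : DifferentiableAt ℝ (fun y => conj (ψ j y)) x :=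
    (ψ j).contDiff.conj_comp.differentiable (by simp) x
  have e : X.Zbar j (X.weightedConj (ψ j)) x = X.Zbar j (fun y =>
      ((Real.exp (-2 * ∑ j, ‖y.1 j‖ ^ 2) : ℝ) : ℂ) * conj (ψ j y)) x := rfl
  rw [e, Zbar_mul X j (u := fun y : (Fin d → ℂ) × ℝ =>
      ((Real.exp (-2 * ∑ j, ‖y.1 j‖ ^ 2) : ℝ) : ℂ)) (hd.comp x differentiableAt_fst) hψ,
    Zbar_comp_fst X (a := fun z => ((Real.exp (-2 * ∑ j, ‖z j‖ ^ 2) : ℝ) : ℂ)) j hd,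
    wirtingerDbar_exp_sum_norm_sq]
  simp only [map_sub, map_mul, Complex.conj_conj, density, map_ofNat]
  push_cast
  ring

/-- The formal adjoint of `∂̄_b` on test forms, with values in the test functions. -/
def formalAdjoint : (Fin d → 𝓓(X.carrier, ℂ)) →ₗ[ℂ] 𝓓(X.carrier, ℂ) where
  toFun ψ := ⟨X.formalAdjointFun ψ,
    (ContDiff.sum fun j _ => ((X.ZbarTest j (X.conjTest (ψ j))).contDiff.conj_comp).sub
      ((contDiff_const.mul (((contDiff_apply ℝ ℂ j).comp contDiff_fst).conj_comp)).mul
        (ψ j).contDiff)).neg,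
    by
      refine HasCompactSupport.intro (isCompact_iUnion fun j => (ψ j).hasCompactSupport.isCompact)
        fun x hx => ?_
      rw [formalAdjointFun, Finset.sum_eq_zero, neg_zero]
      intro j _
      have hj : x ∉ tsupport (ψ j) := fun h => hx (mem_iUnion.2 ⟨j, h⟩)
      have h' : ∀ v, fderiv ℝ (ψ j) x v = 0 := fderiv_apply_eq_zero hj
      rw [conj_Zbar_conj, h', h', h', image_eq_zero_of_notMem_tsupport hj]
      simp,
    by
      refine (closure_minimal (fun x hx => ?_)
        (isClosed_iUnion_of_finite fun j => isClosed_tsupport (ψ j))).trans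
          (iUnion_subset fun j => (ψ j).tsupport_subset)
      by_contra hx'
      refine hx ?_
      rw [formalAdjointFun, Finset.sum_eq_zero, neg_zero]
      intro j _
      have hj : x ∉ tsupport (ψ j) := fun h => hx' (mem_iUnion.2 ⟨j, h⟩)
      have h' : ∀ v, fderiv ℝ (ψ j) x v = 0 := fderiv_apply_eq_zero hj
      rw [conj_Zbar_conj, h', h', h', image_eq_zero_of_notMem_tsupport hj]
      simp⟩
  map_add' ψ χ := by
    ext x
    change X.formalAdjointFun (ψ + χ) x = X.formalAdjointFun ψ x + X.formalAdjointFun χ x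
    simp only [formalAdjointFun, ← neg_add, ← Finset.sum_add_distrib]
    refine congrArg Neg.neg (Finset.sum_congr rfl fun j _ => ?_)
    have e : ⇑((ψ + χ) j) = fun y => ψ j y + χ j y := rfl
    simp only [conj_Zbar_conj, e]
    rw [fderiv_fun_add ((ψ j).contDiff.differentiable (by simp) x)
      ((χ j).contDiff.differentiable (by simp) x)]
    simp only [_root_.add_apply]
    ring
  map_smul' c ψ := by
    ext x
    change X.formalAdjointFun (c • ψ) x = c * X.formalAdjointFun ψ x
    simp only [formalAdjointFun, mul_neg, Finset.mul_sum]
    refine congrArg Neg.neg (Finset.sum_congr rfl fun j _ => ?_)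
    have e : ⇑((c • ψ) j) = fun y => c * ψ j y := rfl
    simp only [conj_Zbar_conj, e]
    rw [fderiv_const_mul ((ψ j).contDiff.differentiable (by simp) x)]
    simp only [_root_.smul_apply, smul_eq_mul]
    ring

lemma formalAdjoint_apply (ψ : Fin d → 𝓓(X.carrier, ℂ)) (x : (Fin d → ℂ) × ℝ) :
    X.formalAdjoint ψ x = X.formalAdjointFun ψ x := rfl

/-- The `(0,1)` form with coefficients `ψ_j`, in `L²_{(0,1)}(X)`. -/
def testForm (ψ : Fin d → 𝓓(X.carrier, ℂ)) : X.L2Form :=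
  (show MemLp (fun x => WithLp.toLp 2 fun j => ψ j x) 2 X.measure from
    Continuous.memLp_of_hasCompactSupport
      ((PiLp.continuous_toLp 2 _).comp (continuous_pi fun j => (ψ j).continuous))
      (HasCompactSupport.intro (isCompact_iUnion fun j => (ψ j).hasCompactSupport.isCompact)
        fun x hx => by
          ext j
          exact image_eq_zero_of_notMem_tsupport (f := ψ j) fun h => hx (mem_iUnion.2 ⟨j, h⟩))).toLp

lemma coeFn_testForm (ψ : Fin d → 𝓓(X.carrier, ℂ)) :
    X.testForm ψ =ᵐ[X.measure] fun x => WithLp.toLp 2 fun j => ψ j x := MemLp.coeFn_toLp _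

lemma integral_measure (f : (Fin d → ℂ) × ℝ → ℂ) :
    ∫ x, f x ∂X.measure = ∫ x in (X.carrier : Set _), (density x : ℂ) * f x := by
  have hm : Measurable fun x : (Fin d → ℂ) × ℝ => ENNReal.ofReal (density x) :=
    (continuous_density.measurable).ennreal_ofReal
  rw [measure, restrict_withDensity X.carrier.isOpen.measurableSet,
    integral_withDensity_eq_integral_toReal_smul hm (by simp)]
  refine integral_congr_ae (.of_forall fun z => ?_)
  simp only [ENNReal.toReal_ofReal (density_pos z).le, Complex.real_smul]

lemma inner_testForm (ψ : Fin d → 𝓓(X.carrier, ℂ)) (f : X.L2Form) :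
    inner ℂ (X.testForm ψ) f
      = ∑ j, ∫ x in (X.carrier : Set _), f x j * X.weightedConj (ψ j) x := by
  have e : inner ℂ (X.testForm ψ) f = ∫ x, ∑ j, f x j * conj (ψ j x) ∂X.measure := by
    rw [L2.inner_def]
    refine integral_congr_ae ?_
    filter_upwards [X.coeFn_testForm ψ] with x hx
    rw [hx, PiLp.inner_apply]
    simp
  rw [e, integral_measure, ← integral_finsetSum _ fun j _ => X.integrableOn_form_mul f _ j]
  refine integral_congr_ae (.of_forall fun x => ?_)
  simp only [Finset.mul_sum]
  refine Finset.sum_congr rfl fun j _ => ?_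
  change _ = f x j * (((Real.exp (-2 * ∑ j, ‖x.1 j‖ ^ 2) : ℝ) : ℂ) * conj (ψ j x))
  rw [density]; ring

lemma inner_toL2_formalAdjoint (ψ : Fin d → 𝓓(X.carrier, ℂ)) (u : X.L2) :
    inner ℂ (X.toL2 (X.formalAdjoint ψ)) u
      = -∑ j, ∫ x in (X.carrier : Set _), u x * X.Zbar j (X.weightedConj (ψ j)) x := by
  rw [inner_toL2_left, integral_measure,
    ← integral_finsetSum _ fun j _ => X.integrableOn_mul_Zbar u _ j, ← integral_neg]
  refine integral_congr_ae (.of_forall fun x => ?_)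
  simp only [formalAdjoint_apply]
  rw [mul_left_comm, density_mul_conj_formalAdjointFun, mul_neg, Finset.mul_sum]

/-- The defining property of the formal adjoint, tested against the weak `∂̄_b`. -/
lemma inner_testForm_of_isWeakDbar {u : X.L2} {f : X.L2Form} (h : X.IsWeakDbar u f)
    (ψ : Fin d → 𝓓(X.carrier, ℂ)) :
    inner ℂ (X.testForm ψ) f = inner ℂ (X.toL2 (X.formalAdjoint ψ)) u := by
  rw [inner_testForm, inner_toL2_formalAdjoint, ← Finset.sum_neg_distrib]
  exact Finset.sum_congr rfl fun j _ => h _ j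

/-- A function is annihilated by `∂̄_b` as soon as it is orthogonal to the range of the formal
adjoint. -/
lemma isWeakDbar_zero {u : X.L2} (h : ∀ ψ, inner ℂ (X.toL2 (X.formalAdjoint ψ)) u = 0) :
    X.IsWeakDbar u 0 := by
  intro φ j
  classical
  -- the test form whose only coefficient `χ` satisfies `e^{-2|z|²} χ̄ = φ`
  set χ : 𝓓(X.carrier, ℂ) :=
    ⟨fun x => ((Real.exp (2 * ∑ j, ‖x.1 j‖ ^ 2) : ℝ) : ℂ) * conj (φ x),
      ((contDiff_exp_sum_norm_sq 2).comp contDiff_fst).mul φ.contDiff.conj_comp,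
      φ.hasCompactSupport.conj_comp.mul_left,
      (closure_mono fun x hx => by
        by_contra h
        exact hx (by simp [Function.notMem_support.1 h])).trans φ.tsupport_subset⟩ with hχ
  have hχφ : ⇑(X.weightedConj χ) = φ := by
    funext x
    change ((Real.exp (-2 * ∑ j, ‖x.1 j‖ ^ 2) : ℝ) : ℂ)
      * conj (((Real.exp (2 * ∑ j, ‖x.1 j‖ ^ 2) : ℝ) : ℂ) * conj (φ x)) = φ x
    rw [map_mul, Complex.conj_ofReal, Complex.conj_conj, ← mul_assoc, ← Complex.ofReal_mul,
      ← Real.exp_add]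
    simp
  have h1 := h (Pi.single j χ)
  rw [inner_toL2_formalAdjoint, neg_eq_zero, Finset.sum_eq_single j] at h1
  · rw [Pi.single_eq_same, hχφ] at h1
    rw [h1, neg_zero]
    refine integral_eq_zero_of_ae ?_
    filter_upwards [X.ae_carrier.1 (Lp.coeFn_zero (EuclideanSpace ℂ (Fin d)) 2 X.measure)] with x hx
    rw [hx]; simp
  · intro k _ hk
    refine integral_eq_zero_of_ae (.of_forall fun x => ?_)
    have e : ⇑(X.weightedConj ((Pi.single j χ : Fin d → 𝓓(X.carrier, ℂ)) k)) = fun _ => 0 := by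
      rw [Pi.single_eq_of_ne hk]
      funext x
      change _ * conj (0 : ℂ) = 0
      simp
    rw [e]
    simp [Zbar]
  · simp

/-- `∂̄_b u` for a test function, as an `L²` form. -/
lemma isWeakDbar_toL2 (u : 𝓓(X.carrier, ℂ)) :
    X.IsWeakDbar (X.toL2 u) (X.testForm fun j => X.ZbarTest j u) := by
  intro φ j
  have e1 : ∫ x in (X.carrier : Set _), X.testForm (fun j => X.ZbarTest j u) x j * φ x
      = ∫ x in (X.carrier : Set _), X.Zbar j u x * φ x := by
    refine integral_congr_ae ?_
    filter_upwards [X.ae_carrier.1 (X.coeFn_testForm fun j => X.ZbarTest j u)] with x hx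
    rw [hx]; rfl
  have e2 : ∫ x in (X.carrier : Set _), X.toL2 u x * X.Zbar j φ x
      = ∫ x in (X.carrier : Set _), u x * X.Zbar j φ x := by
    refine integral_congr_ae ?_
    filter_upwards [X.ae_carrier.1 (X.toL2_coeFn u)] with x hx
    rw [hx]
  rw [e1, e2, X.setIntegral_carrier_eq φ (fun x hx => by rw [hx, mul_zero]),
    X.setIntegral_carrier_eq u (fun x hx => by rw [hx, zero_mul]), integral_Zbar_mul]

end TubeCR

end FormalAdjoint

/-! ### The `L²` estimate at a fixed frequency -/

section Fibre

open Filter Topology FourierTransform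

variable {d : ℕ}

/-- The estimate `norm_integral_twistedDbar_sq_le_of_psh` after integration by parts. -/
lemma norm_integral_mul_conj_sum_twistedD_sq_le {Γ : Set (Fin d → ℂ)} {μ : (Fin d → ℂ) → ℝ}
    (hΓ : Γ = univ ∨ IsBoundedStrictlyPseudoconvexDomain Γ) (hμ : ContDiffOn ℝ 2 μ Γ)
    (hpsh : ∀ z ∈ Γ, (leviMatrix μ z).PosSemidef) {η : ℝ} (hη : 0 ≤ η)
    {u : (Fin d → ℂ) → ℂ} {g : Fin d → (Fin d → ℂ) → ℂ} (hu : ContDiff ℝ 2 u)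
    (huc : HasCompactSupport u) (huΓ : tsupport u ⊆ Γ) (hg : ∀ j, ContDiff ℝ 2 (g j))
    (hgc : ∀ j, HasCompactSupport (g j)) (hgΓ : ∀ j, tsupport (g j) ⊆ Γ) :
    ‖∫ z, u z * conj (∑ j, twistedD (fun z => η * μ z + ∑ j, ‖z j‖ ^ 2) j (g j) z)‖ ^ 2
      ≤ 2 * (∑ j, ∫ z, ‖twistedDbar (fun z => η * μ z + ∑ j, ‖z j‖ ^ 2) j u z‖ ^ 2)
        * ∫ z, ‖∑ j, twistedD (fun z => η * μ z + ∑ j, ‖z j‖ ^ 2) j (g j) z‖ ^ 2 := by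
  have h2 : (2 : WithTop ℕ∞) ≤ ((⊤ : ℕ∞) : WithTop ℕ∞) :=
    WithTop.coe_le_coe.2 (le_top : (2 : ℕ∞) ≤ ⊤)
  have hΓo : IsOpen Γ := by
    rcases hΓ with rfl | h
    · exact isOpen_univ
    · exact h.1
  refine le_of_eq_of_le ?_ (norm_integral_twistedDbar_sq_le_of_psh hΓ hμ hpsh hη hu huc huΓ hg hgc
    hgΓ)
  -- the weight can be replaced by one which is smooth on the whole space
  set ψ : (Fin d → ℂ) → ℝ := fun z => η * μ z + ∑ j, ‖z j‖ ^ 2 with hψ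
  have hψc : ContDiffOn ℝ 2 ψ Γ :=
    (contDiffOn_const.mul hμ).add (contDiff_sum_norm_sq.of_le h2).contDiffOn
  have hKc : IsCompact (tsupport u ∪ ⋃ j, tsupport (g j)) :=
    huc.isCompact.union (isCompact_iUnion fun j => (hgc j).isCompact)
  obtain ⟨β, hβ, -, hβ1, hβΓ⟩ := exists_smooth_cutoff hKc.isClosed hΓo
    (union_subset huΓ (iUnion_subset hgΓ))
  set φ : (Fin d → ℂ) → ℝ := fun z => β z * ψ z with hφdef
  have hφ : ContDiff ℝ 1 φ := by
    refine ContDiff.of_le (n := 2) (ContDiffOn.contDiff_of_eventually_zero (s := Γ) ?_ hΓo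
      fun z hz => ?_) (by norm_num)
    · exact (hβ.of_le h2).contDiffOn.mul hψc
    · filter_upwards [notMem_tsupport_iff_eventuallyEq.1 fun h => hz (hβΓ h)] with y hy
      simp [hφdef, hy]
  have hφK : ∀ z ∈ tsupport u ∪ ⋃ j, tsupport (g j), φ =ᶠ[𝓝 z] ψ := fun z hz => by
    filter_upwards [hβ1 z hz] with y hy
    simp [hφdef, hy]
  have e1 : ∀ j, twistedDbar ψ j u = twistedDbar φ j u := fun j =>
    (twistedDbar_congr_of_tsupport (fun z hz => hφK z (Or.inl hz)) j).symm
  have e2 : ∀ j, twistedD ψ j (g j) = twistedD φ j (g j) := fun j =>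
    (twistedD_congr_of_tsupport (fun z hz => hφK z (Or.inr (mem_iUnion.2 ⟨j, hz⟩))) j).symm
  have hu1 : ContDiff ℝ 1 u := hu.of_le (by norm_num)
  have hg1 : ∀ j, ContDiff ℝ 1 (g j) := fun j => (hg j).of_le (by norm_num)
  simp only [e1, e2]
  simp_rw [integral_twistedDbar_mul_conj hφ hu1 (hg1 _) (hgc _)]
  rw [Finset.sum_neg_distrib, norm_neg, ← integral_finsetSum]
  · simp only [map_sum, Finset.mul_sum]
  · exact fun j _ => integrable_mul_conj hu1.continuous (continuous_twistedD (hg1 j) hφ j) huc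

lemma wirtingerDbar_gauge {μ : (Fin d → ℂ) → ℝ} {z : Fin d → ℂ} (hμ : DifferentiableAt ℝ μ z)
    (η : ℝ) (j : Fin d) : wirtingerDbar j (fun z => ((η * μ z + ∑ j, ‖z j‖ ^ 2 : ℝ) : ℂ)) z
      = η * wirtingerDbar j (fun z => (μ z : ℂ)) z + z j := by
  have h1 : DifferentiableAt ℝ (fun z => (μ z : ℂ)) z :=
    Complex.ofRealCLM.differentiableAt.comp z hμ
  have h2 : DifferentiableAt ℝ (fun z : Fin d → ℂ => ((∑ j, ‖z j‖ ^ 2 : ℝ) : ℂ)) z :=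
    contDiff_sum_norm_sq.ofReal_comp.differentiable (by simp) z
  have e : (fun z => ((η * μ z + ∑ j, ‖z j‖ ^ 2 : ℝ) : ℂ))
      = fun z => (η : ℂ) * (μ z : ℂ) + ((∑ j, ‖z j‖ ^ 2 : ℝ) : ℂ) := by
    funext z; push_cast; rfl
  rw [e, wirtingerDbar_add j (h1.const_mul _) h2, wirtingerDbar_const_mul j _ h1,
    wirtingerDbar_sum_norm_sq]

lemma twistedDbar_exp_mul {μ : (Fin d → ℂ) → ℝ} {f : (Fin d → ℂ) → ℂ} {z : Fin d → ℂ}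
    (hμ : DifferentiableAt ℝ μ z) (hf : DifferentiableAt ℝ f z) (η : ℝ) (j : Fin d) :
    twistedDbar (fun z => η * μ z + ∑ j, ‖z j‖ ^ 2) j
        (fun z => ((Real.exp (-1 * ∑ j, ‖z j‖ ^ 2) : ℝ) : ℂ) * f z) z
      = ((Real.exp (-1 * ∑ j, ‖z j‖ ^ 2) : ℝ) : ℂ)
        * (wirtingerDbar j f z + η * wirtingerDbar j (fun z => (μ z : ℂ)) z * f z) := by
  rw [twistedDbar, wirtingerDbar_gauge hμ, wirtingerDbar_mul j
    ((contDiff_exp_sum_norm_sq (-1)).differentiable (by simp) z) hf, wirtingerDbar_exp_sum_norm_sq]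
  push_cast; ring

lemma twistedD_exp_mul {μ : (Fin d → ℂ) → ℝ} {f : (Fin d → ℂ) → ℂ} {z : Fin d → ℂ}
    (hμ : DifferentiableAt ℝ μ z) (hf : DifferentiableAt ℝ f z) (η : ℝ) (j : Fin d) :
    twistedD (fun z => η * μ z + ∑ j, ‖z j‖ ^ 2) j
        (fun z => ((Real.exp (-1 * ∑ j, ‖z j‖ ^ 2) : ℝ) : ℂ) * f z) z
      = ((Real.exp (-1 * ∑ j, ‖z j‖ ^ 2) : ℝ) : ℂ)
        * (wirtingerD j f z - η * wirtingerD j (fun z => (μ z : ℂ)) z * f z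
          - 2 * conj (z j) * f z) := by
  rw [twistedD, ← conj_wirtingerDbar_ofReal, wirtingerDbar_gauge hμ, wirtingerD_mul j
    ((contDiff_exp_sum_norm_sq (-1)).differentiable (by simp) z) hf, wirtingerD_exp_sum_norm_sq,
    map_add, map_mul, Complex.conj_ofReal, conj_wirtingerDbar_ofReal]
  push_cast; ring

namespace TubeCR

variable (X : TubeCR d)

lemma partialFourier_sum {E : Type} [NormedAddCommGroup E] [NormedSpace ℝ E] {ι : Type}
    {s : Finset ι} {f : ι → E × ℝ → ℂ} {x : E × ℝ}
    (hf : ∀ i ∈ s, Integrable fun t => f i (x.1, t)) :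
    partialFourier (fun y => ∑ i ∈ s, f i y) x = ∑ i ∈ s, partialFourier (f i) x := by
  simp only [partialFourier_eq, Finset.smul_sum]
  exact integral_finsetSum _ fun i hi =>
    (Real.fourierIntegral_convergent_iff (μ := volume) (V := ℝ) x.2).2 (hf i hi)
      |>.congr (.of_forall fun t => by simp [mul_comm])

lemma integrable_fderiv_slice (u : 𝓓(X.carrier, ℂ)) (v : (Fin d → ℂ) × ℝ) (z : Fin d → ℂ) :
    Integrable fun t => fderiv ℝ u (z, t) v :=
  integrable_slice (contDiff_fderiv_apply u.contDiff v).continuous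
    (u.hasCompactSupport.fderiv_apply ℝ v) z

/-- The Fourier transform of a first order operator with coefficients depending on `z` only. -/
lemma partialFourier_fderiv_combination (u : 𝓓(X.carrier, ℂ)) (j : Fin d)
    (a b c : (Fin d → ℂ) → ℂ) (x : (Fin d → ℂ) × ℝ) :
    partialFourier (fun y => a y.1 * fderiv ℝ u y (Pi.single j 1, 0)
        + (b y.1 * fderiv ℝ u y (Pi.single j Complex.I, 0) + c y.1 * fderiv ℝ u y (0, 1))) x
      = a x.1 * fderiv ℝ (fun z => partialFourier u (z, x.2)) x.1 (Pi.single j 1)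
        + (b x.1 * fderiv ℝ (fun z => partialFourier u (z, x.2)) x.1 (Pi.single j Complex.I)
          + c x.1 * (2 * Real.pi * Complex.I * x.2 * partialFourier u x)) := by
  have hu1 : ContDiff ℝ 1 u := u.contDiff.of_le (by simp)
  have i := fun v => X.integrable_fderiv_slice u v x.1
  have h1 : partialFourier (fun y => a y.1 * fderiv ℝ u y (Pi.single j 1, 0)) x
      = a x.1 * fderiv ℝ (fun z => partialFourier u (z, x.2)) x.1 (Pi.single j 1) := by
    rw [fderiv_partialFourier_apply hu1 u.hasCompactSupport]
    exact partialFourier_mul_fst a (fun y => fderiv ℝ u y (Pi.single j 1, 0)) x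
  have h2 : partialFourier (fun y => b y.1 * fderiv ℝ u y (Pi.single j Complex.I, 0)) x
      = b x.1 * fderiv ℝ (fun z => partialFourier u (z, x.2)) x.1 (Pi.single j Complex.I) := by
    rw [fderiv_partialFourier_apply hu1 u.hasCompactSupport]
    exact partialFourier_mul_fst b (fun y => fderiv ℝ u y (Pi.single j Complex.I, 0)) x
  have h3 : partialFourier (fun y => c y.1 * fderiv ℝ u y (0, 1)) x
      = c x.1 * (2 * Real.pi * Complex.I * x.2 * partialFourier u x) := by
    rw [← smul_eq_mul (2 * Real.pi * Complex.I * x.2 : ℂ),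
      ← partialFourier_fderiv_snd hu1 u.hasCompactSupport]
    exact partialFourier_mul_fst c (fun y => fderiv ℝ u y (0, 1)) x
  rw [← h1, ← h2, ← h3]
  have s1 := partialFourier_add (x := x) (u := fun y => a y.1 * fderiv ℝ u y (Pi.single j 1, 0))
    (v := fun y => b y.1 * fderiv ℝ u y (Pi.single j Complex.I, 0) + c y.1 * fderiv ℝ u y (0, 1))
    ((i _).const_mul (a x.1)) (((i _).const_mul (b x.1)).fun_add ((i _).const_mul (c x.1)))
  have s2 := partialFourier_add (x := x)
    (u := fun y => b y.1 * fderiv ℝ u y (Pi.single j Complex.I, 0))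
    (v := fun y => c y.1 * fderiv ℝ u y (0, 1))
    ((i _).const_mul (b x.1)) ((i _).const_mul (c x.1))
  rw [s1, s2]

/-- On the Fourier side `Z̄_j` becomes `∂̄_j + η μ_{z̄_j}`, with `η = 2πξ`. -/
lemma partialFourier_Zbar (u : 𝓓(X.carrier, ℂ)) (j : Fin d) (x : (Fin d → ℂ) × ℝ) :
    partialFourier (X.Zbar j u) x = wirtingerDbar j (fun z => partialFourier u (z, x.2)) x.1
      + ((2 * Real.pi * x.2 : ℝ) : ℂ) * wirtingerDbar j (fun z => (X.weight z : ℂ)) x.1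
        * partialFourier u x := by
  have e : X.Zbar j u = fun y => (1 / 2 : ℂ) * fderiv ℝ u y (Pi.single j 1, 0)
      + (Complex.I / 2 * fderiv ℝ u y (Pi.single j Complex.I, 0)
        + -Complex.I * wirtingerDbar j (fun z => (X.weight z : ℂ)) y.1 * fderiv ℝ u y (0, 1)) := by
    funext y; simp only [Zbar]; ring
  rw [e, X.partialFourier_fderiv_combination u j (fun _ => 1 / 2) (fun _ => Complex.I / 2)
    (fun z => -Complex.I * wirtingerDbar j (fun z => (X.weight z : ℂ)) z),
    show wirtingerDbar j (fun z => partialFourier u (z, x.2)) x.1 = (_ + _) / 2 from rfl]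
  push_cast
  linear_combination (-2 * Real.pi * x.2 * wirtingerDbar j (fun z => (X.weight z : ℂ)) x.1
    * partialFourier u x) * Complex.I_mul_I

lemma partialFourier_conj_Zbar_conj (u : 𝓓(X.carrier, ℂ)) (j : Fin d) (x : (Fin d → ℂ) × ℝ) :
    partialFourier (fun y => conj (X.Zbar j (fun y => conj (u y)) y)) x
      = wirtingerD j (fun z => partialFourier u (z, x.2)) x.1
        - ((2 * Real.pi * x.2 : ℝ) : ℂ) * wirtingerD j (fun z => (X.weight z : ℂ)) x.1
          * partialFourier u x := by
  have e : (fun y => conj (X.Zbar j (fun y => conj (u y)) y))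
      = fun y => (1 / 2 : ℂ) * fderiv ℝ u y (Pi.single j 1, 0)
      + (-Complex.I / 2 * fderiv ℝ u y (Pi.single j Complex.I, 0)
        + Complex.I * wirtingerD j (fun z => (X.weight z : ℂ)) y.1 * fderiv ℝ u y (0, 1)) := by
    funext y; rw [conj_Zbar_conj]; ring
  rw [e, X.partialFourier_fderiv_combination u j (fun _ => 1 / 2) (fun _ => -Complex.I / 2)
    (fun z => Complex.I * wirtingerD j (fun z => (X.weight z : ℂ)) z),
    show wirtingerD j (fun z => partialFourier u (z, x.2)) x.1 = (_ - _) / 2 from rfl]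
  push_cast
  linear_combination (2 * Real.pi * x.2 * wirtingerD j (fun z => (X.weight z : ℂ)) x.1
    * partialFourier u x) * Complex.I_mul_I

lemma partialFourier_formalAdjoint (ψ : Fin d → 𝓓(X.carrier, ℂ)) (x : (Fin d → ℂ) × ℝ) :
    partialFourier (X.formalAdjoint ψ) x
      = -∑ j, (wirtingerD j (fun z => partialFourier (ψ j) (z, x.2)) x.1
        - ((2 * Real.pi * x.2 : ℝ) : ℂ) * wirtingerD j (fun z => (X.weight z : ℂ)) x.1
          * partialFourier (ψ j) x - 2 * conj (x.1 j) * partialFourier (ψ j) x) := by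
  have e : ⇑(X.formalAdjoint ψ) = fun y => (-1 : ℂ) * ∑ j,
      (conj (X.Zbar j (fun y => conj (ψ j y)) y) + -2 * conj (y.1 j) * ψ j y) := by
    funext y
    rw [formalAdjoint_apply, formalAdjointFun, neg_one_mul]
    refine congrArg Neg.neg (Finset.sum_congr rfl fun j _ => ?_)
    ring
  have i1 : ∀ j, Integrable fun t => conj (X.Zbar j (fun y => conj (ψ j y)) (x.1, t)) := fun j =>
    integrable_slice (u := fun y => conj (X.Zbar j (fun y => conj (ψ j y)) y))
      ((X.ZbarTest j (X.conjTest (ψ j))).contDiff.conj_comp.continuous)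
      (X.ZbarTest j (X.conjTest (ψ j))).hasCompactSupport.conj_comp x.1
  have i2 : ∀ j, Integrable fun t => -2 * conj (x.1 j) * ψ j (x.1, t) := fun j =>
    (integrable_slice (ψ j).continuous (ψ j).hasCompactSupport x.1).const_mul _
  rw [e, partialFourier_mul_fst (fun _ => (-1 : ℂ)), neg_one_mul,
    partialFourier_sum fun j _ => (i1 j).fun_add (i2 j)]
  refine congrArg Neg.neg (Finset.sum_congr rfl fun j _ => ?_)
  rw [partialFourier_add (i1 j) (i2 j), partialFourier_conj_Zbar_conj,
    partialFourier_mul_fst (fun z : Fin d → ℂ => -2 * conj (z j)) (ψ j) x]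
  ring

lemma tsupport_partialFourier_subset_base (u : 𝓓(X.carrier, ℂ)) (ξ : ℝ) :
    tsupport (fun z => partialFourier u (z, ξ)) ⊆ X.base := by
  refine (tsupport_partialFourier_subset u.hasCompactSupport ξ).trans ?_
  rintro _ ⟨x, hx, rfl⟩
  exact (u.tsupport_subset hx).1

lemma integral_baseMeasure_eq {F : Type*} [NormedAddCommGroup F] [NormedSpace ℝ F]
    {f : (Fin d → ℂ) → F} (hf : ∀ z, z ∉ X.base → f z = 0) :
    ∫ z, f z ∂X.baseMeasure = ∫ z, Real.exp (-2 * ∑ j, ‖z j‖ ^ 2) • f z := by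
  rw [integral_baseMeasure]
  exact setIntegral_eq_integral_of_forall_compl_eq_zero fun z hz => by rw [hf z hz, smul_zero]

lemma exp_sq (z : Fin d → ℂ) : Real.exp (-2 * ∑ j, ‖z j‖ ^ 2)
    = Real.exp (-1 * ∑ j, ‖z j‖ ^ 2) ^ 2 := by
  rw [← Real.exp_nat_mul]; congr 1; push_cast; ring

/-- The `L²` estimate for the Fourier transforms at a fixed frequency `ξ ≥ 0`. Multiplication by
`e^{-|z|²}` turns the weighted space into `L²(ℂ^d)` and the Fourier transforms of `Z̄_j` and of the
formal adjoint into the twisted operators for the weight `2πξ μ + |z|²`. -/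
lemma norm_integral_partialFourier_sq_le
    (hX : X.base = univ ∨ IsBoundedStrictlyPseudoconvexDomain X.base)
    (hpsh : ∀ z ∈ X.base, (leviMatrix X.weight z).PosSemidef) {ξ : ℝ} (hξ : 0 ≤ ξ)
    (u : 𝓓(X.carrier, ℂ)) (ψ : Fin d → 𝓓(X.carrier, ℂ)) :
    ‖∫ z, partialFourier u (z, ξ) * conj (partialFourier (X.formalAdjoint ψ) (z, ξ))
        ∂X.baseMeasure‖ ^ 2
      ≤ 2 * (∑ j, ∫ z, ‖partialFourier (X.Zbar j u) (z, ξ)‖ ^ 2 ∂X.baseMeasure)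
        * ∫ z, ‖partialFourier (X.formalAdjoint ψ) (z, ξ)‖ ^ 2 ∂X.baseMeasure := by
  have h2 : (2 : WithTop ℕ∞) ≤ ((⊤ : ℕ∞) : WithTop ℕ∞) :=
    WithTop.coe_le_coe.2 (le_top : (2 : ℕ∞) ≤ ⊤)
  set η : ℝ := 2 * Real.pi * ξ with hη
  have hη0 : 0 ≤ η := by positivity
  set E : (Fin d → ℂ) → ℂ := fun z => ((Real.exp (-1 * ∑ j, ‖z j‖ ^ 2) : ℝ) : ℂ) with hE
  have hEc : ContDiff ℝ 2 E := (contDiff_exp_sum_norm_sq (-1)).of_le h2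
  have hsupp : ∀ w : 𝓓(X.carrier, ℂ), ContDiff ℝ 2 (fun z => E z * partialFourier w (z, ξ)) ∧
      HasCompactSupport (fun z => E z * partialFourier w (z, ξ)) ∧
      tsupport (fun z => E z * partialFourier w (z, ξ)) ⊆ X.base := fun w =>
    ⟨hEc.mul (contDiff_partialFourier w.contDiff w.hasCompactSupport ξ 2),
      (w.hasCompactSupport.partialFourier ξ).mul_left,
      tsupport_mul_subset_right.trans (X.tsupport_partialFourier_subset_base w ξ)⟩
  have hzero : ∀ (w : 𝓓(X.carrier, ℂ)) (z), z ∉ X.base → partialFourier w (z, ξ) = 0 :=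
    fun w z hz => image_eq_zero_of_notMem_tsupport (f := fun z => partialFourier w (z, ξ))
      fun h => hz (X.tsupport_partialFourier_subset_base w ξ h)
  have hdiff : ∀ (w : 𝓓(X.carrier, ℂ)) (z),
      DifferentiableAt ℝ (fun z => partialFourier w (z, ξ)) z := fun w z =>
    (contDiff_partialFourier w.contDiff w.hasCompactSupport ξ 2).differentiable
      (by simp) z
  have hμ : ∀ z ∈ X.base, DifferentiableAt ℝ X.weight z := fun z hz =>
    (X.contDiffOn_weight.contDiffAt (X.isOpen_base.mem_nhds hz)).differentiableAt (by simp)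
  have key := norm_integral_mul_conj_sum_twistedD_sq_le hX (X.contDiffOn_weight.of_le h2) hpsh hη0
    (hsupp u).1 (hsupp u).2.1 (hsupp u).2.2 (fun j => (hsupp (ψ j)).1)
    (fun j => (hsupp (ψ j)).2.1) (fun j => (hsupp (ψ j)).2.2)
  have e1 : ∀ j z, twistedDbar (fun z => η * X.weight z + ∑ j, ‖z j‖ ^ 2) j
      (fun z => E z * partialFourier u (z, ξ)) z = E z * partialFourier (X.Zbar j u) (z, ξ) := by
    intro j z
    by_cases hz : z ∈ X.base
    · rw [twistedDbar_exp_mul (hμ z hz) (hdiff u z), partialFourier_Zbar]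
    · have h0 : partialFourier (X.Zbar j u) (z, ξ) = 0 := hzero (X.ZbarTest j u) z hz
      rw [h0, mul_zero]
      by_contra h
      exact hz ((hsupp u).2.2 (support_twistedDbar_subset _ _ _ h))
  have e2 : ∀ z, ∑ j, twistedD (fun z => η * X.weight z + ∑ j, ‖z j‖ ^ 2) j
      (fun z => E z * partialFourier (ψ j) (z, ξ)) z
        = -(E z * partialFourier (X.formalAdjoint ψ) (z, ξ)) := by
    intro z
    by_cases hz : z ∈ X.base
    · rw [partialFourier_formalAdjoint, mul_neg, neg_neg, Finset.mul_sum]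
      exact Finset.sum_congr rfl fun j _ => twistedD_exp_mul (hμ z hz) (hdiff (ψ j) z) η j
    · rw [hzero _ z hz, mul_zero, neg_zero]
      refine Finset.sum_eq_zero fun j _ => ?_
      by_contra h
      exact hz ((hsupp (ψ j)).2.2 (support_twistedD_subset _ _ _ h))
  simp only [e1, e2] at key
  have f1 : ∫ z, partialFourier u (z, ξ) * conj (partialFourier (X.formalAdjoint ψ) (z, ξ))
      ∂X.baseMeasure = -∫ z, E z * partialFourier u (z, ξ)
        * conj (-(E z * partialFourier (X.formalAdjoint ψ) (z, ξ))) := by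
    rw [integral_baseMeasure_eq X (fun z hz => by rw [hzero u z hz, zero_mul]), ← integral_neg]
    refine integral_congr_ae (.of_forall fun z => ?_)
    simp only [hE, map_neg, map_mul, Complex.conj_ofReal, Complex.real_smul, exp_sq]
    push_cast; ring
  have f2 : ∀ w : 𝓓(X.carrier, ℂ), ∫ z, ‖partialFourier w (z, ξ)‖ ^ 2 ∂X.baseMeasure
      = ∫ z, ‖E z * partialFourier w (z, ξ)‖ ^ 2 := fun w => by
    rw [integral_baseMeasure_eq X (fun z hz => by rw [hzero w z hz]; simp)]
    refine integral_congr_ae (.of_forall fun z => ?_)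
    simp only [hE, norm_mul, Complex.norm_real, Real.norm_eq_abs, abs_of_pos (Real.exp_pos _),
      smul_eq_mul, exp_sq]
    ring
  rw [f1, norm_neg, f2]
  have f3 := fun j => f2 (X.ZbarTest j u)
  simp only [ZbarTest_coe] at f3
  simp only [f3]
  simpa only [norm_neg] using key

end TubeCR

end Fibre

/-! ### Frequency multipliers and the formal adjoint -/

section Global

open Filter Topology FourierTransform

/-- A Cauchy-Schwarz inequality for integrals, from a pointwise one. -/
lemma norm_integral_sq_le_of_norm_sq_le {α : Type*} [MeasurableSpace α] {μ : Measure α}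
    {f : α → ℂ} {a h : α → ℝ} (ha : Integrable a μ) (hh : Integrable h μ) (ha0 : ∀ x, 0 ≤ a x)
    (hh0 : ∀ x, 0 ≤ h x) (hle : ∀ x, ‖f x‖ ^ 2 ≤ a x * h x) :
    ‖∫ x, f x ∂μ‖ ^ 2 ≤ (∫ x, a x ∂μ) * ∫ x, h x ∂μ := by
  have hpt : ∀ (l : ℝ) (x), 2 * |l| * ‖f x‖ ≤ l ^ 2 * a x + h x := by
    intro l x
    have h1 : ‖f x‖ ≤ √(a x) * √(h x) := by
      rw [← Real.sqrt_mul (ha0 x)]; exact Real.le_sqrt_of_sq_le (hle x)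
    have h2 : 2 * |l| * ‖f x‖ ≤ 2 * |l| * (√(a x) * √(h x)) := by gcongr
    have h3 := two_mul_le_add_sq (|l| * √(a x)) (√(h x))
    rw [mul_pow, sq_abs, Real.sq_sqrt (ha0 x), Real.sq_sqrt (hh0 x)] at h3
    linarith
  have hint : ∀ l : ℝ, 2 * |l| * ‖∫ x, f x ∂μ‖ ≤ l ^ 2 * (∫ x, a x ∂μ) + ∫ x, h x ∂μ := by
    intro l
    have h1 : ‖∫ x, ((2 * |l| : ℝ) : ℂ) * f x ∂μ‖ ≤ ∫ x, (l ^ 2 * a x + h x) ∂μ :=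
      norm_integral_le_of_norm_le ((ha.const_mul _).fun_add hh) (.of_forall fun x => by
        rw [norm_mul, Complex.norm_real, Real.norm_of_nonneg (by positivity)]; exact hpt l x)
    rwa [integral_const_mul, norm_mul, Complex.norm_real, Real.norm_of_nonneg (by positivity),
      integral_add (ha.const_mul _) hh, integral_const_mul] at h1
  have hd := discrim_le_zero (a := ∫ x, a x ∂μ) (b := -2 * ‖∫ x, f x ∂μ‖) (c := ∫ x, h x ∂μ)
    fun l => by
      have := hint l
      nlinarith [mul_le_mul_of_nonneg_right (le_abs_self l) (norm_nonneg (∫ x, f x ∂μ))]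
  rw [discrim] at hd
  nlinarith

/-- An integrable function on `ℝ` is determined by its Fourier transform. -/
lemma ae_eq_zero_of_fourier_eq_zero {f : ℝ → ℂ} (hf : Integrable f) (h : ∀ x, 𝓕 f x = 0) :
    f =ᵐ[volume] 0 := by
  refine ae_eq_zero_of_integral_contDiff_smul_eq_zero hf.locallyIntegrable fun g hg hgc => ?_
  set s : SchwartzMap ℝ ℂ := HasCompactSupport.toSchwartzMap (f := fun x => (g x : ℂ))
    (hgc.comp_left (g := ((↑) : ℝ → ℂ)) Complex.ofReal_zero) hg.ofReal_comp with hs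
  have h1 := VectorFourier.integral_fourierIntegral_smul_eq_flip (μ := volume) (ν := volume)
    (e := 𝐞) (L := innerₗ ℝ) Real.continuous_fourierChar (by fun_prop) (𝓕⁻ s).integrable hf
  have h2 : VectorFourier.fourierIntegral 𝐞 volume (innerₗ ℝ) (𝓕⁻ s : SchwartzMap ℝ ℂ) = s := by
    have : ⇑(𝓕 (𝓕⁻ s) : SchwartzMap ℝ ℂ) = s := by
      rw [FourierTransform.fourier_fourierInv_eq]
    rw [← this]; rfl
  have h3 : VectorFourier.fourierIntegral 𝐞 volume (innerₗ ℝ).flip f = fun _ => 0 := by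
    rw [flip_innerₗ]; exact funext h
  rw [h2, h3] at h1
  simp only [smul_zero, integral_zero] at h1
  rw [← h1]
  refine integral_congr_ae (.of_forall fun x => ?_)
  simp only [hs, Complex.real_smul, smul_eq_mul]
  rfl

namespace TubeCR

variable {d : ℕ} (X : TubeCR d)

lemma integral_norm_sq_partialFourier (u : 𝓓(X.carrier, ℂ)) :
    ∫ x, ‖partialFourier u x‖ ^ 2 ∂X.measure = ∫ x, ‖u x‖ ^ 2 ∂X.measure := by
  rw [← norm_toLp_sq (X.memLp_partialFourier u), ← norm_toLp_sq (X.memLp_test u)]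
  exact congrArg (· ^ 2) (X.norm_fourierTest u)

lemma integral_norm_sq_toL2 (u : 𝓓(X.carrier, ℂ)) :
    ∫ x, ‖u x‖ ^ 2 ∂X.measure = ‖X.toL2 u‖ ^ 2 := (norm_toLp_sq (X.memLp_test u)).symm

lemma integral_norm_sq_smoothDbar (u : 𝓓(X.carrier, ℂ)) :
    ∫ x, ‖X.smoothDbar u x‖ ^ 2 ∂X.measure = ∑ j, ∫ x, ‖X.Zbar j u x‖ ^ 2 ∂X.measure := by
  rw [← integral_finsetSum]
  · simp only [smoothDbar, EuclideanSpace.norm_sq_eq]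
  · exact fun j _ => (X.memLp_test (X.ZbarTest j u)).norm.integrable_sq

lemma integrable_norm_sq_partialFourier (u : 𝓓(X.carrier, ℂ)) :
    Integrable (fun x => ‖partialFourier u x‖ ^ 2) (X.baseMeasure.prod volume) := by
  rw [← measure_eq_prod]; exact (X.memLp_partialFourier u).norm.integrable_sq

lemma integral_integral_norm_sq_partialFourier (u : 𝓓(X.carrier, ℂ)) :
    ∫ ξ, ∫ z, ‖partialFourier u (z, ξ)‖ ^ 2 ∂X.baseMeasure = ∫ x, ‖u x‖ ^ 2 ∂X.measure := by
  rw [← integral_norm_sq_partialFourier, measure_eq_prod,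
    integral_prod_symm _ (X.integrable_norm_sq_partialFourier u)]

variable {σ : ℝ → ℝ} (hσ : Continuous σ) (hb : ∀ ξ, ‖σ ξ‖ ≤ 1)

/-- The `L²` estimate for the positive frequencies: integrate the one at a fixed frequency. -/
lemma norm_inner_formalAdjoint_multiplier_sq_le
    (hX : X.base = univ ∨ IsBoundedStrictlyPseudoconvexDomain X.base)
    (hpsh : ∀ z ∈ X.base, (leviMatrix X.weight z).PosSemidef) (hσ0 : ∀ ξ < 0, σ ξ = 0)
    (u : 𝓓(X.carrier, ℂ)) (ψ : Fin d → 𝓓(X.carrier, ℂ)) :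
    ‖inner ℂ (X.toL2 (X.formalAdjoint ψ)) (X.multiplier σ hσ hb (X.toL2 u))‖ ^ 2
      ≤ 2 * (∫ x, ‖X.smoothDbar u x‖ ^ 2 ∂X.measure) * ‖X.toL2 (X.formalAdjoint ψ)‖ ^ 2 := by
  have i0 : Integrable (fun p : (Fin d → ℂ) × ℝ => (σ p.2 : ℂ) * (partialFourier u p
      * conj (partialFourier (X.formalAdjoint ψ) p))) (X.baseMeasure.prod volume) := by
    rw [← measure_eq_prod]
    exact X.integrable_symbol_mul ((X.memLp_partialFourier u).integrable_mul_conj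
      (X.memLp_partialFourier _)) hσ hb
  have iA : ∀ w : 𝓓(X.carrier, ℂ),
      Integrable fun ξ => ∫ z, ‖partialFourier w (z, ξ)‖ ^ 2 ∂X.baseMeasure := fun w =>
    (X.integrable_norm_sq_partialFourier w).integral_prod_right
  have eA : ∫ ξ, 2 * ∑ j, ∫ z, ‖partialFourier (X.ZbarTest j u) (z, ξ)‖ ^ 2 ∂X.baseMeasure
      = 2 * ∫ x, ‖X.smoothDbar u x‖ ^ 2 ∂X.measure := by
    rw [integral_const_mul, integral_finsetSum _ fun j _ => iA (X.ZbarTest j u),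
      integral_norm_sq_smoothDbar]
    exact congrArg (2 * ·) (Finset.sum_congr rfl fun j _ =>
      X.integral_integral_norm_sq_partialFourier (X.ZbarTest j u))
  have e0 : inner ℂ (X.toL2 (X.formalAdjoint ψ)) (X.multiplier σ hσ hb (X.toL2 u))
      = ∫ ξ, ∫ z, (σ ξ : ℂ) * (partialFourier u (z, ξ)
        * conj (partialFourier (X.formalAdjoint ψ) (z, ξ))) ∂X.baseMeasure := by
    rw [inner_toL2_multiplier_toL2, measure_eq_prod, integral_prod_symm _ i0]
  rw [e0, ← integral_norm_sq_toL2, ← integral_integral_norm_sq_partialFourier, ← eA]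
  refine norm_integral_sq_le_of_norm_sq_le
    ((integrable_finsetSum _ fun j _ => iA (X.ZbarTest j u)).const_mul 2)
    (iA _) (fun ξ => ?_) (fun ξ => by positivity) fun ξ => ?_
  · exact mul_nonneg zero_le_two (Finset.sum_nonneg fun j _ => by positivity)
  · simp only [integral_const_mul]
    rcases lt_or_ge ξ 0 with h | h
    · rw [hσ0 ξ h]
      simp only [Complex.ofReal_zero, zero_mul, norm_zero]
      rw [zero_pow two_ne_zero]
      exact mul_nonneg (mul_nonneg zero_le_two (Finset.sum_nonneg fun j _ => by positivity))
        (by positivity)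
    · rw [norm_mul, mul_pow, Complex.norm_real]
      refine (mul_le_of_le_one_left (by positivity) ?_).trans
        (X.norm_integral_partialFourier_sq_le hX hpsh h u ψ)
      exact pow_le_one₀ (norm_nonneg _) (hb ξ)

lemma norm_fourierL2 (x : X.L2) : ‖X.fourierL2 x‖ = ‖x‖ := by
  refine X.denseRange_toL2.induction_on x
    (isClosed_eq X.fourierL2.continuous.norm continuous_norm) fun u => ?_
  exact (congrArg norm (X.fourierL2_toL2 u)).trans (X.norm_fourierTest u)

lemma inner_fourierL2 (x y : X.L2) : inner ℂ (X.fourierL2 x) (X.fourierL2 y) = inner ℂ x y :=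
  LinearIsometry.inner_map_map ⟨(X.fourierL2 : X.L2 →ₗ[ℂ] X.L2), X.norm_fourierL2⟩ x y

/-- The translate `u(z, t + s)` of a test function. -/
def translateTest (s : ℝ) (u : 𝓓(X.carrier, ℂ)) : 𝓓(X.carrier, ℂ) :=
  ⟨fun x => u (x + (0, s)), u.contDiff.comp (contDiff_id.add contDiff_const),
    u.hasCompactSupport.comp_homeomorph (Homeomorph.addRight ((0, s) : (Fin d → ℂ) × ℝ)), by
    have h : tsupport (fun x => u (x + (0, s)))
        = (Homeomorph.addRight ((0, s) : (Fin d → ℂ) × ℝ)) ⁻¹' tsupport u :=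
      ((Homeomorph.addRight ((0, s) : (Fin d → ℂ) × ℝ)).preimage_closure (Function.support u)).symm
    rw [h]
    intro x hx
    have h1 := (u.tsupport_subset hx).1
    exact ⟨by simpa using h1, mem_univ _⟩⟩

lemma formalAdjoint_translateTest (s : ℝ) (ψ : Fin d → 𝓓(X.carrier, ℂ)) :
    X.formalAdjoint (fun j => X.translateTest s (ψ j))
      = X.translateTest s (X.formalAdjoint ψ) := by
  ext x
  change X.formalAdjointFun _ x = X.formalAdjointFun ψ (x + (0, s))
  have h1 : (x + (0, s)).1 = x.1 := add_zero x.1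
  have h2 : ∀ j, fderiv ℝ (X.translateTest s (ψ j)) x = fderiv ℝ (ψ j) (x + (0, s)) := fun j =>
    fderiv_comp_add_right (0, s)
  have h3 : ∀ j, X.translateTest s (ψ j) x = ψ j (x + (0, s)) := fun _ => rfl
  simp only [formalAdjointFun, conj_Zbar_conj, h1, h2, h3]

lemma partialFourier_translateTest (s : ℝ) (u : 𝓓(X.carrier, ℂ)) (x : (Fin d → ℂ) × ℝ) :
    partialFourier (X.translateTest s u) x = 𝐞 (s * x.2) • partialFourier u x := by
  rw [partialFourier_eq, partialFourier_eq, Circle.smul_def (𝐞 (s * x.2)), ← integral_smul,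
    ← integral_add_right_eq_self
      (fun t => ((𝐞 (s * x.2) : Circle) : ℂ) • 𝐞 (-(t * x.2)) • u (x.1, t)) s]
  refine integral_congr_ae (.of_forall fun t => ?_)
  have h : X.translateTest s u (x.1, t) = u (x.1, t + s) := by
    change u ((x.1, t) + (0, s)) = _
    simp
  have h2 : 𝐞 (-(t * x.2)) = 𝐞 (s * x.2) * 𝐞 (-((t + s) * x.2)) := by
    rw [← AddChar.map_add_eq_mul]; congr 1; ring
  simp only [h, h2, mul_smul]
  rfl

/-- The multipliers preserve the kernel of `∂̄_b`, since the orthogonal complement of this kernel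
is spanned by a translation invariant set of test functions. -/
lemma inner_formalAdjoint_multiplier_eq_zero {h : X.L2}
    (hh : ∀ ψ, inner ℂ (X.toL2 (X.formalAdjoint ψ)) h = 0) (ψ : Fin d → 𝓓(X.carrier, ℂ)) :
    inner ℂ (X.toL2 (X.formalAdjoint ψ)) (X.multiplier σ hσ hb h) = 0 := by
  set g := X.formalAdjoint ψ with hg
  set w : (Fin d → ℂ) × ℝ → ℂ := fun p => X.fourierL2 h p * conj (partialFourier g p) with hw
  have iw : Integrable w X.measure :=
    (Lp.memLp (X.fourierL2 h)).integrable_mul_conj (X.memLp_partialFourier g)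
  have iw' : Integrable w (X.baseMeasure.prod volume) := by rwa [← measure_eq_prod]
  -- the inner products of `h` with the translates of `g` form the Fourier transform of `W`
  set W : ℝ → ℂ := fun ξ => ∫ z, w (z, ξ) ∂X.baseMeasure with hW
  have iW : Integrable W := iw'.integral_prod_right
  have hF : ∀ s, 𝓕 W s = 0 := by
    intro s
    rw [← hh fun j => X.translateTest s (ψ j), formalAdjoint_translateTest, ← inner_fourierL2,
      L2.inner_def]
    have e1 : ∫ p, inner ℂ (X.fourierL2 (X.toL2 (X.translateTest s g)) p) (X.fourierL2 h p)
        ∂X.measure = ∫ p, 𝐞 (-(p.2 * s)) • w p ∂X.measure := by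
      refine integral_congr_ae ?_
      filter_upwards [X.coeFn_fourierL2_toL2 (X.translateTest s g)] with p hp
      rw [hp, partialFourier_translateTest, RCLike.inner_apply, hw]
      simp only [Circle.smul_def, smul_eq_mul, map_mul, AddChar.map_neg_eq_inv,
        Circle.coe_inv_eq_conj, mul_comm s]
      ring
    rw [e1, measure_eq_prod, integral_prod_symm, Real.fourier_real_eq]
    · exact integral_congr_ae (.of_forall fun ξ => by
        simp only [hW, Circle.smul_def, integral_smul])
    · have := (iw'.bdd_mul (c := 1) (f := fun p : (Fin d → ℂ) × ℝ => Circle.coeHom (𝐞 (-(p.2 * s))))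
        (Continuous.aestronglyMeasurable (continuous_induced_dom.comp
          (Real.continuous_fourierChar.comp (by fun_prop))))
        (.of_forall fun p => (Circle.norm_coe _).le))
      exact this
  have hW0 := ae_eq_zero_of_fourier_eq_zero iW hF
  rw [inner_multiplier]
  have e2 : ∫ p, (σ p.2 : ℂ) * (X.fourierL2 h p * conj (X.fourierL2 (X.toL2 g) p)) ∂X.measure
      = ∫ p, (σ p.2 : ℂ) * w p ∂X.measure := by
    refine integral_congr_ae ?_
    filter_upwards [X.coeFn_fourierL2_toL2 g] with p hp
    rw [hp]
  rw [e2, measure_eq_prod, integral_prod_symm]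
  · refine integral_eq_zero_of_ae ?_
    filter_upwards [hW0] with ξ hξ
    simp only [integral_const_mul]
    change _ * W ξ = 0
    rw [hξ]; simp
  · rw [← measure_eq_prod]; exact X.integrable_symbol_mul iw hσ hb

end TubeCR

end Global

/-! ### The kernel of the Kohn Laplacian and the closed range estimate -/

namespace TubeCR

variable {d : ℕ} (X : TubeCR d)

lemma dense_domain_dbar : Dense (X.dbar.domain : Set X.L2) :=
  X.denseRange_toL2.mono (range_subset_iff.2 fun u =>
    LinearPMap.mem_domain_of_mem_graph ((X.mem_graph_dbar _ _).2 (X.isWeakDbar_toL2 u)))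

lemma mem_graph_adjoint_dbar {f : X.L2Form} {w : X.L2} :
    (f, w) ∈ X.dbar.adjoint.graph ↔ ∀ v g, X.IsWeakDbar v g → inner ℂ w v = inner ℂ f g := by
  constructor
  · rintro h v g hvg
    obtain ⟨y, rfl, rfl⟩ := (LinearPMap.mem_graph_iff _).1 h
    obtain ⟨x, rfl, rfl⟩ := (LinearPMap.mem_graph_iff _).1 ((X.mem_graph_dbar v g).2 hvg)
    exact LinearPMap.adjoint_isFormalAdjoint X.dense_domain_dbar y x
  · intro h
    have h1 : ∀ x : X.dbar.domain, inner ℂ w (x : X.L2) = inner ℂ f (X.dbar x) := fun x =>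
      h _ _ ((X.mem_graph_dbar _ _).1 (LinearPMap.mem_graph _ x))
    exact (LinearPMap.mem_graph_iff _).2 ⟨⟨f, LinearPMap.mem_adjoint_domain_of_exists f ⟨w, h1⟩⟩,
      rfl, LinearPMap.adjoint_apply_eq X.dense_domain_dbar _ h1⟩

lemma mem_graph_kohnLaplacian {u w : X.L2} : (u, w) ∈ X.kohnLaplacian.graph ↔
    ∃ f, X.IsWeakDbar u f ∧ ∀ v g, X.IsWeakDbar v g → inner ℂ w v = inner ℂ f g := by
  have e : ∀ f, (∀ v g, X.IsWeakDbar v g → inner ℂ w v = inner ℂ f g)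
      ↔ (f, w) ∈ X.dbar.adjoint.graph := fun f => X.mem_graph_adjoint_dbar.symm
  simp only [e]
  simp only [← mem_graph_dbar]
  constructor
  · intro h
    obtain ⟨x, hx, hw⟩ := (LinearPMap.mem_graph_iff _).1 h
    have h1 : X.dbar.domRestrict _ x = X.dbar ⟨x, x.2.2⟩ := LinearPMap.domRestrict_apply rfl
    refine ⟨X.dbar.domRestrict _ x, ?_, ?_⟩
    · rw [h1, LinearPMap.mem_graph_iff]
      exact ⟨⟨x, x.2.2⟩, hx, rfl⟩
    · exact (LinearPMap.mem_graph_iff _).2 ⟨_, rfl, hw⟩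
  · rintro ⟨f, hf, hw⟩
    obtain ⟨y, hy, hyf⟩ := (LinearPMap.mem_graph_iff _).1 hf
    obtain ⟨y', hy', hw'⟩ := (LinearPMap.mem_graph_iff _).1 hw
    simp only at hy hyf hy' hw'
    subst hw'
    have hmem : X.dbar y ∈ X.dbar.adjoint.domain := by rw [hyf, ← hy']; exact y'.2
    refine (LinearPMap.mem_graph_iff _).2 ⟨⟨y, ⟨y, hmem, rfl⟩, y.2⟩, hy, ?_⟩
    change X.dbar.adjoint ⟨X.dbar.domRestrict _ _, _⟩ = X.dbar.adjoint y'
    congr 1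
    ext1
    rw [hy', ← hyf]
    exact LinearPMap.domRestrict_apply rfl

lemma mem_kohnKernel {u : X.L2} : u ∈ X.kohnKernel ↔ X.IsWeakDbar u 0 := by
  have h : u ∈ X.kohnKernel ↔ (u, 0) ∈ X.kohnLaplacian.graph := by
    rw [LinearPMap.mem_graph_iff, kohnKernel, Submodule.mem_map]
    exact ⟨fun ⟨x, hx, hxu⟩ => ⟨x, hxu, hx⟩, fun ⟨x, hxu, hx⟩ => ⟨x, hx, hxu⟩⟩
  rw [h, mem_graph_kohnLaplacian]
  constructor
  · rintro ⟨f, hf, hw⟩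
    have h0 := hw u f hf
    rw [inner_zero_left, eq_comm, inner_self_eq_zero] at h0
    rwa [h0] at hf
  · exact fun hu => ⟨0, hu, fun v g _ => by rw [inner_zero_left, inner_zero_left]⟩

/-- The range of the formal adjoint of `∂̄_b` on test forms. -/
def formalAdjointRange : Submodule ℂ X.L2 := LinearMap.range (X.toL2Linear ∘ₗ X.formalAdjoint)

lemma mem_orthogonal_formalAdjointRange {u : X.L2} : u ∈ X.formalAdjointRangeᗮ ↔
    ∀ ψ, inner ℂ (X.toL2 (X.formalAdjoint ψ)) u = 0 := by
  rw [Submodule.mem_orthogonal, formalAdjointRange]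
  exact ⟨fun h ψ => h _ (LinearMap.mem_range_self _ ψ), fun h _ ⟨ψ, hψ⟩ => hψ ▸ h ψ⟩

lemma kohnKernel_eq : X.kohnKernel = X.formalAdjointRangeᗮ := by
  ext u
  rw [mem_kohnKernel, mem_orthogonal_formalAdjointRange]
  refine ⟨fun h ψ => ?_, X.isWeakDbar_zero⟩
  rw [← X.inner_testForm_of_isWeakDbar h, inner_zero_right]

lemma topologicalClosure_kohnKernel : X.kohnKernel.topologicalClosure = X.formalAdjointRangeᗮ := by
  rw [kohnKernel_eq]
  exact (Submodule.isClosed_orthogonal _).submodule_topologicalClosure_eq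

lemma szego_mem (u : X.L2) : X.szego u ∈ X.formalAdjointRangeᗮ := by
  rw [← topologicalClosure_kohnKernel]
  exact Submodule.starProjection_apply_mem _ u

lemma sub_szego_mem (u : X.L2) : u - X.szego u ∈ X.formalAdjointRangeᗮᗮ := by
  rw [← topologicalClosure_kohnKernel]
  exact Submodule.sub_starProjection_mem_orthogonal u

/-- The `L²` estimate for `Q(I - Π)`, by duality: `Q(I - Π)u` lies in the closure of the range of
the formal adjoint, and pairs with this range as `Qu` does. -/
lemma norm_multiplier_sub_szego_sq_le {σ : ℝ → ℝ} (hσ : Continuous σ) (hb : ∀ ξ, ‖σ ξ‖ ≤ 1)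
    (hX : X.base = univ ∨ IsBoundedStrictlyPseudoconvexDomain X.base)
    (hpsh : ∀ z ∈ X.base, (leviMatrix X.weight z).PosSemidef) (hσ0 : ∀ ξ < 0, σ ξ = 0)
    (u : 𝓓(X.carrier, ℂ)) :
    ‖X.multiplier σ hσ hb (X.toL2 u - X.szego (X.toL2 u))‖ ^ 2
      ≤ 2 * ∫ x, ‖X.smoothDbar u x‖ ^ 2 ∂X.measure := by
  set Q := X.multiplier σ hσ hb with hQ
  set v := Q (X.toL2 u - X.szego (X.toL2 u)) with hv
  have hQN : ∀ n ∈ X.formalAdjointRangeᗮ, Q n ∈ X.formalAdjointRangeᗮ := fun n hn =>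
    X.mem_orthogonal_formalAdjointRange.2 (X.inner_formalAdjoint_multiplier_eq_zero hσ hb
      (X.mem_orthogonal_formalAdjointRange.1 hn))
  have hmem : v ∈ X.formalAdjointRangeᗮᗮ := by
    rw [Submodule.mem_orthogonal]
    intro n hn
    rw [hv, hQ, ← inner_multiplier_comm]
    exact (Submodule.mem_orthogonal _ _).1 (X.sub_szego_mem _) _ (hQN n hn)
  have hle : ∀ r ∈ X.formalAdjointRange, ‖inner ℂ r v‖ ^ 2
      ≤ 2 * (∫ x, ‖X.smoothDbar u x‖ ^ 2 ∂X.measure) * ‖r‖ ^ 2 := by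
    rintro _ ⟨ψ, rfl⟩
    have h0 : inner ℂ (X.toL2 (X.formalAdjoint ψ)) (Q (X.szego (X.toL2 u))) = 0 :=
      X.mem_orthogonal_formalAdjointRange.1 (hQN _ (X.szego_mem _)) ψ
    have h1 := X.norm_inner_formalAdjoint_multiplier_sq_le hσ hb hX hpsh hσ0 u ψ
    have e : inner ℂ ((X.toL2Linear ∘ₗ X.formalAdjoint) ψ) v
        = inner ℂ (X.toL2 (X.formalAdjoint ψ)) (Q (X.toL2 u)) := by
      rw [hv, map_sub, inner_sub_right]
      exact (congrArg (_ - ·) h0).trans (sub_zero _)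
    rw [e]
    exact h1
  rw [Submodule.orthogonal_orthogonal_eq_closure] at hmem
  have hself : ‖inner ℂ v v‖ ^ 2
      ≤ 2 * (∫ x, ‖X.smoothDbar u x‖ ^ 2 ∂X.measure) * ‖v‖ ^ 2 := by
    have hcl : IsClosed {r : X.L2 | ‖inner ℂ r v‖ ^ 2
        ≤ 2 * (∫ x, ‖X.smoothDbar u x‖ ^ 2 ∂X.measure) * ‖r‖ ^ 2} :=
      isClosed_le (by fun_prop) (by fun_prop)
    exact closure_minimal hle hcl hmem
  rw [inner_self_eq_norm_sq_to_K, norm_pow, RCLike.norm_ofReal, abs_norm] at hself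
  rcases (norm_nonneg v).eq_or_lt with h | h
  · rw [← h, zero_pow two_ne_zero]
    exact mul_nonneg zero_le_two (by positivity)
  · nlinarith [pow_pos h 2]

lemma norm_testForm_sq (u : 𝓓(X.carrier, ℂ)) :
    (inner ℂ (X.testForm fun j => X.ZbarTest j u) (X.testForm fun j => X.ZbarTest j u)).re
      = ∫ x, ‖X.smoothDbar u x‖ ^ 2 ∂X.measure := by
  rw [L2.inner_def, ← Complex.ofReal_re (∫ x, ‖X.smoothDbar u x‖ ^ 2 ∂X.measure),
    ← integral_complex_ofReal]
  congr 1
  refine integral_congr_ae ?_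
  filter_upwards [X.coeFn_testForm fun j => X.ZbarTest j u] with x hx
  rw [hx, inner_self_eq_norm_sq_to_K]
  simp [smoothDbar, ZbarTest_coe]

lemma isKohnPow_one_toL2 (u : 𝓓(X.carrier, ℂ)) :
    X.IsKohnPow 1 (X.toL2 u) (X.toL2 (X.formalAdjoint fun j => X.ZbarTest j u)) :=
  ⟨X.toL2 u, rfl, X.mem_graph_kohnLaplacian.2 ⟨_, X.isWeakDbar_toL2 u, fun _ _ h =>
    (X.inner_testForm_of_isWeakDbar h _).symm⟩⟩

/-- `(□_b u | u) = ‖∂̄_b u‖²` for test functions. -/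
lemma inner_formalAdjoint_ZbarTest (u : 𝓓(X.carrier, ℂ)) :
    (inner ℂ (X.toL2 (X.formalAdjoint fun j => X.ZbarTest j u)) (X.toL2 u)).re
      = ∫ x, ‖X.smoothDbar u x‖ ^ 2 ∂X.measure := by
  rw [← X.inner_testForm_of_isWeakDbar (X.isWeakDbar_toL2 u), norm_testForm_sq]

lemma IsFrequencyCutoff.unique {τ : ℝ → ℝ} {Q₁ Q₂ : X.L2 →L[ℂ] X.L2}
    (h₁ : X.IsFrequencyCutoff τ Q₁) (h₂ : X.IsFrequencyCutoff τ Q₂) : Q₁ = Q₂ := by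
  refine ContinuousLinearMap.ext fun x => congrFun (X.denseRange_toL2.equalizer Q₁.continuous
    Q₂.continuous (funext fun u => Lp.ext ((h₁ u).trans (h₂ u).symm))) x

lemma isFrequencyCutoff_multiplier {τ : ℝ → ℝ} (hσ : Continuous fun ξ => τ (2 * Real.pi * ξ))
    (hb : ∀ ξ, ‖τ (2 * Real.pi * ξ)‖ ≤ 1) :
    X.IsFrequencyCutoff τ (X.multiplier _ hσ hb) := fun u => by
  refine (X.coeFn_multiplier_toL2 hσ hb u).trans (.of_forall fun x => ?_)
  exact (frequencyCutoff_eq τ u x).symm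

end TubeCR

end

theorem theorem7p3 (n : ℕ) (hn : 2 ≤ n) (X : TubeCR (n - 1))
    (hsmooth : ∃ Γ' : Set (Fin (n - 1) → ℂ), IsOpen Γ' ∧ closure X.base ⊆ Γ' ∧
      ContDiffOn ℝ ∞ X.weight Γ')
    (hpsh : ∀ z ∈ X.base, (leviMatrix X.weight z).PosSemidef)
    (hbase : (X.base = Set.univ ∧ ∀ z, 0 ≤ X.weight z) ∨
      IsBoundedStrictlyPseudoconvexDomain X.base)
    (τ : ℝ → ℝ) (hτ : ContDiff ℝ ∞ τ) (hτ_mem : ∀ η, τ η ∈ Set.Icc (0 : ℝ) 1)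
    (hτ_zero : ∀ η ≤ 1 / 4, τ η = 0) (hτ_one : ∀ η, 1 / 2 ≤ η → τ η = 1) :
    (∃! Q : X.L2 →L[ℂ] X.L2, X.IsFrequencyCutoff τ Q) ∧
      ∀ Q : X.L2 →L[ℂ] X.L2, X.IsFrequencyCutoff τ Q →
        (∃ C₀ : ℝ, 0 < C₀ ∧ ∀ u : 𝓓(X.carrier, ℂ),
          ‖Q (X.toL2 u - X.szego (X.toL2 u))‖ ^ 2 ≤
            C₀ * ∫ x, ‖X.smoothDbar u x‖ ^ 2 ∂X.measure) ∧
        X.HasLocalL2ClosedRange Q X.carrier := by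
  have hσ : Continuous fun ξ => τ (2 * Real.pi * ξ) := hτ.continuous.comp (by fun_prop)
  have hb : ∀ ξ, ‖τ (2 * Real.pi * ξ)‖ ≤ 1 := fun ξ => by
    rw [Real.norm_of_nonneg (hτ_mem _).1]; exact (hτ_mem _).2
  have hσ0 : ∀ ξ < 0, τ (2 * Real.pi * ξ) = 0 := fun ξ hξ =>
    hτ_zero _ (by nlinarith [Real.pi_pos])
  have hQ := X.isFrequencyCutoff_multiplier hσ hb
  have hX := hbase.imp_left And.left
  refine ⟨⟨_, hQ, fun Q' hQ' => hQ'.unique X hQ⟩, fun Q hQ' => ?_⟩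
  obtain rfl := hQ'.unique X hQ
  have main := X.norm_multiplier_sub_szego_sq_le hσ hb hX hpsh hσ0
  refine ⟨⟨2, two_pos, main⟩, fun _ _ _ _ => ⟨2, two_pos, 1, le_rfl, fun u _ =>
    ⟨_, X.isKohnPow_one_toL2 u, ?_⟩⟩⟩
  rw [X.inner_formalAdjoint_ZbarTest]
  exact main u
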